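/- Let $(\mathcal A,\mathcal E)$ be an exact category in the sense of Quillen: $\mathcal A$ is additive and $\mathcal E$ is a class of sequences $a'\to a\to a''$ (the admissible short exact sequences; their first and second maps are the admissible monomorphisms and admissible epimorphisms), closed under isomorphism, consisting of kernel–cokernel pairs, containing the split sequences $a'\to a'\oplus a''\to a''$, and such that admissible epimorphisms (monomorphisms) are closed under composition and under base change (cobase change) along arbitrary morphisms, which are required to exist, and a morphism $f$ that has a kernel (cokernel) is an admissible epimorphism (monomorphism) as soon as some composite $f\circ e$ (respectively $e\circ f$) is one. Let $\Pi=\{(i,j)\in\mathbb Z^2 : i\le j\}$ with the componentwise order. A functor $X:\Pi\to\mathcal A$ is admissible if $X_{i,j}\to X_{i,k}\to X_{j,k}$ is in $\mathcal E$ for all $i\le j\le k$. The Beilinson category $\underleftrightarrow{\lim}\,\mathcal A$ is the localization of the category of admissible functors at the morphisms $(X_{\varphi(i),\varphi(j)})\to(X_{\psi(i),\psi(j)})$, where $X$ is admissible and $\varphi\le\psi$ are nondecreasing maps $\mathbb Z\to\mathbb Z$ tending to $\pm\infty$ at $\pm\infty$. Call a sequence in $\mathrm{Ind}(\mathcal C)$,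 where $\mathcal C$ is equipped with a class of admissible sequences, admissible if it is isomorphic to the formal inductive limit, over a small filtered category, of a diagram of admissible sequences of $\mathcal C$; dually for $\mathrm{Pro}(\mathcal C)=\mathrm{Ind}(\mathcal C^{op})^{op}$. This defines the admissible sequences of $\mathrm{Ind}\,\mathrm{Pro}(\mathcal A)$, starting from $\mathcal E$. Then $\underleftrightarrow{\lim}\,\mathcal A$ has a natural structure of an exact category. Precisely: (1) $\mathrm{Ind}\,\mathrm{Pro}(\mathcal A)$ with its admissible sequences is an exact category. (2) $\underleftrightarrow{\lim}\,\mathcal A$ carries an additive structure for which the localization functor is additive, and the functor $X\mapsto \text{“}\varinjlim_j\text{”}\,\text{“}\varprojlim_{i\le j}\text{”}\,X_{i,j}$ from admissible functors to $\mathrm{Ind}\,\mathrm{Pro}(\mathcal A)$ factors, up to isomorphism, through a fully faithful additive functor $\iota:\underleftrightarrow{\lim}\,\mathcal A\to\mathrm{Ind}\,\mathrm{Pro}(\mathcal A)$. (3) The essential image of $\iota$ is closed under extensions: if $\iota X\to Y\to\iota Z$ is an admissible sequence of $\mathrm{Ind}\,\mathrm{Pro}(\mathcal A)$, then $Y$ is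 isomorphic to $\iota Y'$ for some $Y'$. (4) $\underleftrightarrow{\lim}\,\mathcal A$, with the class of all sequences $X\to Y\to Z$ whose image $\iota X\to\iota Y\to\iota Z$ is an admissible sequence of $\mathrm{Ind}\,\mathrm{Pro}(\mathcal A)$, is an exact category. -/

import Mathlib

open CategoryTheory CategoryTheory.Limits Opposite

universe v u

noncomputable section

namespace Beilinson

/-! ### Exact categories -/

/-- A class of sequences `X ⟶ Y ⟶ Z` in a category. -/
abbrev SequenceClass (C : Type u) [Category.{v} C] :=
  ∀ ⦃X Y Z : C⦄, (X ⟶ Y) → (Y ⟶ Z) → Prop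

/-- Isomorphism of the sequences `(f, g)` and `(f', g')`. -/
def SequenceIso {C : Type u} [Category.{v} C] {X Y Z X' Y' Z' : C}
    (f : X ⟶ Y) (g : Y ⟶ Z) (f' : X' ⟶ Y') (g' : Y' ⟶ Z') : Prop :=
  ∃ (a : X ≅ X') (b : Y ≅ Y') (c : Z ≅ Z'),
    f ≫ b.hom = a.hom ≫ f' ∧ g ≫ c.hom = b.hom ≫ g'

namespace SequenceClass

variable {C : Type u} [Category.{v} C] (S : SequenceClass C)

/-- Admissible monomorphisms: the first maps of the sequences of the class. -/
def AdmissibleMono {X Y : C} (f : X ⟶ Y) : Prop :=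
  ∃ (Z : C) (g : Y ⟶ Z), S f g

/-- Admissible epimorphisms: the second maps of the sequences of the class. -/
def AdmissibleEpi {Y Z : C} (g : Y ⟶ Z) : Prop :=
  ∃ (X : C) (f : X ⟶ Y), S f g

/-- The class of the opposite sequences, in the opposite category. -/
def op : SequenceClass Cᵒᵖ :=
  fun _ _ _ f g => S g.unop f.unop

/-- The preimage of a class of sequences under a functor. -/
def preimage {D : Type*} [Category* D] (F : D ⥤ C) : SequenceClass D :=
  fun _ _ _ f g => S (F.map f) (F.map g)

end SequenceClass

/-- `(C, S)` is an exact category in the sense of Quillen: `C` is additive, and `S` is the class of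
admissible short exact sequences. -/
structure IsExactStructure (C : Type u) [Category.{v} C] [Preadditive C]
    (S : SequenceClass C) : Prop where
  hasFiniteBiproducts : HasFiniteBiproducts C
  of_iso : ∀ {X Y Z X' Y' Z' : C} {f : X ⟶ Y} {g : Y ⟶ Z} {f' : X' ⟶ Y'} {g' : Y' ⟶ Z'},
    SequenceIso f g f' g' → S f g → S f' g'
  kernel_cokernel : ∀ {X Y Z : C} {f : X ⟶ Y} {g : Y ⟶ Z}, S f g →
    ∃ w : f ≫ g = 0, Nonempty (IsLimit (KernelFork.ofι f w)) ∧
      Nonempty (IsColimit (CokernelCofork.ofπ g w))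
  split : ∀ {X Z : C} (b : BinaryBicone X Z), b.IsBilimit → S b.inl b.snd
  epi_comp : ∀ {X Y Z : C} {f : X ⟶ Y} {g : Y ⟶ Z},
    S.AdmissibleEpi f → S.AdmissibleEpi g → S.AdmissibleEpi (f ≫ g)
  mono_comp : ∀ {X Y Z : C} {f : X ⟶ Y} {g : Y ⟶ Z},
    S.AdmissibleMono f → S.AdmissibleMono g → S.AdmissibleMono (f ≫ g)
  epi_pullback : ∀ {X Y Z : C} {g : X ⟶ Z}, S.AdmissibleEpi g → ∀ f : Y ⟶ Z,
    ∃ (P : C) (f' : P ⟶ X) (g' : P ⟶ Y), IsPullback f' g' g f ∧ S.AdmissibleEpi g'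
  mono_pushout : ∀ {X Y Z : C} {g : Z ⟶ X}, S.AdmissibleMono g → ∀ f : Z ⟶ Y,
    ∃ (P : C) (f' : X ⟶ P) (g' : Y ⟶ P), IsPushout g f f' g' ∧ S.AdmissibleMono g'
  epi_of_comp : ∀ {X Y Z : C} (e : X ⟶ Y) (f : Y ⟶ Z), HasKernel f →
    S.AdmissibleEpi (e ≫ f) → S.AdmissibleEpi f
  mono_of_comp : ∀ {X Y Z : C} (f : X ⟶ Y) (e : Y ⟶ Z), HasCokernel f →
    S.AdmissibleMono (f ≫ e) → S.AdmissibleMono f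

/-! ### Ind- and pro-objects -/

/-- The category of pro-objects, `Pro(C) = Ind(Cᵒᵖ)ᵒᵖ`. -/
abbrev Pro (C : Type u) [Category.{v} C] : Type (max u (v + 1)) := (Ind Cᵒᵖ)ᵒᵖ

/-- The category `Ind Pro(C)`. -/
abbrev IndPro (C : Type u) [Category.{v} C] : Type (max u (v + 1)) := Ind (Pro C)

/-- The formal projective limit, as a functor of the diagram. -/
def proLim (C : Type u) [Category.{v} C] (J : Type v) [SmallCategory J] [IsCofiltered J] :
    (J ⥤ C) ⥤ Pro C :=
  opOp (J ⥤ C) ⋙ (Functor.opHom J C).op ⋙ (Ind.lim (C := Cᵒᵖ) Jᵒᵖ).op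

/-- The sequences in `Ind(C)` that are isomorphic to the formal inductive limit, over a small
filtered category, of a diagram of sequences of the class `S`. -/
def SequenceClass.ind {C : Type u} [Category.{v} C] (S : SequenceClass C) :
    SequenceClass (Ind C) :=
  fun _ _ _ f g =>
    ∃ (I : Type v) (_ : SmallCategory I) (_ : IsFiltered I) (F G H : I ⥤ C)
      (α : F ⟶ G) (β : G ⟶ H),
      (∀ i, S (α.app i) (β.app i)) ∧
        SequenceIso ((Ind.lim I).map α) ((Ind.lim I).map β) f g

/-- The sequences in `Pro(C)` that are isomorphic to the formal projective limit, over a small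
cofiltered category, of a diagram of sequences of the class `S`. -/
def SequenceClass.pro {C : Type u} [Category.{v} C] (S : SequenceClass C) :
    SequenceClass (Pro C) :=
  S.op.ind.op

/-! ### The Beilinson category -/

/-- The preorder of the pairs of integers `(i, j)` with `i ≤ j`, ordered componentwise. -/
abbrev Pairs : Type := {p : ℤ × ℤ // p.1 ≤ p.2}

/-- The pair `(i, j)`. -/
abbrev pair (i j : ℤ) (h : i ≤ j) : Pairs := ⟨(i, j), h⟩

/-- The structure morphism `X_{i,j} ⟶ X_{i',j'}` of a diagram on `Pairs`. -/
abbrev str {A : Type u} [Category.{v} A] (X : Pairs ⥤ A) {i j i' j' : ℤ} (h : i ≤ j)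
    (h' : i' ≤ j') (hi : i ≤ i') (hj : j ≤ j') : X.obj (pair i j h) ⟶ X.obj (pair i' j' h') :=
  X.map (homOfLE (show pair i j h ≤ pair i' j' h' from ⟨hi, hj⟩))

/-- A diagram `X` is admissible if `X_{i,j} ⟶ X_{i,k} ⟶ X_{j,k}` belongs to the class `E` for all
`i ≤ j ≤ k`. -/
def admissible {A : Type u} [Category.{v} A] (E : SequenceClass A) :
    ObjectProperty (Pairs ⥤ A) :=
  fun X => ∀ (i j k : ℤ) (hij : i ≤ j) (hjk : j ≤ k),
    E (str X hij (hij.trans hjk) le_rfl hjk) (str X (hij.trans hjk) hjk hij le_rfl)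

/-- The category of admissible diagrams. -/
abbrev AdmDiagram {A : Type u} [Category.{v} A] (E : SequenceClass A) :=
  (admissible E).FullSubcategory

/-- A nondecreasing map `ℤ → ℤ` is bicofinal if it tends to `±∞` at `±∞`. -/
def Bicofinal (φ : ℤ →o ℤ) : Prop :=
  Filter.Tendsto φ Filter.atTop Filter.atTop ∧ Filter.Tendsto φ Filter.atBot Filter.atBot

/-- The endofunctor `(i, j) ↦ (φ i, φ j)` of `Pairs`. -/
def tilde (φ : ℤ →o ℤ) : Pairs ⥤ Pairs :=
  Monotone.functor (f := fun p : Pairs => pair (φ p.1.1) (φ p.1.2) (φ.monotone p.2))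
    fun _ _ h => ⟨φ.monotone h.1, φ.monotone h.2⟩

/-- The natural transformation between the endofunctors given by `φ ≤ ψ`. -/
def tildeMap {φ ψ : ℤ →o ℤ} (h : φ ≤ ψ) : tilde φ ⟶ tilde ψ where
  app p := homOfLE (show (tilde φ).obj p ≤ (tilde ψ).obj p from ⟨h p.1.1, h p.1.2⟩)

variable {A : Type u} [Category.{v} A] (E : SequenceClass A)

variable {E} in
/-- The reindexed diagram `X_{φ i, φ j}`. -/
def reindex (X : AdmDiagram E) (φ : ℤ →o ℤ) : AdmDiagram E where
  obj := tilde φ ⋙ X.obj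
  property i j k hij hjk := X.property (φ i) (φ j) (φ k) (φ.monotone hij) (φ.monotone hjk)

variable {E} in
/-- The morphism `X_{φ i, φ j} ⟶ X_{ψ i, ψ j}` for `φ ≤ ψ`. -/
def reindexMap (X : AdmDiagram E) {φ ψ : ℤ →o ℤ} (h : φ ≤ ψ) : reindex X φ ⟶ reindex X ψ :=
  ObjectProperty.homMk (Functor.whiskerRight (tildeMap h) X.obj)

/-- The class of the morphisms `X_{φ i, φ j} ⟶ X_{ψ i, ψ j}` with `φ ≤ ψ` bicofinal. -/
inductive IsReindexMap : ∀ ⦃X Y : AdmDiagram E⦄, (X ⟶ Y) → Prop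
  | mk (X : AdmDiagram E) (φ ψ : ℤ →o ℤ) (hφ : Bicofinal φ) (hψ : Bicofinal ψ) (h : φ ≤ ψ) :
      IsReindexMap (reindexMap X h)

/-- The same class, as a property of morphisms. -/
def reindexMaps : MorphismProperty (AdmDiagram E) := IsReindexMap E

/-- The Beilinson category: the localization of the category of admissible diagrams at the
reindexing morphisms. -/
abbrev BeilinsonCategory := (reindexMaps E).Localization

/-- The localization functor. -/
abbrev toBeilinson : AdmDiagram E ⥤ BeilinsonCategory E := (reindexMaps E).Q

/-! ### The functor to `Ind Pro(A)` -/

/-- The functor `j ↦ (i ↦ (min i j, j))`: in a diagram on `Pairs`, the projective system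
`(X_{i,j})_{i ≤ j}` with `j` fixed is extended by the constant value `X_{j,j}` to all integers `i`,
which does not change its formal projective limit. -/
def extend : ULift.{v} ℤ ⥤ ULift.{v} ℤ ⥤ Pairs where
  obj j := Monotone.functor
    (f := fun i : ULift.{v} ℤ => pair (min i.down j.down) j.down (min_le_right _ _))
    fun _ _ h => ⟨min_le_min_right _ h, le_rfl⟩
  map {j j'} f :=
    have h : j.down ≤ j'.down := (leOfHom f : j ≤ j')
    { app := fun _ => homOfLE ⟨min_le_min_left _ h, h⟩ }

/-- The functor `X ↦ “colim”_j “lim”_i X_{i,j}` from diagrams on `Pairs` to `Ind Pro(A)`. -/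
def indProLim (A : Type u) [Category.{v} A] : (Pairs ⥤ A) ⥤ IndPro A where
  obj X := (Ind.lim (ULift.{v} ℤ)).obj
    (extend.{v} ⋙ (Functor.whiskeringRight _ _ _).obj X ⋙ proLim A (ULift.{v} ℤ))
  map f := (Ind.lim (ULift.{v} ℤ)).map
    (Functor.whiskerLeft extend.{v}
      (Functor.whiskerRight ((Functor.whiskeringRight _ _ _).map f) (proLim A (ULift.{v} ℤ))))
  map_id X := by
    rw [← (Ind.lim (ULift.{v} ℤ)).map_id]
    congr 1
    ext j
    simp
  map_comp f g := by
    rw [← (Ind.lim (ULift.{v} ℤ)).map_comp]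
    congr 1
    ext j
    simp

end Beilinson

end

/-!
A sequence in `Ind C` is tested on generalized elements, the morphisms from representable objects:
it is admissible if and only if it is left exact on elements and elements of the last term lift
locally, after restriction along an admissible epimorphism of `C`. The axioms of an exact category
for `Ind C` are then arguments on elements, and those for `Pro C` follow by duality.

For an admissible diagram `X`, the pro-objects `“lim”_i X_{i,j}` form an increasing filtration of
`“colim”_j “lim”_i X_{i,j}` with successive quotients in `A`. A morphism between two such
ind-pro-objects is given, on each step of the filtrations, by morphisms `X_{φ i, φ j} ⟶ Y_{i,j}` for
some bicofinal `φ`, so it is a fraction whose denominator is a reindexing map; this gives full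
faithfulness.

For an extension `Y` of two such ind-pro-objects, a lattice in `Y` is a subobject that is an
extension of a step of one filtration by a step of the other. Every lattice contains a smaller one
and lies in a larger one, so there is a chain of lattices, indexed by `ℤ`, which exhausts `Y` and
such that every morphism from one of them to an object of `A` vanishes on a smaller one. The
quotients of the chain lie in `A` and form an admissible diagram, whose ind-pro-object is `Y`. Hence
the essential image is closed under extensions, and the exact structure of `Ind Pro(A)` restricts to
it.
-/

noncomputable section

namespace Beilinson

/-! ### Generalized elements of ind-objects -/

namespace IndObj

variable {C : Type u} [Category.{v} C]

/-- Maps out of a representable ind-object are the sections of the underlying presheaf. -/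
def coyonedaYonedaIso (c : C) :
    coyoneda.obj (op (Ind.yoneda.obj c)) ≅ Ind.inclusion C ⋙ (evaluation _ _).obj (op c) :=
  NatIso.ofComponents
    (fun X => (Ind.inclusion.fullyFaithful.homEquiv.trans
      ((Iso.homCongr (Ind.yonedaCompInclusion.app c) (Iso.refl ((Ind.inclusion C).obj X))).trans
        yonedaEquiv)).toIso)
    (fun _ => by ext; simp [yonedaEquiv, Functor.FullyFaithful.homEquiv])

instance (c : C) (I : Type v) [SmallCategory I] [IsFiltered I] :
    PreservesColimitsOfShape I (coyoneda.obj (op (Ind.yoneda.obj c))) :=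
  preservesColimitsOfShape_of_natIso (coyonedaYonedaIso c).symm

section lim

variable {I : Type v} [SmallCategory I] [IsFiltered I]

/-- The structure maps of a formal inductive limit. -/
def limι (F : I ⥤ C) (i : I) : Ind.yoneda.obj (F.obj i) ⟶ (Ind.lim I).obj F :=
  colimit.ι (F ⋙ Ind.yoneda) i

@[simp]
lemma map_limι (F : I ⥤ C) {i j : I} (s : i ⟶ j) :
    Ind.yoneda.map (F.map s) ≫ limι F j = limι F i :=
  colimit.w (F ⋙ Ind.yoneda) s

@[simp]
lemma map_limι_assoc (F : I ⥤ C) {i j : I} (s : i ⟶ j) {X : Ind C}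
    (f : (Ind.lim I).obj F ⟶ X) : Ind.yoneda.map (F.map s) ≫ limι F j ≫ f = limι F i ≫ f := by
  rw [← Category.assoc, map_limι]

@[simp]
lemma limι_map {F G : I ⥤ C} (α : F ⟶ G) (i : I) :
    limι F i ≫ (Ind.lim I).map α = Ind.yoneda.map (α.app i) ≫ limι G i := by
  simp [limι, Ind.lim]

@[simp]
lemma limι_map_assoc {F G : I ⥤ C} (α : F ⟶ G) (i : I) {X : Ind C}
    (f : (Ind.lim I).obj G ⟶ X) :
    limι F i ≫ (Ind.lim I).map α ≫ f = Ind.yoneda.map (α.app i) ≫ limι G i ≫ f := by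
  rw [← Category.assoc, limι_map, Category.assoc]

/-- The morphism from a formal inductive limit given by a compatible family. -/
def limDesc {F : I ⥤ C} {X : Ind C} (τ : ∀ i, Ind.yoneda.obj (F.obj i) ⟶ X)
    (h : ∀ {i j : I} (s : i ⟶ j), Ind.yoneda.map (F.map s) ≫ τ j = τ i) :
    (Ind.lim I).obj F ⟶ X :=
  colimit.desc (F ⋙ Ind.yoneda) ⟨X, { app := τ, naturality := fun i j s => by simpa using h s }⟩

@[simp]
lemma limι_limDesc {F : I ⥤ C} {X : Ind C} (τ : ∀ i, Ind.yoneda.obj (F.obj i) ⟶ X)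
    (h : ∀ {i j : I} (s : i ⟶ j), Ind.yoneda.map (F.map s) ≫ τ j = τ i) (i : I) :
    limι F i ≫ limDesc τ h = τ i :=
  colimit.ι_desc (F := F ⋙ Ind.yoneda) _ i

lemma lim_hom_ext {F : I ⥤ C} {X : Ind C} {f g : (Ind.lim I).obj F ⟶ X}
    (h : ∀ i, limι F i ≫ f = limι F i ≫ g) : f = g :=
  colimit.hom_ext (F := F ⋙ Ind.yoneda) h

lemma exists_eq_map_comp_limι {F : I ⥤ C} {c : C} (t : Ind.yoneda.obj c ⟶ (Ind.lim I).obj F) :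
    ∃ (i : I) (a : c ⟶ F.obj i), t = Ind.yoneda.map a ≫ limι F i := by
  obtain ⟨i, s, hs⟩ := Types.jointly_surjective _
    (isColimitOfPreserves (coyoneda.obj (op (Ind.yoneda.obj c)))
      (colimit.isColimit (F ⋙ Ind.yoneda))) t
  obtain ⟨a, rfl⟩ := Ind.yoneda.map_surjective s
  exact ⟨i, a, hs.symm⟩

lemma exists_comp_map_eq {F : I ⥤ C} {c : C} {i : I} {a b : c ⟶ F.obj i}
    (h : Ind.yoneda.map a ≫ limι F i = Ind.yoneda.map b ≫ limι F i) :
    ∃ (j : I) (s : i ⟶ j), a ≫ F.map s = b ≫ F.map s := by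
  obtain ⟨k, s, t, hst⟩ := (Types.FilteredColimit.isColimit_eq_iff _
    (isColimitOfPreserves (coyoneda.obj (op (Ind.yoneda.obj c)))
      (colimit.isColimit (F ⋙ Ind.yoneda))) (i := i) (j := i)
      (xi := Ind.yoneda.map a) (xj := Ind.yoneda.map b)).1 h
  have hst' : a ≫ F.map s = b ≫ F.map t := Ind.yoneda.map_injective (by simpa using hst)
  refine ⟨IsFiltered.coeq s t, s ≫ IsFiltered.coeqHom s t, ?_⟩
  rw [F.map_comp, reassoc_of% hst', ← F.map_comp, ← F.map_comp, IsFiltered.coeq_condition]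

end lim

lemma exists_lim_iso (X : Ind C) :
    ∃ (I : Type v) (_ : SmallCategory I) (_ : IsFiltered I) (F : I ⥤ C),
      Nonempty ((Ind.lim I).obj F ≅ X) :=
  ⟨X.presentation.I, inferInstance, inferInstance, X.presentation.F,
    ⟨X.colimitPresentationCompYoneda⟩⟩

lemma hom_ext {X Y : Ind C} {f g : X ⟶ Y}
    (h : ∀ (c : C) (t : Ind.yoneda.obj c ⟶ X), t ≫ f = t ≫ g) : f = g :=
  Ind.isSeparating_range_yoneda f g (by rintro _ ⟨c⟩ t; exact h c t)

lemma exists_hom_of_natural {X Y : Ind C}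
    (τ : ∀ c : C, (Ind.yoneda.obj c ⟶ X) → (Ind.yoneda.obj c ⟶ Y))
    (h : ∀ (c d : C) (a : c ⟶ d) (t : Ind.yoneda.obj d ⟶ X),
      τ c (Ind.yoneda.map a ≫ t) = Ind.yoneda.map a ≫ τ d t) :
    ∃ f : X ⟶ Y, ∀ (c : C) (t : Ind.yoneda.obj c ⟶ X), t ≫ f = τ c t := by
  obtain ⟨I, _, _, F, ⟨e⟩⟩ := exists_lim_iso X
  refine ⟨e.inv ≫ limDesc (fun i => τ _ (limι F i ≫ e.hom))
    (fun s => by rw [← h, map_limι_assoc]), fun c t => ?_⟩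
  obtain ⟨i, a, ha⟩ := exists_eq_map_comp_limι (t ≫ e.inv)
  rw [reassoc_of% ha, limι_limDesc, ← h, ← reassoc_of% ha, e.inv_hom_id, Category.comp_id]

lemma isIso_of_bijective {X Y : Ind C} (f : X ⟶ Y)
    (hf : ∀ (c : C) (s t : Ind.yoneda.obj c ⟶ X), s ≫ f = t ≫ f → s = t)
    (hf' : ∀ (c : C) (t : Ind.yoneda.obj c ⟶ Y), ∃ s : Ind.yoneda.obj c ⟶ X, s ≫ f = t) :
    IsIso f := by
  choose τ hτ using hf'
  obtain ⟨g, hg⟩ := exists_hom_of_natural τ (fun c d a t => hf _ _ _ (by simp [hτ]))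
  have hgf : g ≫ f = 𝟙 Y := hom_ext fun c t => by rw [← Category.assoc, hg, hτ, Category.comp_id]
  exact ⟨g, hom_ext fun c t => hf _ _ _ (by simp [hgf]), hgf⟩

lemma mono_of_injective {X Y : Ind C} (f : X ⟶ Y)
    (hf : ∀ (c : C) (s t : Ind.yoneda.obj c ⟶ X), s ≫ f = t ≫ f → s = t) : Mono f :=
  ⟨fun a b hab => hom_ext fun c t => hf _ _ _ (by simp [hab])⟩

instance (X : Ind C) : IsFiltered (CostructuredArrow Ind.yoneda X) :=
  RepresentablyCoflat.filtered X

lemma exists_factor_pair {X : Ind C} {c c' : C} (t : Ind.yoneda.obj c ⟶ X)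
    (t' : Ind.yoneda.obj c' ⟶ X) :
    ∃ (d : C) (u : Ind.yoneda.obj d ⟶ X) (a : c ⟶ d) (a' : c' ⟶ d),
      t = Ind.yoneda.map a ≫ u ∧ t' = Ind.yoneda.map a' ≫ u := by
  let s := IsFiltered.leftToMax (CostructuredArrow.mk t) (CostructuredArrow.mk t')
  let s' := IsFiltered.rightToMax (CostructuredArrow.mk t) (CostructuredArrow.mk t')
  exact ⟨_, _, s.left, s'.left, (CostructuredArrow.w s).symm, (CostructuredArrow.w s').symm⟩

lemma exists_factor_coeq {X : Ind C} {c d : C} (u : Ind.yoneda.obj d ⟶ X) (a b : c ⟶ d)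
    (h : Ind.yoneda.map a ≫ u = Ind.yoneda.map b ≫ u) :
    ∃ (d' : C) (u' : Ind.yoneda.obj d' ⟶ X) (e : d ⟶ d'),
      u = Ind.yoneda.map e ≫ u' ∧ a ≫ e = b ≫ e := by
  let s : CostructuredArrow.mk (Ind.yoneda.map a ≫ u) ⟶ CostructuredArrow.mk u :=
    CostructuredArrow.homMk a rfl
  let t : CostructuredArrow.mk (Ind.yoneda.map a ≫ u) ⟶ CostructuredArrow.mk u :=
    CostructuredArrow.homMk b h.symm
  exact ⟨_, _, (IsFiltered.coeqHom s t).left,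
    (CostructuredArrow.w (IsFiltered.coeqHom s t)).symm,
    congrArg CommaMorphism.left (IsFiltered.coeq_condition s t)⟩

/-! ### The additive structure of ind-objects -/

/-- A natural binary operation on the morphisms out of `c` extends to the elements of every
ind-object, because two elements factor through a common one. -/
lemma exists_elem_op {c : C} (μ : ∀ ⦃d : C⦄, (c ⟶ d) → (c ⟶ d) → (c ⟶ d))
    (hμ : ∀ {d e : C} (a b : c ⟶ d) (f : d ⟶ e), μ a b ≫ f = μ (a ≫ f) (b ≫ f))
    {X : Ind C} (s t : Ind.yoneda.obj c ⟶ X) :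
    ∃ r : Ind.yoneda.obj c ⟶ X, ∀ (d : C) (u : Ind.yoneda.obj d ⟶ X) (a b : c ⟶ d),
      s = Ind.yoneda.map a ≫ u → t = Ind.yoneda.map b ≫ u → r = Ind.yoneda.map (μ a b) ≫ u := by
  obtain ⟨d₀, u₀, a₀, b₀, rfl, rfl⟩ := exists_factor_pair s t
  refine ⟨Ind.yoneda.map (μ a₀ b₀) ≫ u₀, fun d u a b ha hb => ?_⟩
  obtain ⟨d₁, u₁, e, e₀, rfl, rfl⟩ := exists_factor_pair u u₀
  simp only [← Category.assoc, ← Functor.map_comp] at ha hb ⊢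
  obtain ⟨d₂, u₂, f, rfl, hf⟩ := exists_factor_coeq _ _ _ ha
  simp only [← Category.assoc, ← Functor.map_comp] at hb ⊢
  obtain ⟨d₃, u₃, g, rfl, hg⟩ := exists_factor_coeq _ _ _ hb
  simp only [← Category.assoc, ← Functor.map_comp, hμ, hf, hg] at hg ⊢

section Preadditive

variable [Preadditive C]

/-- The sum of two elements of an ind-object. -/
def elemAdd {X : Ind C} {c : C} (s t : Ind.yoneda.obj c ⟶ X) : Ind.yoneda.obj c ⟶ X :=
  (exists_elem_op (fun _ a b => a + b) (fun _ _ _ => Preadditive.add_comp ..) s t).choose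

lemma elemAdd_map_comp {X : Ind C} {c d : C} (u : Ind.yoneda.obj d ⟶ X) (a b : c ⟶ d) :
    elemAdd (Ind.yoneda.map a ≫ u) (Ind.yoneda.map b ≫ u) = Ind.yoneda.map (a + b) ≫ u :=
  (exists_elem_op _ (fun _ _ _ => Preadditive.add_comp ..) _ _).choose_spec _ _ _ _ rfl rfl

/-- The opposite of an element of an ind-object. -/
def elemNeg {X : Ind C} {c : C} (s : Ind.yoneda.obj c ⟶ X) : Ind.yoneda.obj c ⟶ X :=
  (exists_elem_op (fun _ a _ => -a) (fun _ _ _ => Preadditive.neg_comp ..) s s).choose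

lemma elemNeg_map_comp {X : Ind C} {c d : C} (u : Ind.yoneda.obj d ⟶ X) (a : c ⟶ d) :
    elemNeg (Ind.yoneda.map a ≫ u) = Ind.yoneda.map (-a) ≫ u :=
  (exists_elem_op _ (fun _ _ _ => Preadditive.neg_comp ..) _ _).choose_spec _ _ _ _ rfl rfl

/-- The zero element of an ind-object. -/
def elemZero (X : Ind C) (c : C) : Ind.yoneda.obj c ⟶ X :=
  Ind.yoneda.map 0 ≫ (IsFiltered.nonempty (C := CostructuredArrow Ind.yoneda X)).some.hom

lemma elemZero_eq {X : Ind C} {c d : C} (u : Ind.yoneda.obj d ⟶ X) :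
    elemZero X c = Ind.yoneda.map 0 ≫ u := by
  obtain ⟨d', u', e, e', h, rfl⟩ := exists_factor_pair
    (IsFiltered.nonempty (C := CostructuredArrow Ind.yoneda X)).some.hom u
  rw [elemZero, h, ← Category.assoc, ← Category.assoc, ← Functor.map_comp, ← Functor.map_comp,
    zero_comp, zero_comp]

/-- The group of the elements of an ind-object. -/
@[reducible]
def elemGroup (X : Ind C) (c : C) : AddCommGroup (Ind.yoneda.obj c ⟶ X) :=
  letI : Add (Ind.yoneda.obj c ⟶ X) := ⟨elemAdd⟩
  letI : Neg (Ind.yoneda.obj c ⟶ X) := ⟨elemNeg⟩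
  letI : Zero (Ind.yoneda.obj c ⟶ X) := ⟨elemZero X c⟩
  { AddGroup.ofLeftAxioms (G := Ind.yoneda.obj c ⟶ X)
      (fun r s t => by
        obtain ⟨d, u, a, b, rfl, rfl⟩ := exists_factor_pair r s
        obtain ⟨d', u', a', b', rfl, rfl⟩ := exists_factor_pair u t
        change elemAdd (elemAdd _ _) _ = elemAdd _ (elemAdd _ _)
        simp only [← Category.assoc, ← Functor.map_comp, elemAdd_map_comp, add_assoc])
      (fun t => by
        obtain ⟨d, u, a, -, rfl, -⟩ := exists_factor_pair t t
        change elemAdd (elemZero X c) _ = _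
        rw [elemZero_eq u, elemAdd_map_comp, zero_add])
      (fun t => by
        obtain ⟨d, u, a, -, rfl, -⟩ := exists_factor_pair t t
        change elemAdd (elemNeg _) _ = elemZero X c
        rw [elemNeg_map_comp, elemAdd_map_comp, elemZero_eq u, neg_add_cancel]) with
    add_comm := fun s t => by
      obtain ⟨d, u, a, b, rfl, rfl⟩ := exists_factor_pair s t
      change elemAdd _ _ = elemAdd _ _
      rw [elemAdd_map_comp, elemAdd_map_comp, add_comm] }

attribute [local instance] elemGroup

lemma map_add_comp {X : Ind C} {c d : C} (a b : c ⟶ d) (u : Ind.yoneda.obj d ⟶ X) :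
    Ind.yoneda.map (a + b) ≫ u = Ind.yoneda.map a ≫ u + Ind.yoneda.map b ≫ u :=
  (elemAdd_map_comp u a b).symm

lemma add_elem_comp {X Y : Ind C} {c : C} (s t : Ind.yoneda.obj c ⟶ X) (f : X ⟶ Y) :
    (s + t) ≫ f = s ≫ f + t ≫ f := by
  obtain ⟨d, u, a, b, rfl, rfl⟩ := exists_factor_pair s t
  simp only [← map_add_comp, Category.assoc]

lemma map_comp_add {X : Ind C} {c d : C} (a : c ⟶ d) (s t : Ind.yoneda.obj d ⟶ X) :
    Ind.yoneda.map a ≫ (s + t) = Ind.yoneda.map a ≫ s + Ind.yoneda.map a ≫ t := by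
  obtain ⟨d, u, a, b, rfl, rfl⟩ := exists_factor_pair s t
  simp only [← map_add_comp, ← Category.assoc, ← Functor.map_comp, Preadditive.comp_add]

/-- Precomposition with `a : c ⟶ d`, from the elements of stage `d` to those of stage `c`. -/
def restrict (X : Ind C) {c d : C} (a : c ⟶ d) :
    (Ind.yoneda.obj d ⟶ X) →+ (Ind.yoneda.obj c ⟶ X) :=
  AddMonoidHom.mk' (fun t => Ind.yoneda.map a ≫ t) (map_comp_add a)

/-- The natural families of maps between the elements of two ind-objects. -/
def naturalFamilies (X Y : Ind C) :
    AddSubgroup (∀ c : C, (Ind.yoneda.obj c ⟶ X) → (Ind.yoneda.obj c ⟶ Y)) where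
  carrier := {τ | ∀ (c d : C) (a : c ⟶ d) (t : Ind.yoneda.obj d ⟶ X),
    τ c (Ind.yoneda.map a ≫ t) = restrict Y a (τ d t)}
  add_mem' hσ hτ c d a t := by simp only [Pi.add_apply, hσ c d a t, hτ c d a t, map_add]
  zero_mem' _ _ a _ := (map_zero (restrict Y a)).symm
  neg_mem' hτ c d a t := by simp only [Pi.neg_apply, hτ c d a t, map_neg]

/-- The morphisms of ind-objects are the natural families of maps between their elements. -/
def homEquiv (X Y : Ind C) : (X ⟶ Y) ≃ naturalFamilies X Y :=
  Equiv.ofBijective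
    (fun f => ⟨fun _ t => t ≫ f, fun _ _ _ _ => Category.assoc ..⟩)
    ⟨fun _ _ h => hom_ext fun c t => congrFun (congrFun (Subtype.ext_iff.1 h) c) t,
      fun τ => (exists_hom_of_natural τ.1 τ.2).imp fun _ h => Subtype.ext (funext₂ h)⟩

/-- The group of morphisms of ind-objects. -/
@[reducible]
def homGroup (X Y : Ind C) : AddCommGroup (X ⟶ Y) := (homEquiv X Y).addCommGroup

lemma comp_homGroup_add {X Y : Ind C} (f g : X ⟶ Y) {c : C} (t : Ind.yoneda.obj c ⟶ X) :
    letI := homGroup X Y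
    t ≫ (f + g) = t ≫ f + t ≫ g :=
  congrFun (congrFun (congrArg Subtype.val ((homEquiv X Y).apply_symm_apply _)) c) t

instance preadditive : Preadditive (Ind C) where
  homGroup := homGroup
  add_comp _ _ _ f f' g := hom_ext fun c t => by
    rw [← Category.assoc, comp_homGroup_add, add_elem_comp, comp_homGroup_add]
    simp only [Category.assoc]
  comp_add _ _ _ f g g' := hom_ext fun c t => by
    rw [← Category.assoc, comp_homGroup_add, comp_homGroup_add]
    simp only [Category.assoc]

instance : (Ind.yoneda (C := C)).Additive where
  map_add {X Y f g} := hom_ext fun c t => by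
    obtain ⟨a, rfl⟩ := Ind.yoneda.map_surjective t
    refine Eq.trans ?_ (comp_homGroup_add _ _ _).symm
    have h := map_add_comp (a ≫ f) (a ≫ g) (𝟙 (Ind.yoneda.obj Y))
    simp only [Category.comp_id] at h
    rw [← Functor.map_comp, ← Functor.map_comp, ← Functor.map_comp, Preadditive.comp_add, h]

end Preadditive

instance [Preadditive C] [HasFiniteBiproducts C] : HasFiniteBiproducts (Ind C) :=
  HasFiniteBiproducts.of_hasFiniteCoproducts

end IndObj

section SequenceIso

variable {C : Type u} [Category.{v} C]

lemma SequenceIso.symm {X Y Z X' Y' Z' : C} {f : X ⟶ Y} {g : Y ⟶ Z} {f' : X' ⟶ Y'} {g' : Y' ⟶ Z'}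
    (h : SequenceIso f g f' g') : SequenceIso f' g' f g := by
  obtain ⟨a, b, c, hf, hg⟩ := h
  refine ⟨a.symm, b.symm, c.symm, ?_, ?_⟩
  · simp [Iso.eq_inv_comp, ← reassoc_of% hf]
  · simp [Iso.eq_inv_comp, ← reassoc_of% hg]

lemma SequenceIso.trans {X Y Z X' Y' Z' X'' Y'' Z'' : C}
    {f : X ⟶ Y} {g : Y ⟶ Z} {f' : X' ⟶ Y'} {g' : Y' ⟶ Z'} {f'' : X'' ⟶ Y''} {g'' : Y'' ⟶ Z''}
    (h : SequenceIso f g f' g') (h' : SequenceIso f' g' f'' g'') : SequenceIso f g f'' g'' := by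
  obtain ⟨a, b, c, hf, hg⟩ := h
  obtain ⟨a', b', c', hf', hg'⟩ := h'
  refine ⟨a ≪≫ a', b ≪≫ b', c ≪≫ c', ?_, ?_⟩
  · simp [← hf', reassoc_of% hf]
  · simp [← hg', reassoc_of% hg]

lemma SequenceIso.unop {X Y Z X' Y' Z' : Cᵒᵖ} {f : X ⟶ Y} {g : Y ⟶ Z} {f' : X' ⟶ Y'}
    {g' : Y' ⟶ Z'} (h : SequenceIso f g f' g') :
    SequenceIso g'.unop f'.unop g.unop f.unop := by
  obtain ⟨a, b, c, hf, hg⟩ := h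
  exact ⟨c.unop, b.unop, a.unop, congrArg Quiver.Hom.unop hg.symm,
    congrArg Quiver.Hom.unop hf.symm⟩

end SequenceIso

/-! ### Kernels and cokernels -/

section Kernels

variable {C : Type u} [Category.{v} C] [Preadditive C]

/-- `f` is a kernel of `g`: a propositional form of `IsLimit (KernelFork.ofι f w)`. -/
structure IsKer {X Y Z : C} (f : X ⟶ Y) (g : Y ⟶ Z) : Prop where
  w : f ≫ g = 0
  mono : Mono f
  lift : ∀ {T : C} (t : T ⟶ Y), t ≫ g = 0 → ∃ s : T ⟶ X, s ≫ f = t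

/-- `g` is a cokernel of `f`: a propositional form of `IsColimit (CokernelCofork.ofπ g w)`. -/
structure IsCok {X Y Z : C} (f : X ⟶ Y) (g : Y ⟶ Z) : Prop where
  w : f ≫ g = 0
  epi : Epi g
  desc : ∀ {T : C} (t : Y ⟶ T), f ≫ t = 0 → ∃ s : Z ⟶ T, g ≫ s = t

variable {X Y Z : C} {f : X ⟶ Y} {g : Y ⟶ Z}

lemma IsKer.isLimit (h : IsKer f g) : Nonempty (IsLimit (KernelFork.ofι f h.w)) :=
  have := h.mono
  ⟨KernelFork.IsLimit.ofι' f h.w fun t ht => ⟨(h.lift t ht).choose, (h.lift t ht).choose_spec⟩⟩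

lemma IsKer.of_isLimit {w : f ≫ g = 0} (h : IsLimit (KernelFork.ofι f w)) : IsKer f g where
  w := w
  mono := Fork.IsLimit.mono h
  lift t ht := ⟨_, (KernelFork.IsLimit.lift' h t ht).2⟩

lemma IsCok.isColimit (h : IsCok f g) : Nonempty (IsColimit (CokernelCofork.ofπ g h.w)) :=
  have := h.epi
  ⟨CokernelCofork.IsColimit.ofπ' g h.w fun t ht =>
    ⟨(h.desc t ht).choose, (h.desc t ht).choose_spec⟩⟩

lemma IsCok.of_isColimit {w : f ≫ g = 0} (h : IsColimit (CokernelCofork.ofπ g w)) :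
    IsCok f g where
  w := w
  epi := Cofork.IsColimit.epi h
  desc t ht := ⟨_, (CokernelCofork.IsColimit.desc' h t ht).2⟩

lemma IsKer.hasKernel (h : IsKer f g) : HasKernel g :=
  ⟨⟨⟨_, h.isLimit.some⟩⟩⟩

lemma IsCok.hasCokernel (h : IsCok f g) : HasCokernel f :=
  ⟨⟨⟨_, h.isColimit.some⟩⟩⟩

lemma IsKer.op (h : IsKer f g) : IsCok g.op f.op where
  w := by rw [← op_comp, h.w, op_zero]
  epi := have := h.mono; inferInstance
  desc t ht := by
    obtain ⟨s, hs⟩ := h.lift t.unop (Quiver.Hom.op_inj (by simpa using ht))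
    exact ⟨s.op, Quiver.Hom.unop_inj (by simpa using hs)⟩

lemma IsCok.op (h : IsCok f g) : IsKer g.op f.op where
  w := by rw [← op_comp, h.w, op_zero]
  mono := have := h.epi; inferInstance
  lift t ht := by
    obtain ⟨s, hs⟩ := h.desc t.unop (Quiver.Hom.op_inj (by simpa using ht))
    exact ⟨s.op, Quiver.Hom.unop_inj (by simpa using hs)⟩

lemma IsKer.of_isPullback {P T : C} {u : P ⟶ T} {v : P ⟶ X} {t : T ⟶ Y}
    (h : IsKer f g) (hP : IsPullback u v t f) : IsKer u (t ≫ g) where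
  w := by rw [← Category.assoc, hP.w, Category.assoc, h.w, comp_zero]
  mono := have := h.mono; (MorphismProperty.monomorphisms C).of_isPullback hP.flip ‹_›
  lift s hs := by
    obtain ⟨r, hr⟩ := h.lift (s ≫ t) (by rw [Category.assoc, hs])
    exact ⟨hP.lift s r hr.symm, hP.lift_fst _ _ _⟩

lemma IsKer.exists_iso {X' : C} {f' : X' ⟶ Y} (h : IsKer f g) (h' : IsKer f' g) :
    ∃ e : X ≅ X', e.hom ≫ f' = f := by
  have := h.mono
  have := h'.mono
  obtain ⟨s, hs⟩ := h'.lift f h.w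
  obtain ⟨t, ht⟩ := h.lift f' h'.w
  refine ⟨⟨s, t, ?_, ?_⟩, hs⟩
  · rw [← cancel_mono f, Category.assoc, ht, hs, Category.id_comp]
  · rw [← cancel_mono f', Category.assoc, hs, ht, Category.id_comp]

lemma IsCok.exists_iso {Z' : C} {g' : Y ⟶ Z'} (h : IsCok f g) (h' : IsCok f g') :
    ∃ e : Z ≅ Z', g ≫ e.hom = g' := by
  have := h.epi
  have := h'.epi
  obtain ⟨s, hs⟩ := h'.desc g h.w
  obtain ⟨t, ht⟩ := h.desc g' h'.w
  refine ⟨⟨t, s, ?_, ?_⟩, ht⟩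
  · rw [← cancel_epi g, ← Category.assoc, ht, hs, Category.comp_id]
  · rw [← cancel_epi g', ← Category.assoc, hs, ht, Category.comp_id]

lemma IsCok.of_iso {X Y Z X' Y' Z' : C}
    {f : X ⟶ Y} {g : Y ⟶ Z} {f' : X' ⟶ Y'} {g' : Y' ⟶ Z'}
    (hi : SequenceIso f g f' g') (h : IsCok f g) : IsCok f' g' := by
  obtain ⟨a, b, c, hab, hbc⟩ := hi
  have := h.epi
  have hg : g' = b.inv ≫ g ≫ c.hom := by simp [hbc]
  refine ⟨?_, ?_, fun t ht => ?_⟩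
  · rw [← cancel_epi a.hom, ← Category.assoc, ← hab, Category.assoc, ← hbc, ← Category.assoc, h.w,
      zero_comp, comp_zero]
  · rw [hg]; infer_instance
  · obtain ⟨s, hs⟩ := h.desc (b.hom ≫ t) (by
      rw [← Category.assoc, hab, Category.assoc, ht, comp_zero])
    exact ⟨c.inv ≫ s, by simp [hg, hs]⟩

section Biproducts

variable [HasBinaryBiproducts C]

lemma isPushout_inl_biprodMap (f : X ⟶ Y) (Z : C) :
    IsPushout f biprod.inl biprod.inl (biprod.map f (𝟙 Z)) := by
  refine ⟨⟨by simp⟩, ⟨PushoutCocone.IsColimit.mk _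
    (fun s => biprod.desc s.inl (biprod.inr ≫ s.inr)) (fun s => by simp) (fun s => ?_)
    (fun s m hm₁ hm₂ => ?_)⟩⟩
  · ext
    · simpa using s.condition
    · simp
  · ext
    · simp [hm₁]
    · simp [← hm₂]

lemma isPullback_inr_biprodMap (g : Y ⟶ Z) (X : C) :
    IsPullback biprod.inr g (biprod.map (𝟙 X) g) biprod.inr := by
  refine ⟨⟨by simp⟩, ⟨PullbackCone.IsLimit.mk _ (fun s => s.fst ≫ biprod.snd) (fun s => ?_)
    (fun s => ?_) (fun s m hm₁ _ => by simp [← hm₁])⟩⟩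
  · have hfst := s.condition =≫ biprod.fst
    ext
    · simpa using hfst.symm
    · simp
  · simpa using s.condition =≫ biprod.snd

lemma IsCok.biprodMap (h : IsCok f g) (W : C) :
    IsCok (f ≫ (biprod.inr : Y ⟶ W ⊞ Y)) (biprod.map (𝟙 W) g) := by
  have := h.epi
  refine ⟨by simp [reassoc_of% h.w], ⟨fun s t hst => ?_⟩, fun t ht => ?_⟩
  · ext
    · simpa using biprod.inl ≫= hst
    · simpa [cancel_epi] using biprod.inr ≫= hst
  · obtain ⟨s, hs⟩ := h.desc (biprod.inr ≫ t) (by simpa using ht)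
    exact ⟨biprod.desc (biprod.inl ≫ t) s, by ext <;> simp [hs]⟩

lemma IsKer.isPullback {P : C} {k : P ⟶ X ⊞ Y} {f : X ⟶ Z} {g : Y ⟶ Z}
    (h : IsKer k (biprod.desc f (-g))) : IsPullback (k ≫ biprod.fst) (k ≫ biprod.snd) f g := by
  have := h.mono
  have w : (k ≫ biprod.fst) ≫ f = (k ≫ biprod.snd) ≫ g := by
    have := h.w
    rw [biprod.desc_eq, Preadditive.comp_add] at this
    simpa [add_neg_eq_zero] using this
  choose d hd using fun s : PullbackCone f g =>
    h.lift (biprod.lift s.fst s.snd) (by simp [biprod.lift_desc, s.condition])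
  refine ⟨⟨w⟩, ⟨PullbackCone.IsLimit.mk _ d (fun s => by simp [reassoc_of% hd s])
    (fun s => by simp [reassoc_of% hd s]) (fun s m hm₁ hm₂ => ?_)⟩⟩
  rw [← cancel_mono k, hd]
  ext <;> simp [hm₁, hm₂]

lemma IsCok.isPushout {P : C} {f : X ⟶ Y} {g : X ⟶ Z} {a : Y ⟶ P} {b : Z ⟶ P}
    (h : IsCok (biprod.lift f (-g)) (biprod.desc a b)) : IsPushout f g a b := by
  have := h.epi
  choose d hd using fun s : PushoutCocone f g =>
    h.desc (biprod.desc s.inl s.inr) (by simp [biprod.lift_desc, s.condition])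
  refine ⟨⟨by simpa [biprod.lift_desc, add_neg_eq_zero] using h.w⟩,
    ⟨PushoutCocone.IsColimit.mk _ d (fun s => by simpa using biprod.inl ≫= hd s)
      (fun s => by simpa using biprod.inr ≫= hd s) (fun s m hm₁ hm₂ => ?_)⟩⟩
  rw [← cancel_epi (biprod.desc a b), hd]
  ext <;> simp [hm₁, hm₂]

/-- The automorphism `(x, y) ↦ (x - e y, y)` of `X ⊞ Y`. -/
def shear (e : Y ⟶ X) : X ⊞ Y ≅ X ⊞ Y where
  hom := biprod.lift (biprod.fst - biprod.snd ≫ e) biprod.snd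
  inv := biprod.lift (biprod.fst + biprod.snd ≫ e) biprod.snd

end Biproducts

end Kernels

/-! ### Exact categories without the redundant axioms -/

/-- Quillen's axioms for an exact category, without the two on the cancellation of composites, which
follow from the others (`IsExactCore.exact`). -/
structure IsExactCore (C : Type u) [Category.{v} C] [Preadditive C]
    (S : SequenceClass C) : Prop where
  hasFiniteBiproducts : HasFiniteBiproducts C
  of_iso : ∀ {X Y Z X' Y' Z' : C} {f : X ⟶ Y} {g : Y ⟶ Z} {f' : X' ⟶ Y'} {g' : Y' ⟶ Z'},
    SequenceIso f g f' g' → S f g → S f' g'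
  ker : ∀ {X Y Z : C} {f : X ⟶ Y} {g : Y ⟶ Z}, S f g → IsKer f g
  cok : ∀ {X Y Z : C} {f : X ⟶ Y} {g : Y ⟶ Z}, S f g → IsCok f g
  split : ∀ {X Y Z : C} (i₁ : X ⟶ Y) (p₁ : Y ⟶ X) (i₂ : Z ⟶ Y) (p₂ : Y ⟶ Z),
    i₁ ≫ p₁ = 𝟙 X → i₂ ≫ p₂ = 𝟙 Z → i₁ ≫ p₂ = 0 → i₂ ≫ p₁ = 0 → p₁ ≫ i₁ + p₂ ≫ i₂ = 𝟙 Y →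
    S i₁ p₂
  epi_comp : ∀ {X Y Z : C} {f : X ⟶ Y} {g : Y ⟶ Z},
    S.AdmissibleEpi f → S.AdmissibleEpi g → S.AdmissibleEpi (f ≫ g)
  mono_comp : ∀ {X Y Z : C} {f : X ⟶ Y} {g : Y ⟶ Z},
    S.AdmissibleMono f → S.AdmissibleMono g → S.AdmissibleMono (f ≫ g)
  epi_pullback : ∀ {X Y Z : C} {g : X ⟶ Z}, S.AdmissibleEpi g → ∀ f : Y ⟶ Z,
    ∃ (P : C) (f' : P ⟶ X) (g' : P ⟶ Y), IsPullback f' g' g f ∧ S.AdmissibleEpi g'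
  mono_pushout : ∀ {X Y Z : C} {g : Z ⟶ X}, S.AdmissibleMono g → ∀ f : Z ⟶ Y,
    ∃ (P : C) (f' : X ⟶ P) (g' : Y ⟶ P), IsPushout g f f' g' ∧ S.AdmissibleMono g'

section Core

variable {C : Type u} [Category.{v} C] {S : SequenceClass C}

lemma op_admissibleEpi_iff {X Y : Cᵒᵖ} (f : X ⟶ Y) :
    S.op.AdmissibleEpi f ↔ S.AdmissibleMono f.unop :=
  ⟨fun ⟨Z, g, h⟩ => ⟨Z.unop, g.unop, h⟩, fun ⟨Z, g, h⟩ => ⟨.op Z, g.op, h⟩⟩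

lemma op_admissibleMono_iff {X Y : Cᵒᵖ} (f : X ⟶ Y) :
    S.op.AdmissibleMono f ↔ S.AdmissibleEpi f.unop :=
  ⟨fun ⟨Z, g, h⟩ => ⟨Z.unop, g.unop, h⟩, fun ⟨Z, g, h⟩ => ⟨.op Z, g.op, h⟩⟩

variable [Preadditive C]

lemma IsExactStructure.core (h : IsExactStructure C S) : IsExactCore C S where
  hasFiniteBiproducts := h.hasFiniteBiproducts
  of_iso := h.of_iso
  ker hfg := .of_isLimit (h.kernel_cokernel hfg).choose_spec.1.some
  cok hfg := .of_isColimit (h.kernel_cokernel hfg).choose_spec.2.some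
  split {X Y Z} i₁ p₁ i₂ p₂ h₁ h₂ h₃ h₄ h₅ := by
    let b : BinaryBicone X Z :=
      { pt := Y, inl := i₁, inr := i₂, fst := p₁, snd := p₂,
        inl_fst := h₁, inl_snd := h₃, inr_fst := h₄, inr_snd := h₂ }
    exact h.split b (isBinaryBilimitOfTotal b h₅)
  epi_comp := h.epi_comp
  mono_comp := h.mono_comp
  epi_pullback := h.epi_pullback
  mono_pushout := h.mono_pushout

lemma hasFiniteBiproducts_op [HasFiniteBiproducts C] : HasFiniteBiproducts Cᵒᵖ :=
  HasFiniteBiproducts.of_hasFiniteProducts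

namespace IsExactCore

variable (h : IsExactCore C S)
include h

lemma op : IsExactCore Cᵒᵖ S.op where
  hasFiniteBiproducts := have := h.hasFiniteBiproducts; hasFiniteBiproducts_op
  of_iso hfg := h.of_iso hfg.unop.symm
  ker hfg := (h.cok hfg).op
  cok hfg := (h.ker hfg).op
  split i₁ p₁ i₂ p₂ h₁ h₂ h₃ h₄ h₅ := by
    refine h.split p₂.unop i₂.unop p₁.unop i₁.unop ?_ ?_ ?_ ?_ ?_
    · rw [← unop_comp, h₂, unop_id]
    · rw [← unop_comp, h₁, unop_id]
    · rw [← unop_comp, h₃, unop_zero]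
    · rw [← unop_comp, h₄, unop_zero]
    · rw [← unop_comp, ← unop_comp, ← unop_add, add_comm, h₅, unop_id]
  epi_comp hf hg := by
    rw [op_admissibleEpi_iff] at *
    exact h.mono_comp hg hf
  mono_comp hf hg := by
    rw [op_admissibleMono_iff] at *
    exact h.epi_comp hg hf
  epi_pullback hg f := by
    rw [op_admissibleEpi_iff] at hg
    obtain ⟨P, f', g', hP, hg'⟩ := h.mono_pushout hg f.unop
    exact ⟨.op P, f'.op, g'.op, hP.flip.op, (op_admissibleEpi_iff _).2 hg'⟩
  mono_pushout hg f := by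
    rw [op_admissibleMono_iff] at hg
    obtain ⟨P, f', g', hP, hg'⟩ := h.epi_pullback hg f.unop
    exact ⟨.op P, f'.op, g'.op, hP.flip.op, (op_admissibleMono_iff _).2 hg'⟩

lemma hasBinaryBiproducts : HasBinaryBiproducts C :=
  have := h.hasFiniteBiproducts
  hasBinaryBiproducts_of_finite_biproducts C

lemma of_isKer {X Y Z : C} {f : X ⟶ Y} {g : Y ⟶ Z} (hg : S.AdmissibleEpi g) (hf : IsKer f g) :
    S f g := by
  obtain ⟨X', f', h'⟩ := hg
  obtain ⟨e, he⟩ := (h.ker h').exists_iso hf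
  exact h.of_iso ⟨e, Iso.refl _, Iso.refl _, by simp [he], by simp⟩ h'

lemma of_isCok {X Y Z : C} {f : X ⟶ Y} {g : Y ⟶ Z} (hf : S.AdmissibleMono f) (hg : IsCok f g) :
    S f g := by
  obtain ⟨Z', g', h'⟩ := hf
  obtain ⟨e, he⟩ := (h.cok h').exists_iso hg
  exact h.of_iso ⟨Iso.refl _, Iso.refl _, e, by simp, by simp [he]⟩ h'

lemma admissibleMono_comp_iso {X Y Y' : C} {f : X ⟶ Y} (hf : S.AdmissibleMono f) (e : Y ≅ Y') :
    S.AdmissibleMono (f ≫ e.hom) := by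
  obtain ⟨Z, g, hg⟩ := hf
  exact ⟨Z, e.inv ≫ g, h.of_iso ⟨Iso.refl _, e, Iso.refl _, by simp, by simp⟩ hg⟩

lemma admissibleEpi_iso_comp {Y Y' Z : C} {g : Y ⟶ Z} (hg : S.AdmissibleEpi g) (e : Y' ≅ Y) :
    S.AdmissibleEpi (e.hom ≫ g) := by
  obtain ⟨X, f, hf⟩ := hg
  exact ⟨X, f ≫ e.inv, h.of_iso ⟨Iso.refl _, e.symm, Iso.refl _, by simp, by simp⟩ hf⟩

lemma admissibleEpi_of_isPullback {P X Y Z : C} {f' : P ⟶ X} {g' : P ⟶ Y} {g : X ⟶ Z}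
    {f : Y ⟶ Z} (hP : IsPullback f' g' g f) (hg : S.AdmissibleEpi g) : S.AdmissibleEpi g' := by
  obtain ⟨P₁, f₁, g₁, hP₁, hg₁⟩ := h.epi_pullback hg f
  rw [← hP.isoIsPullback_hom_snd _ _ hP₁]
  exact h.admissibleEpi_iso_comp hg₁ _

lemma admissibleMono_of_isPushout {P X Y Z : C} {f' : X ⟶ P} {g' : Y ⟶ P} {g : Z ⟶ X}
    {f : Z ⟶ Y} (hP : IsPushout g f f' g') (hg : S.AdmissibleMono g) : S.AdmissibleMono g' := by
  obtain ⟨P₁, f₁, g₁, hP₁, hg₁⟩ := h.mono_pushout hg f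
  rw [← hP₁.inr_isoIsPushout_hom _ _ hP]
  exact h.admissibleMono_comp_iso hg₁ _

lemma of_comp_inr {W X Y Z : C} [HasBinaryBiproducts C] {f : X ⟶ Y} {g : Y ⟶ Z} (hg : IsCok f g)
    (hf : S.AdmissibleMono (f ≫ (biprod.inr : Y ⟶ W ⊞ Y))) : S f g := by
  have hS : S (f ≫ (biprod.inr : Y ⟶ W ⊞ Y)) (biprod.map (𝟙 W) g) := h.of_isCok hf (hg.biprodMap W)
  have := (h.ker hS).mono
  refine h.of_isKer (h.admissibleEpi_of_isPullback (isPullback_inr_biprodMap g W) ⟨_, _, hS⟩)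
    ⟨hg.w, mono_of_mono f (biprod.inr : Y ⟶ W ⊞ Y), fun t ht => ?_⟩
  obtain ⟨s, hs⟩ := (h.ker hS).lift (t ≫ biprod.inr) (by simp [reassoc_of% ht])
  exact ⟨s, by simpa using hs =≫ biprod.snd⟩

/-- The morphism `(0, f) : X ⟶ Z ⊞ Y` is the composite of the graph `(1, f)`, of `(f ≫ e) ⊞ 1` and
of a shear, hence an admissible monomorphism. -/
lemma mono_of_comp {X Y Z : C} (f : X ⟶ Y) (e : Y ⟶ Z) (hf : HasCokernel f)
    (hfe : S.AdmissibleMono (f ≫ e)) : S.AdmissibleMono f := by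
  have := h.hasBinaryBiproducts
  have hgraph : S.AdmissibleMono (biprod.lift (𝟙 X) f) :=
    ⟨Y, biprod.desc (-f) (𝟙 Y), h.split _ biprod.fst biprod.inr _ (by simp) (by simp) (by simp)
      (by simp) (by ext <;> simp)⟩
  have hmap : S.AdmissibleMono (biprod.map (f ≫ e) (𝟙 Y)) :=
    h.admissibleMono_of_isPushout (isPushout_inl_biprodMap (f ≫ e) Y) hfe
  have hinr : S.AdmissibleMono (f ≫ (biprod.inr : Y ⟶ Z ⊞ Y)) := by
    convert h.admissibleMono_comp_iso (h.mono_comp hgraph hmap) (shear e) using 1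
    ext <;> simp [shear]
  exact ⟨_, _, h.of_comp_inr
    (.of_isColimit (w := cokernel.condition f) (cokernelIsCokernel f)) hinr⟩

lemma epi_of_comp {X Y Z : C} (e : X ⟶ Y) (f : Y ⟶ Z) (hf : HasKernel f)
    (hef : S.AdmissibleEpi (e ≫ f)) : S.AdmissibleEpi f := by
  have hk : IsKer (kernel.ι f) f :=
    .of_isLimit (w := kernel.condition f) (kernelIsKernel f)
  have := h.op.mono_of_comp f.op e.op hk.op.hasCokernel
    ((op_admissibleMono_iff _).2 (by simpa using hef))
  simpa [op_admissibleMono_iff] using this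

lemma exact : IsExactStructure C S where
  hasFiniteBiproducts := h.hasFiniteBiproducts
  of_iso := h.of_iso
  kernel_cokernel hfg := ⟨(h.ker hfg).w, (h.ker hfg).isLimit, (h.cok hfg).isColimit⟩
  split b hb := h.split b.inl b.fst b.inr b.snd (by simp) (by simp) (by simp) (by simp)
    (IsBilimit.binary_total hb)
  epi_comp := h.epi_comp
  mono_comp := h.mono_comp
  epi_pullback := h.epi_pullback
  mono_pushout := h.mono_pushout
  epi_of_comp := h.epi_of_comp
  mono_of_comp := h.mono_of_comp

/-! ### Diagram chases in exact categories -/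

lemma admissibleEpi_id (X : C) : S.AdmissibleEpi (𝟙 X) := by
  have := h.hasFiniteBiproducts
  have : HasZeroObject C := hasZeroObject_of_hasFiniteBiproducts C
  open ZeroObject in
  exact ⟨0, 0, h.split 0 0 (𝟙 X) (𝟙 X) (by simp) (by simp) (by simp) (by simp) (by simp)⟩

lemma epi {Y Z : C} {g : Y ⟶ Z} (hg : S.AdmissibleEpi g) : Epi g :=
  (h.cok hg.choose_spec.choose_spec).epi

lemma exists_lift_of_admissibleEpi {T' T X Y : C} {e : T' ⟶ T} (he : S.AdmissibleEpi e)
    {m : X ⟶ Y} [Mono m] (t : T ⟶ Y) (s : T' ⟶ X) (hst : e ≫ t = s ≫ m) :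
    ∃ w : T ⟶ X, w ≫ m = t := by
  obtain ⟨K, k, hk⟩ := he
  have := (h.cok hk).epi
  obtain ⟨w, hw⟩ := (h.cok hk).desc s (by
    rw [← cancel_mono m, Category.assoc, ← hst, ← Category.assoc, (h.cok hk).w, zero_comp,
      zero_comp])
  exact ⟨w, by rw [← cancel_epi e, ← Category.assoc, hw, hst]⟩

lemma exists_local_lift {X Y T : C} {g : X ⟶ Y} (hg : S.AdmissibleEpi g) (z : T ⟶ Y) :
    ∃ (T' : C) (p : T' ⟶ T) (x : T' ⟶ X), S.AdmissibleEpi p ∧ x ≫ g = p ≫ z := by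
  obtain ⟨P, f', g', hP, hg'⟩ := h.epi_pullback hg z
  exact ⟨P, g', f', hg', hP.w⟩

lemma of_isKer_of_comp {X Y Z T : C} {f : X ⟶ Y} {g : Y ⟶ Z} (hf : IsKer f g) (t : T ⟶ Y)
    (ht : S.AdmissibleEpi (t ≫ g)) : S f g :=
  h.of_isKer (h.epi_of_comp t g hf.hasKernel ht) hf

lemma exists_cokernel_of_isPushout {X Y Z X' P : C} {f : X ⟶ Y} {g : Y ⟶ Z} {a : X ⟶ X'}
    {b : Y ⟶ P} {f' : X' ⟶ P} (hfg : S f g) (hP : IsPushout f a b f') :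
    ∃ q : P ⟶ Z, S f' q ∧ b ≫ q = g := by
  have hg := h.cok hfg
  have := hg.epi
  let q : P ⟶ Z := hP.desc g 0 (by simp [hg.w])
  have hbq : b ≫ q = g := hP.inl_desc _ _ _
  have hfq : f' ≫ q = 0 := hP.inr_desc _ _ _
  refine ⟨q, h.of_isCok (h.admissibleMono_of_isPushout hP ⟨Z, g, hfg⟩)
    ⟨hfq, epi_of_epi_fac hbq, fun t ht => ?_⟩, hbq⟩
  obtain ⟨s, hs⟩ := hg.desc (b ≫ t) (by rw [← Category.assoc, hP.w, Category.assoc, ht, comp_zero])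
  refine ⟨s, hP.hom_ext ?_ ?_⟩
  · rw [← Category.assoc, hbq, hs]
  · rw [← Category.assoc, hfq, ht, zero_comp]

lemma exists_pushout {X Y Z X' : C} {f : X ⟶ Y} {g : Y ⟶ Z} (hfg : S f g) (a : X ⟶ X') :
    ∃ (P : C) (f' : X' ⟶ P) (b : Y ⟶ P) (q : P ⟶ Z), IsPushout f a b f' ∧ S f' q ∧ b ≫ q = g := by
  obtain ⟨P, b, f', hP, -⟩ := h.mono_pushout ⟨Z, g, hfg⟩ a
  obtain ⟨q, hq, hbq⟩ := h.exists_cokernel_of_isPushout hfg hP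
  exact ⟨P, f', b, q, hP, hq, hbq⟩

lemma admissibleEpi_biprodDesc [HasBinaryBiproducts C] {X Y Z : C} (f : X ⟶ Z) {g : Y ⟶ Z}
    (hg : S.AdmissibleEpi g) : S.AdmissibleEpi (biprod.desc f g) := by
  obtain ⟨P, a, b, hP, -⟩ := h.epi_pullback hg (-f)
  have hk : IsKer (biprod.lift b a) (biprod.desc f g) := by
    refine ⟨by simp [biprod.lift_desc, hP.w], ⟨fun s t hst => hP.hom_ext ?_ ?_⟩, fun t ht => ?_⟩
    · simpa using hst =≫ biprod.snd
    · simpa using hst =≫ biprod.fst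
    · refine ⟨hP.lift (t ≫ biprod.snd) (t ≫ biprod.fst) ?_, ?_⟩
      · rw [biprod.desc_eq, Preadditive.comp_add, ← Category.assoc, ← Category.assoc] at ht
        rw [Preadditive.comp_neg]
        exact eq_neg_of_add_eq_zero_right ht
      · ext <;> simp
  exact ⟨P, _, h.of_isKer_of_comp hk biprod.inr (by simpa using hg)⟩

lemma quotient_sequence {X Y Z Q W R : C} {f : X ⟶ Y} {p : Y ⟶ Q} {g : Y ⟶ Z} {q : Z ⟶ R}
    {r : Z ⟶ W} {u : Q ⟶ W} {v : W ⟶ R} (hp : S f p) (hq : S g q) (hr : S (f ≫ g) r)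
    (hu : p ≫ u = g ≫ r) (hv : r ≫ v = q) : S u v := by
  have := (h.cok hp).epi
  have := (h.ker hq).mono
  have hmono : Mono u := by
    refine Preadditive.mono_of_cancel_zero _ fun {T} t ht => ?_
    obtain ⟨T', e, t', he, het⟩ := h.exists_local_lift ⟨_, _, hp⟩ t
    have := h.epi he
    obtain ⟨s, hs⟩ := (h.ker hr).lift (t' ≫ g) (by
      rw [Category.assoc, ← hu, ← Category.assoc, het, Category.assoc, ht, comp_zero])
    rw [← Category.assoc, cancel_mono] at hs
    rw [← cancel_epi e, ← het, ← hs, Category.assoc, (h.ker hp).w, comp_zero, comp_zero]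
  refine h.of_isKer_of_comp (t := r) ⟨?_, hmono, fun {T} t ht => ?_⟩ (hv ▸ ⟨_, _, hq⟩)
  · rw [← cancel_epi p, ← Category.assoc, hu, Category.assoc, hv, (h.ker hq).w, comp_zero]
  · obtain ⟨T', e, t', he, het⟩ := h.exists_local_lift ⟨_, _, hr⟩ t
    obtain ⟨s, hs⟩ := (h.ker hq).lift t' (by
      rw [← hv, ← Category.assoc, het, Category.assoc, ht, comp_zero])
    refine h.exists_lift_of_admissibleEpi he t (s ≫ p) ?_
    rw [← het, ← hs, Category.assoc, Category.assoc, hu]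

lemma exists_quotient_sequence {X Y Z Q W R : C} {f : X ⟶ Y} {p : Y ⟶ Q} {g : Y ⟶ Z} {q : Z ⟶ R}
    {r : Z ⟶ W} (hp : S f p) (hq : S g q) (hr : S (f ≫ g) r) :
    ∃ (u : Q ⟶ W) (v : W ⟶ R), p ≫ u = g ≫ r ∧ r ≫ v = q ∧ S u v := by
  obtain ⟨u, hu⟩ := (h.cok hp).desc (g ≫ r) (by rw [← Category.assoc, (h.cok hr).w])
  obtain ⟨v, hv⟩ := (h.cok hr).desc q (by rw [Category.assoc, (h.cok hq).w, comp_zero])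
  exact ⟨u, v, hu, hv, h.quotient_sequence hp hq hr hu hv⟩

lemma exists_kernel_sequence {X Y Z K L M : C} {g : X ⟶ Y} {k : K ⟶ X} {g' : Y ⟶ Z} {l : L ⟶ Y}
    {m : M ⟶ X} (hk : S k g) (hl : S l g') (hm : S m (g ≫ g')) :
    ∃ (u : K ⟶ M) (v : M ⟶ L), u ≫ m = k ∧ m ≫ g = v ≫ l ∧ S u v := by
  obtain ⟨u, v, hu, hv, huv⟩ := h.op.exists_quotient_sequence (f := g'.op) (g := g.op) (p := l.op)
    (q := k.op) (r := m.op) hl hk hm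
  exact ⟨v.unop, u.unop, congrArg Quiver.Hom.unop hv, (congrArg Quiver.Hom.unop hu).symm, huv⟩

section Middle

variable {X Y Z X' Y' Z' : C} {f : X ⟶ Y} {g : Y ⟶ Z} {f' : X' ⟶ Y'} {g' : Y' ⟶ Z'}
  {a : X ⟶ X'} {b : Y ⟶ Y'} {c : Z ⟶ Z'}

lemma mono_middle (hf : S f g) (hf' : S f' g') (hl : f ≫ b = a ≫ f') (hr : g ≫ c = b ≫ g')
    [Mono a] [Mono c] : Mono b := by
  have := (h.ker hf').mono
  refine Preadditive.mono_of_cancel_zero _ fun {T} t ht => ?_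
  obtain ⟨s, hs⟩ := (h.ker hf).lift t (by
    rw [← cancel_mono c, Category.assoc, hr, ← Category.assoc, ht, zero_comp, zero_comp])
  have : s = 0 := by
    rw [← cancel_mono a, ← cancel_mono f', Category.assoc, ← hl, ← Category.assoc, hs, ht,
      zero_comp, zero_comp]
  rw [← hs, this, zero_comp]

lemma short_five (hf : S f g) (hf' : S f' g') (hl : f ≫ b = a ≫ f') (hr : g ≫ c = b ≫ g')
    [IsIso a] [IsIso c] : IsIso b := by
  have := h.mono_middle hf hf' hl hr
  obtain ⟨T, e, d, he, hd⟩ := h.exists_local_lift ⟨_, _, hf⟩ (g' ≫ inv c)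
  obtain ⟨x, hx⟩ := (h.ker hf').lift (e - d ≫ b) (by
    rw [Preadditive.sub_comp, Category.assoc, ← hr, reassoc_of% hd]
    simp)
  obtain ⟨r, hr⟩ := h.exists_lift_of_admissibleEpi he (𝟙 Y') (m := b) (d + x ≫ inv a ≫ f) (by
    simp [hl, hx])
  exact ⟨r, by rw [← cancel_mono b]; simp [hr], hr⟩

lemma isPushout_of_admissible (hf : S f g) {g' : Y' ⟶ Z} (hf' : S f' g')
    (hl : f ≫ b = a ≫ f') (hr : b ≫ g' = g) : IsPushout f a b f' := by
  obtain ⟨P, f₁, b₁, q₁, hP, hfq, hbq⟩ := h.exists_pushout hf a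
  let π : P ⟶ Y' := hP.desc b f' hl
  have hbπ : b₁ ≫ π = b := hP.inl_desc _ _ _
  have hfπ : f₁ ≫ π = f' := hP.inr_desc _ _ _
  have hπ : π ≫ g' = q₁ := by
    refine hP.hom_ext ?_ ?_
    · rw [← Category.assoc, hbπ, hbq, hr]
    · rw [← Category.assoc, hfπ, (h.ker hfq).w, (h.ker hf').w]
  have : IsIso π := h.short_five (a := 𝟙 _) (c := 𝟙 _) hfq hf' (by simp [hfπ]) (by simp [hπ])
  exact hP.of_iso (Iso.refl _) (Iso.refl _) (Iso.refl _) (asIso π) (by simp) (by simp)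
    (by simp [hbπ]) (by simp [hfπ])

lemma isPullback_of_admissible {f' : X ⟶ Y'} (hf : S f g) (hf' : S f' g') (hl : f ≫ b = f')
    (hr : g ≫ c = b ≫ g') : IsPullback b g g' c :=
  (h.op.isPushout_of_admissible (f := g'.op) (b := b.op) hf' hf (congrArg Quiver.Hom.op hr).symm
    (congrArg Quiver.Hom.op hl)).unop.flip

/-- The morphism of sequences factors through the pushout `P` of `X ⟶ Y` along `a`: the quotient of
`Y ⟶ P` is that of `a`, and the quotient of `P ⟶ Y'` is that of `c`. -/
lemma exists_middle_quotient {A C' : C} {p : X' ⟶ A} {q : Z' ⟶ C'} (hf : S f g) (hf' : S f' g')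
    (hl : f ≫ b = a ≫ f') (hr : g ≫ c = b ≫ g') (ha : S a p) (hc : S c q) :
    ∃ (Q : C) (r : Y' ⟶ Q) (u : A ⟶ Q) (w : Q ⟶ C'),
      S b r ∧ S u w ∧ p ≫ u = f' ≫ r ∧ r ≫ w = g' ≫ q := by
  obtain ⟨P, f₁, b₁, q₁, hP, hfq, hbq⟩ := h.exists_pushout hf a
  obtain ⟨s, hs, hfs⟩ := h.exists_cokernel_of_isPushout ha hP.flip
  let π : P ⟶ Y' := hP.desc b f' hl
  have hbπ : b₁ ≫ π = b := hP.inl_desc _ _ _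
  have hfπ : f₁ ≫ π = f' := hP.inr_desc _ _ _
  have hπ : q₁ ≫ c = π ≫ g' := by
    refine hP.hom_ext ?_ ?_
    · rw [← Category.assoc, hbq, ← Category.assoc, hbπ, hr]
    · rw [← Category.assoc, (h.ker hfq).w, ← Category.assoc, hfπ, (h.ker hf').w, zero_comp]
  have hπq : S π (g' ≫ q) := h.of_isKer (h.epi_comp ⟨_, _, hf'⟩ ⟨_, _, hc⟩)
    ((h.ker hc).of_isPullback (h.isPullback_of_admissible hfq hf' hfπ hπ))
  obtain ⟨Q, r, hr⟩ := h.mono_comp ⟨_, _, hs⟩ ⟨_, _, hπq⟩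
  obtain ⟨u, w, hu, hw, huw⟩ := h.exists_quotient_sequence hs hπq hr
  exact ⟨Q, r, u, w, hbπ ▸ hr, huw, by rw [← hfs, Category.assoc, hu, ← Category.assoc, hfπ], hw⟩

lemma exists_middle_kernel {K L : C} {k : K ⟶ X} {l : L ⟶ Z} (hf : S f g) (hf' : S f' g')
    (hl : f ≫ b = a ≫ f') (hr : g ≫ c = b ≫ g') (ha : S k a) (hc : S l c) :
    ∃ (M : C) (r : M ⟶ Y) (u : K ⟶ M) (w : M ⟶ L),
      S r b ∧ S u w ∧ u ≫ r = k ≫ f ∧ r ≫ g = w ≫ l := by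
  obtain ⟨Q, r, u, w, hr, huw, hu, hw⟩ := h.op.exists_middle_quotient (f := g'.op) (g := f'.op)
    (f' := g.op) (g' := f.op) (a := c.op) (b := b.op) (c := a.op) (p := l.op) (q := k.op)
    hf' hf (congrArg Quiver.Hom.op hr).symm (congrArg Quiver.Hom.op hl).symm hc ha
  exact ⟨Q.unop, r.unop, w.unop, u.unop, hr, huw, congrArg Quiver.Hom.unop hw,
    (congrArg Quiver.Hom.unop hu).symm⟩

end Middle

end IsExactCore

end Core

/-! ### The exact structure on ind-objects -/

lemma SequenceClass.ind_of_iso {C : Type u} [Category.{v} C] {S : SequenceClass C}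
    {X Y Z X' Y' Z' : Ind C} {f : X ⟶ Y} {g : Y ⟶ Z} {f' : X' ⟶ Y'} {g' : Y' ⟶ Z'}
    (h : SequenceIso f g f' g') (hfg : S.ind f g) : S.ind f' g' := by
  obtain ⟨I, _, _, F, G, H, α, β, hS, hi⟩ := hfg
  exact ⟨I, _, inferInstance, F, G, H, α, β, hS, hi.trans h⟩

namespace IndObj

section

variable {C : Type u} [Category.{v} C] {I : Type v} [SmallCategory I] [IsFiltered I]

lemma isIso_limDesc {F : I ⥤ C} {X : Ind C} (τ : ∀ i, Ind.yoneda.obj (F.obj i) ⟶ X)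
    (h : ∀ {i j : I} (s : i ⟶ j), Ind.yoneda.map (F.map s) ≫ τ j = τ i)
    (hinj : ∀ (c : C) (i : I) (a b : c ⟶ F.obj i), Ind.yoneda.map a ≫ τ i = Ind.yoneda.map b ≫ τ i →
      ∃ (j : I) (s : i ⟶ j), a ≫ F.map s = b ≫ F.map s)
    (hsurj : ∀ (c : C) (t : Ind.yoneda.obj c ⟶ X),
      ∃ (i : I) (a : c ⟶ F.obj i), t = Ind.yoneda.map a ≫ τ i) :
    IsIso (limDesc τ h) := by
  refine isIso_of_bijective _ (fun c s t hst => ?_) (fun c t => ?_)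
  · obtain ⟨i, a, rfl⟩ := exists_eq_map_comp_limι s
    obtain ⟨j, b, rfl⟩ := exists_eq_map_comp_limι t
    let k := IsFiltered.max i j
    simp only [Category.assoc, limι_limDesc] at hst
    obtain ⟨l, s, hs⟩ := hinj c k (a ≫ F.map (IsFiltered.leftToMax i j))
      (b ≫ F.map (IsFiltered.rightToMax i j)) (by simp [h, hst])
    rw [← map_limι F (IsFiltered.leftToMax i j), ← map_limι F (IsFiltered.rightToMax i j),
      ← map_limι F s]
    simp only [Category.assoc] at hs
    simp only [← Functor.map_comp_assoc, hs]
  · obtain ⟨i, a, rfl⟩ := hsurj c t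
    exact ⟨Ind.yoneda.map a ≫ limι F i, by simp⟩

/-- The invariance of formal inductive limits under restriction along a final functor. -/
def finalIso {J : Type v} [SmallCategory J] [IsFiltered J] (p : J ⥤ I) [p.Final] (F : I ⥤ C) :
    (Ind.lim J).obj (p ⋙ F) ≅ (Ind.lim I).obj F :=
  Functor.Final.colimitIso p (F ⋙ Ind.yoneda)

@[simp]
lemma limι_finalIso_hom {J : Type v} [SmallCategory J] [IsFiltered J] (p : J ⥤ I) [p.Final]
    (F : I ⥤ C) (j : J) : limι (p ⋙ F) j ≫ (finalIso p F).hom = limι F (p.obj j) :=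
  Functor.Final.ι_colimitIso_hom p (F ⋙ Ind.yoneda) j

end

/-- Every element of `Z`, that is a morphism `Ind.yoneda.obj c ⟶ Z`, lifts along `g` to `Y` after
restriction along an admissible epimorphism onto `c`. -/
def LocalEpi {C : Type u} [Category.{v} C] (S : SequenceClass C) {Y Z : Ind C} (g : Y ⟶ Z) : Prop :=
  ∀ (c : C) (z : Ind.yoneda.obj c ⟶ Z), ∃ (d : C) (p : d ⟶ c) (t : Ind.yoneda.obj d ⟶ Y),
    S.AdmissibleEpi p ∧ t ≫ g = Ind.yoneda.map p ≫ z

variable {C : Type u} [Category.{v} C] [Preadditive C] {S : SequenceClass C}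

variable (S) in
/-- Exactness of `0 ⟶ X ⟶ Y ⟶ Z ⟶ 0` on elements, where surjectivity is only required locally for
the admissible epimorphisms. -/
structure IsElemExact {X Y Z : Ind C} (f : X ⟶ Y) (g : Y ⟶ Z) : Prop where
  w : f ≫ g = 0
  injective : ∀ {c : C} (t : Ind.yoneda.obj c ⟶ X), t ≫ f = 0 → t = 0
  exact : ∀ {c : C} (t : Ind.yoneda.obj c ⟶ Y), t ≫ g = 0 → ∃ s : Ind.yoneda.obj c ⟶ X, s ≫ f = t
  localEpi : LocalEpi S g

lemma IsElemExact.isKer {X Y Z : Ind C} {f : X ⟶ Y} {g : Y ⟶ Z} (h : IsElemExact S f g) :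
    IsKer f g := by
  have hf : ∀ (c : C) (s t : Ind.yoneda.obj c ⟶ X), s ≫ f = t ≫ f → s = t := fun c s t hst =>
    sub_eq_zero.1 (h.injective _ (by rw [Preadditive.sub_comp, hst, sub_self]))
  refine ⟨h.w, mono_of_injective f hf, fun {T} t ht => ?_⟩
  have (c : C) (x : Ind.yoneda.obj c ⟶ T) : ∃ s : Ind.yoneda.obj c ⟶ X, s ≫ f = x ≫ t :=
    h.exact _ (by rw [Category.assoc, ht, comp_zero])
  choose τ hτ using this
  obtain ⟨s, hs⟩ := exists_hom_of_natural τ fun c d a x => hf _ _ _ (by simp [hτ])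
  exact ⟨s, hom_ext fun c x => by rw [← Category.assoc, hs, hτ]⟩

lemma IsElemExact.of_iso {X Y Z X' Y' Z' : Ind C} {f : X ⟶ Y} {g : Y ⟶ Z} {f' : X' ⟶ Y'}
    {g' : Y' ⟶ Z'} (hi : SequenceIso f g f' g') (h : IsElemExact S f g) : IsElemExact S f' g' := by
  obtain ⟨a, b, c, hab, hbc⟩ := hi
  have hf : f' = a.inv ≫ f ≫ b.hom := by simp [hab]
  have hg : g' = b.inv ≫ g ≫ c.hom := by simp [hbc]
  refine ⟨?_, fun t ht => ?_, fun t ht => ?_, fun d z => ?_⟩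
  · simp [hf, hg, reassoc_of% h.w]
  · have := h.injective (t ≫ a.inv) (by
      rw [← cancel_mono b.hom]; simpa [hf] using ht)
    simpa using this =≫ a.hom
  · obtain ⟨s, hs⟩ := h.exact (t ≫ b.inv) (by
      rw [← cancel_mono c.hom]; simpa [hg] using ht)
    exact ⟨s ≫ a.hom, by simp [hf, reassoc_of% hs]⟩
  · obtain ⟨e, p, t, hp, ht⟩ := h.localEpi d (z ≫ c.inv)
    exact ⟨e, p, t ≫ b.hom, hp, by simp [hg, reassoc_of% ht]⟩

lemma exists_comp_eq_zero {X : Ind C} {c d : C} (u : Ind.yoneda.obj d ⟶ X) (a : c ⟶ d)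
    (h : Ind.yoneda.map a ≫ u = 0) :
    ∃ (d' : C) (u' : Ind.yoneda.obj d' ⟶ X) (e : d ⟶ d'),
      u = Ind.yoneda.map e ≫ u' ∧ a ≫ e = 0 := by
  obtain ⟨d', u', e, hu, hae⟩ := exists_factor_coeq u a 0 (by simpa using h)
  exact ⟨d', u', e, hu, by simpa using hae⟩

lemma exists_map_eq_zero {I : Type v} [SmallCategory I] [IsFiltered I] {F : I ⥤ C} {c : C} {i : I}
    {a : c ⟶ F.obj i} (h : Ind.yoneda.map a ≫ limι F i = 0) :
    ∃ (j : I) (s : i ⟶ j), a ≫ F.map s = 0 := by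
  obtain ⟨j, s, hs⟩ := exists_comp_map_eq (a := a) (b := 0) (by simpa using h)
  exact ⟨j, s, by simpa using hs⟩

lemma isCok_yoneda_map {X Y Z : C} {f : X ⟶ Y} {g : Y ⟶ Z} (h : IsCok f g) :
    IsCok (Ind.yoneda.map f) (Ind.yoneda.map g) := by
  have := h.epi
  refine ⟨by rw [← Functor.map_comp, h.w, Functor.map_zero], ?_, fun {T} t ht => ?_⟩
  · refine Preadditive.epi_of_cancel_zero _ fun {T} t ht => ?_
    obtain ⟨d, u, a, -, rfl, -⟩ := exists_factor_pair t t
    rw [← Category.assoc, ← Functor.map_comp] at ht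
    obtain ⟨d', u', e, rfl, he⟩ := exists_comp_eq_zero _ _ ht
    rw [Category.assoc] at he
    rw [← Category.assoc, ← Functor.map_comp, (cancel_epi g).1 (he.trans comp_zero.symm),
      Functor.map_zero, zero_comp]
  · obtain ⟨d, u, a, -, rfl, -⟩ := exists_factor_pair t t
    rw [← Category.assoc, ← Functor.map_comp] at ht
    obtain ⟨d', u', e, rfl, he⟩ := exists_comp_eq_zero _ _ ht
    obtain ⟨s, hs⟩ := h.desc (a ≫ e) (by simpa using he)
    exact ⟨Ind.yoneda.map s ≫ u', by simp only [← Category.assoc, ← Functor.map_comp, hs]⟩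

end IndObj

namespace IsExactCore

open IndObj

variable {C : Type u} [Category.{v} C] [Preadditive C] {S : SequenceClass C} (h : IsExactCore C S)
include h

lemma elemExact_lim {I : Type v} [SmallCategory I] [IsFiltered I] {F G H : I ⥤ C} (α : F ⟶ G)
    (β : G ⟶ H) (hS : ∀ i, S (α.app i) (β.app i)) :
    IsElemExact S ((Ind.lim I).map α) ((Ind.lim I).map β) := by
  refine ⟨lim_hom_ext fun i => ?_, fun {c} t ht => ?_, fun {c} t ht => ?_, fun c z => ?_⟩
  · simp [← Functor.map_comp_assoc, (h.ker (hS i)).w]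
  · obtain ⟨i, a, rfl⟩ := exists_eq_map_comp_limι t
    rw [Category.assoc, limι_map, ← Functor.map_comp_assoc] at ht
    obtain ⟨j, s, hs⟩ := exists_map_eq_zero ht
    have := (h.ker (hS j)).mono
    have : a ≫ F.map s = 0 := by rw [← cancel_mono (α.app j)]; simpa using hs
    rw [← map_limι F s, ← Functor.map_comp_assoc, this, Functor.map_zero, zero_comp]
  · obtain ⟨i, a, rfl⟩ := exists_eq_map_comp_limι t
    rw [Category.assoc, limι_map, ← Functor.map_comp_assoc] at ht
    obtain ⟨j, s, hs⟩ := exists_map_eq_zero ht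
    obtain ⟨r, hr⟩ := (h.ker (hS j)).lift (a ≫ G.map s) (by simpa using hs)
    exact ⟨Ind.yoneda.map r ≫ limι F j, by
      rw [Category.assoc, limι_map, ← Functor.map_comp_assoc, hr, Functor.map_comp_assoc, map_limι]⟩
  · obtain ⟨i, a, rfl⟩ := exists_eq_map_comp_limι z
    obtain ⟨d, p, x, hp, hx⟩ := h.exists_local_lift ⟨_, _, hS i⟩ a
    exact ⟨d, p, Ind.yoneda.map x ≫ limι G i, hp, by
      rw [Category.assoc, limι_map, ← Functor.map_comp_assoc, hx, Functor.map_comp_assoc]⟩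

lemma elemExact_of_ind {X Y Z : Ind C} {f : X ⟶ Y} {g : Y ⟶ Z} (hfg : S.ind f g) :
    IsElemExact S f g := by
  obtain ⟨I, _, _, F, G, H, α, β, hS, hi⟩ := hfg
  exact (h.elemExact_lim α β hS).of_iso hi

lemma isCok_lim {I : Type v} [SmallCategory I] [IsFiltered I] {F G H : I ⥤ C} (α : F ⟶ G)
    (β : G ⟶ H) (hS : ∀ i, S (α.app i) (β.app i)) :
    IsCok ((Ind.lim I).map α) ((Ind.lim I).map β) := by
  have hc (i : I) := isCok_yoneda_map (h.cok (hS i))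
  have he (i : I) := (hc i).epi
  refine ⟨(h.elemExact_lim α β hS).w, ?_, fun {T} t ht => ?_⟩
  · refine Preadditive.epi_of_cancel_zero _ fun {T} t ht => lim_hom_ext fun i => ?_
    rw [← cancel_epi (Ind.yoneda.map (β.app i)), ← limι_map_assoc, ht]
    simp
  · have (i : I) : ∃ s, Ind.yoneda.map (β.app i) ≫ s = limι G i ≫ t :=
      (hc i).desc _ (by rw [← limι_map_assoc, ht, comp_zero])
    choose τ hτ using this
    refine ⟨limDesc τ fun {i j} s => ?_, lim_hom_ext fun i => by simp [hτ]⟩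
    rw [← cancel_epi (Ind.yoneda.map (β.app i)), ← Functor.map_comp_assoc, ← β.naturality,
      Functor.map_comp_assoc, hτ, hτ, map_limι_assoc]

lemma isCok_of_ind {X Y Z : Ind C} {f : X ⟶ Y} {g : Y ⟶ Z} (hfg : S.ind f g) : IsCok f g := by
  obtain ⟨I, _, _, F, G, H, α, β, hS, hi⟩ := hfg
  exact (h.isCok_lim α β hS).of_iso hi

lemma exists_kernel_diagram {J : Type*} [Category* J] {G H : J ⥤ C} (β : G ⟶ H)
    (hβ : ∀ j, S.AdmissibleEpi (β.app j)) :
    ∃ (F : J ⥤ C) (α : F ⟶ G), ∀ j, S (α.app j) (β.app j) := by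
  choose X f hf using hβ
  have (i j : J) (s : i ⟶ j) : ∃ t, t ≫ f j = f i ≫ G.map s :=
    (h.ker (hf j)).lift _ (by
      rw [Category.assoc, β.naturality, ← Category.assoc, (h.ker (hf i)).w, zero_comp])
  choose m hm using this
  have hmono (j : J) := (h.ker (hf j)).mono
  exact ⟨{  obj := X
            map := fun {i j} s => m i j s
            map_id := fun i => by rw [← cancel_mono (f i)]; simp [hm]
            map_comp := fun {i j k} s t => by
              rw [← cancel_mono (f k)]; simp [hm, reassoc_of% (hm i j s)] },
    { app := f, naturality := fun i j s => hm i j s }, hf⟩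

lemma exists_pushout_diagram {J : Type*} [Category* J] {F G H F' : J ⥤ C} (α : F ⟶ G)
    (β : G ⟶ H) (hS : ∀ j, S (α.app j) (β.app j)) (η : F ⟶ F') :
    ∃ (P : J ⥤ C) (α' : F' ⟶ P) (b : G ⟶ P) (β' : P ⟶ H),
      (∀ j, S (α'.app j) (β'.app j)) ∧ α ≫ b = η ≫ α' ∧ b ≫ β' = β := by
  choose P f' b q hP hfq hbq using fun j => h.exists_pushout (hS j) (η.app j)
  let m {i j : J} (s : i ⟶ j) : P i ⟶ P j :=
    (hP i).desc (G.map s ≫ b j) (F'.map s ≫ f' j) (by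
      rw [← Category.assoc, ← α.naturality, Category.assoc, (hP j).w, ← Category.assoc,
        η.naturality, Category.assoc])
  have hbm {i j : J} (s : i ⟶ j) : b i ≫ m s = G.map s ≫ b j := (hP i).inl_desc _ _ _
  have hfm {i j : J} (s : i ⟶ j) : f' i ≫ m s = F'.map s ≫ f' j := (hP i).inr_desc _ _ _
  let Pf : J ⥤ C :=
    { obj := P
      map := fun s => m s
      map_id := fun i => (hP i).hom_ext (by simp [hbm]) (by simp [hfm])
      map_comp := fun {i j k} s t => (hP i).hom_ext
        (by rw [hbm, ← Category.assoc, hbm, Category.assoc, hbm, G.map_comp, Category.assoc])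
        (by rw [hfm, ← Category.assoc, hfm, Category.assoc, hfm, F'.map_comp, Category.assoc]) }
  refine ⟨Pf, { app := f', naturality := fun i j s => (hfm s).symm },
    { app := b, naturality := fun i j s => (hbm s).symm },
    { app := q, naturality := fun i j s => (hP i).hom_ext ?_ ?_ }, hfq, ?_, ?_⟩
  · change b i ≫ m s ≫ q j = b i ≫ q i ≫ H.map s
    rw [← Category.assoc, hbm, Category.assoc, hbq, ← Category.assoc, hbq, β.naturality]
  · change f' i ≫ m s ≫ q j = f' i ≫ q i ≫ H.map s
    rw [← Category.assoc, hfm, Category.assoc, (h.ker (hfq j)).w, ← Category.assoc,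
      (h.ker (hfq i)).w, comp_zero, zero_comp]
  · ext j
    exact (hP j).w
  · ext j
    exact hbq j

end IsExactCore

/-! ### Local epimorphisms are admissible -/

namespace IndObj

variable {C : Type u} [Category.{v} C] {I : Type v} [SmallCategory I] [IsFiltered I]

lemma exists_factor_square {G H : I ⥤ C} {φ : G ⟶ H} {b c b₀ c₀ : C} {q : b ⟶ c}
    {e : Ind.yoneda.obj b ⟶ (Ind.lim I).obj G} {z : Ind.yoneda.obj c ⟶ (Ind.lim I).obj H}
    (w : e ≫ (Ind.lim I).map φ = Ind.yoneda.map q ≫ z) {β β' : b₀ ⟶ b} {γ γ' : c₀ ⟶ c}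
    (hβ : Ind.yoneda.map β ≫ e = Ind.yoneda.map β' ≫ e)
    (hγ : Ind.yoneda.map γ ≫ z = Ind.yoneda.map γ' ≫ z) :
    ∃ (i : I) (a : b ⟶ G.obj i) (x : c ⟶ H.obj i), a ≫ φ.app i = q ≫ x ∧
      Ind.yoneda.map a ≫ limι G i = e ∧ Ind.yoneda.map x ≫ limι H i = z ∧
      β ≫ a = β' ≫ a ∧ γ ≫ x = γ' ≫ x := by
  obtain ⟨i₁, a₁, he⟩ := exists_eq_map_comp_limι e
  obtain ⟨i₂, x₂, hz⟩ := exists_eq_map_comp_limι z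
  obtain ⟨i, a, x, rfl, rfl⟩ : ∃ (i : I) (a : b ⟶ G.obj i) (x : c ⟶ H.obj i),
      e = Ind.yoneda.map a ≫ limι G i ∧ z = Ind.yoneda.map x ≫ limι H i :=
    ⟨IsFiltered.max i₁ i₂, a₁ ≫ G.map (IsFiltered.leftToMax _ _),
      x₂ ≫ H.map (IsFiltered.rightToMax _ _), by simpa using he, by simpa using hz⟩
  obtain ⟨j, s, hs⟩ := exists_comp_map_eq (F := G) (a := β ≫ a) (b := β' ≫ a) (by simpa using hβ)
  obtain ⟨k, r, hr⟩ := exists_comp_map_eq (F := H) (a := γ ≫ x ≫ H.map s)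
    (b := γ' ≫ x ≫ H.map s) (by simpa using hγ)
  obtain ⟨l, n, hn⟩ := exists_comp_map_eq (F := H)
    (a := (a ≫ G.map s ≫ G.map r) ≫ φ.app k) (b := q ≫ x ≫ H.map s ≫ H.map r) (by simpa using w)
  simp only [Category.assoc] at hs hr hn
  exact ⟨l, a ≫ G.map s ≫ G.map r ≫ G.map n, x ≫ H.map s ≫ H.map r ≫ H.map n, by simpa using hn,
    by simp, by simp, by simp [reassoc_of% hs], by simp [reassoc_of% hr]⟩

/-- For each `i`, a morphism `p i : d i ⟶ H.obj i` along which the canonical morphism `limι H i`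
lifts to the formal inductive limit of `G`. -/
structure CanonicalLifts {G H : I ⥤ C} (φ : G ⟶ H) where
  d : I → C
  p (i : I) : d i ⟶ H.obj i
  lift (i : I) : Ind.yoneda.obj (d i) ⟶ (Ind.lim I).obj G
  lift_comp (i : I) : lift i ≫ (Ind.lim I).map φ = Ind.yoneda.map (p i) ≫ limι H i

namespace CanonicalLifts

variable [Preadditive C] [HasBinaryBiproducts C] {G H : I ⥤ C} {φ : G ⟶ H} (L : CanonicalLifts φ)

/-- The morphism from `G.obj i ⊞ d i` to the formal inductive limit of `G` that is the canonical one
on the first summand and the lift on the second. -/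
def coverElem (i : I) : Ind.yoneda.obj (G.obj i ⊞ L.d i) ⟶ (Ind.lim I).obj G :=
  Ind.yoneda.map biprod.fst ≫ limι G i + Ind.yoneda.map biprod.snd ≫ L.lift i

lemma map_inl_coverElem (i : I) : Ind.yoneda.map biprod.inl ≫ L.coverElem i = limι G i := by
  rw [coverElem, Preadditive.comp_add, ← Functor.map_comp_assoc, ← Functor.map_comp_assoc]
  simp

lemma coverElem_comp (i : I) :
    L.coverElem i ≫ (Ind.lim I).map φ =
      Ind.yoneda.map (biprod.desc (φ.app i) (L.p i)) ≫ limι H i := by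
  rw [coverElem, biprod.desc_eq, Functor.map_add, Preadditive.add_comp, Preadditive.add_comp,
    Category.assoc, Category.assoc, limι_map, L.lift_comp]
  simp

/-- The morphism `G.obj i ⊞ d i ⟶ H.obj i`, as a morphism of `C` over `(Ind.lim I).map φ`. -/
def cover (i : I) :
    CostructuredArrow (Ind.yoneda (C := C)).mapArrow (Arrow.mk ((Ind.lim I).map φ)) :=
  CostructuredArrow.mk (Y := Arrow.mk (biprod.desc (φ.app i) (L.p i)))
    (Arrow.homMk (L.coverElem i) (limι H i) (L.coverElem_comp i))

lemma exists_hom_cover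
    (T : CostructuredArrow (Ind.yoneda (C := C)).mapArrow (Arrow.mk ((Ind.lim I).map φ)))
    {b₀ c₀ : C} {β β' : b₀ ⟶ T.left.left} {γ γ' : c₀ ⟶ T.left.right}
    (hβ : Ind.yoneda.map β ≫ T.hom.left = Ind.yoneda.map β' ≫ T.hom.left)
    (hγ : Ind.yoneda.map γ ≫ T.hom.right = Ind.yoneda.map γ' ≫ T.hom.right) :
    ∃ i, ∀ {j : I} (_ : i ⟶ j), ∃ m : T ⟶ L.cover j,
      β ≫ m.left.left = β' ≫ m.left.left ∧ γ ≫ m.left.right = γ' ≫ m.left.right := by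
  obtain ⟨i, a, x, hax, ha, hx, hβa, hγx⟩ := exists_factor_square (Arrow.w T.hom) hβ hγ
  refine ⟨i, fun {j} s => ?_⟩
  have hax' : (a ≫ G.map s ≫ biprod.inl) ≫ biprod.desc (φ.app j) (L.p j) =
      T.left.hom ≫ x ≫ H.map s := by
    simp [reassoc_of% hax]
  have ha' : Ind.yoneda.map (a ≫ G.map s ≫ biprod.inl) ≫ L.coverElem j = T.hom.left := by
    simp only [Functor.map_comp, Category.assoc, map_inl_coverElem, map_limι]
    exact ha
  have hx' : Ind.yoneda.map (x ≫ H.map s) ≫ limι H j = T.hom.right := by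
    rw [Functor.map_comp, Category.assoc, map_limι]
    exact hx
  exact ⟨CostructuredArrow.homMk (Arrow.homMk _ _ hax') (Arrow.hom_ext _ _ ha' hx'),
    (reassoc_of% hβa) _, (reassoc_of% hγx) _⟩

/-- The full subcategory on the `cover i`. -/
abbrev Index : Type v :=
  InducedCategory _ L.cover

/-- The sources of the covers. -/
def src : L.Index ⥤ C :=
  inducedFunctor L.cover ⋙ CostructuredArrow.proj _ _ ⋙ Arrow.leftFunc

/-- The targets of the covers. -/
def tgt : L.Index ⥤ C :=
  inducedFunctor L.cover ⋙ CostructuredArrow.proj _ _ ⋙ Arrow.rightFunc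

/-- The covers, as a natural transformation. -/
def coverHom : L.src ⟶ L.tgt :=
  Functor.whiskerLeft (inducedFunctor L.cover ⋙ CostructuredArrow.proj _ _) Arrow.leftToRight

lemma map_src_comp_coverElem {i j : L.Index} (f : i ⟶ j) :
    Ind.yoneda.map (L.src.map f) ≫ L.coverElem j = L.coverElem i :=
  congr_arg (·.left) (CostructuredArrow.w f.hom)

lemma map_tgt_comp_limι {i j : L.Index} (f : i ⟶ j) :
    Ind.yoneda.map (L.tgt.map f) ≫ limι H j = limι H i :=
  congr_arg (·.right) (CostructuredArrow.w f.hom)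

instance : IsFilteredOrEmpty L.Index where
  cocone_objs i j := by
    obtain ⟨i', hi⟩ := L.exists_hom_cover (L.cover i) (β := 𝟙 _) (γ := 𝟙 _) rfl rfl
    obtain ⟨j', hj⟩ := L.exists_hom_cover (L.cover j) (β := 𝟙 _) (γ := 𝟙 _) rfl rfl
    obtain ⟨m, -⟩ := hi (IsFiltered.leftToMax (C := I) i' j')
    obtain ⟨n, -⟩ := hj (IsFiltered.rightToMax (C := I) i' j')
    exact ⟨IsFiltered.max (C := I) i' j', InducedCategory.homMk m, InducedCategory.homMk n, trivial⟩
  cocone_maps i j f f' := by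
    obtain ⟨k, hk⟩ := L.exists_hom_cover (L.cover j) (β := f.hom.left.left) (β' := f'.hom.left.left)
      (γ := f.hom.left.right) (γ' := f'.hom.left.right)
      ((L.map_src_comp_coverElem f).trans (L.map_src_comp_coverElem f').symm)
      ((L.map_tgt_comp_limι f).trans (L.map_tgt_comp_limι f').symm)
    obtain ⟨m, hβ, hγ⟩ := hk (𝟙 k)
    exact ⟨k, InducedCategory.homMk m, InducedCategory.hom_ext
      (CostructuredArrow.hom_ext _ _ (Arrow.hom_ext _ _ hβ hγ))⟩

instance : IsFiltered L.Index where
  nonempty := ‹IsFiltered I›.nonempty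

/-- The comparison of the formal inductive limits of `L.src` and `G`. -/
def srcDesc : (Ind.lim L.Index).obj L.src ⟶ (Ind.lim I).obj G :=
  limDesc L.coverElem L.map_src_comp_coverElem

/-- The comparison of the formal inductive limits of `L.tgt` and `H`. -/
def tgtDesc : (Ind.lim L.Index).obj L.tgt ⟶ (Ind.lim I).obj H :=
  limDesc (limι H) L.map_tgt_comp_limι

lemma limι_srcDesc (i : L.Index) : limι L.src i ≫ L.srcDesc = L.coverElem i :=
  limι_limDesc (F := L.src) L.coverElem L.map_src_comp_coverElem i

lemma limι_tgtDesc (i : L.Index) : limι L.tgt i ≫ L.tgtDesc = limι H i :=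
  limι_limDesc (F := L.tgt) (limι H) L.map_tgt_comp_limι i

instance : IsIso L.srcDesc := by
  refine isIso_limDesc (F := L.src) _ L.map_src_comp_coverElem (fun c i a b hab => ?_) fun c x => ?_
  · obtain ⟨j, hj⟩ := L.exists_hom_cover (L.cover i) (γ := 𝟙 _) hab rfl
    obtain ⟨m, hm, -⟩ := hj (𝟙 j)
    exact ⟨j, InducedCategory.homMk m, hm⟩
  · obtain ⟨i, a, rfl⟩ := exists_eq_map_comp_limι x
    refine ⟨i, a ≫ biprod.inl, ?_⟩
    rw [← map_inl_coverElem, ← Functor.map_comp_assoc]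
    rfl

instance : IsIso L.tgtDesc := by
  refine isIso_limDesc (F := L.tgt) _ L.map_tgt_comp_limι (fun c i a b hab => ?_) fun c x => ?_
  · obtain ⟨j, hj⟩ := L.exists_hom_cover (L.cover i) (β := 𝟙 _) rfl hab
    obtain ⟨m, -, hm⟩ := hj (𝟙 j)
    exact ⟨j, InducedCategory.homMk m, hm⟩
  · obtain ⟨i, a, rfl⟩ := exists_eq_map_comp_limι x
    exact ⟨i, a, rfl⟩

lemma map_coverHom_comp_tgtDesc :
    (Ind.lim L.Index).map L.coverHom ≫ L.tgtDesc = L.srcDesc ≫ (Ind.lim I).map φ := by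
  refine lim_hom_ext fun i => ?_
  rw [limι_map_assoc, limι_tgtDesc, ← Category.assoc, limι_srcDesc]
  exact (L.coverElem_comp i).symm

end CanonicalLifts

end IndObj

namespace IsExactCore

open IndObj

variable {C : Type u} [Category.{v} C] [Preadditive C] {S : SequenceClass C} (h : IsExactCore C S)
include h

lemma exists_ind_of_localEpi {Y Z : Ind C} {g : Y ⟶ Z} (hg : LocalEpi S g) :
    ∃ (X : Ind C) (f : X ⟶ Y), S.ind f g := by
  have := h.hasBinaryBiproducts
  obtain ⟨I, _, _, G, H, φ, ⟨e⟩⟩ := Ind.exists_nonempty_arrow_mk_iso_ind_lim (f := g)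
  let eY : Y ≅ (Ind.lim I).obj G := Arrow.leftFunc.mapIso e
  let eZ : Z ≅ (Ind.lim I).obj H := Arrow.rightFunc.mapIso e
  have he : eY.hom ≫ (Ind.lim I).map φ = g ≫ eZ.hom := Arrow.w_mk_right e.hom
  have he' : (Ind.lim I).map φ ≫ eZ.inv = eY.inv ≫ g := by simp [Iso.eq_inv_comp, reassoc_of% he]
  choose d p t hp ht using fun i => hg _ (limι H i ≫ eZ.inv)
  let L : CanonicalLifts φ :=
    ⟨d, p, fun i => t i ≫ eY.hom, fun i => by simp [he, reassoc_of% ht]⟩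
  obtain ⟨K, k, hk⟩ := h.exists_kernel_diagram L.coverHom fun i =>
    h.admissibleEpi_biprodDesc (φ.app i) (hp i)
  refine ⟨_, (Ind.lim L.Index).map k ≫ L.srcDesc ≫ eY.inv, L.Index, _, inferInstance, _, _, _, k,
    L.coverHom, hk, Iso.refl _, asIso L.srcDesc ≪≫ eY.symm, asIso L.tgtDesc ≪≫ eZ.symm, ?_, ?_⟩
  · simp
  · simp [reassoc_of% L.map_coverHom_comp_tgtDesc, he']

lemma ind_admissibleEpi_iff {Y Z : Ind C} {g : Y ⟶ Z} :
    S.ind.AdmissibleEpi g ↔ LocalEpi S g :=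
  ⟨fun ⟨_, _, hf⟩ => (h.elemExact_of_ind hf).localEpi, h.exists_ind_of_localEpi⟩

lemma ind_iff {X Y Z : Ind C} {f : X ⟶ Y} {g : Y ⟶ Z} : S.ind f g ↔ IsElemExact S f g := by
  refine ⟨h.elemExact_of_ind, fun hfg => ?_⟩
  obtain ⟨X', f', hf'⟩ := h.exists_ind_of_localEpi hfg.localEpi
  obtain ⟨e, he⟩ := (h.elemExact_of_ind hf').isKer.exists_iso hfg.isKer
  exact SequenceClass.ind_of_iso ⟨e, Iso.refl _, Iso.refl _, by simp [he], by simp⟩ hf'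

end IsExactCore

/-! ### Ind-objects form an exact category -/

namespace IndObj

variable {C : Type u} [Category.{v} C] {I : Type v} [SmallCategory I] [IsFiltered I]

lemma lim_map_whiskerLeft {J : Type v} [SmallCategory J] [IsFiltered J] (p : J ⥤ I) [p.Final]
    {F G : I ⥤ C} (α : F ⟶ G) :
    (Ind.lim J).map (Functor.whiskerLeft p α) ≫ (finalIso p G).hom =
      (finalIso p F).hom ≫ (Ind.lim I).map α := by
  refine lim_hom_ext fun j => ?_
  rw [limι_map_assoc, limι_finalIso_hom, ← Category.assoc, limι_finalIso_hom, limι_map]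
  rfl

/-- The elements of `X` given by the members of a diagram with a compatible family of morphisms to
`X`. -/
def elemFunctor {F : I ⥤ C} {X : Ind C} (a : (Ind.lim I).obj F ⟶ X) :
    I ⥤ CostructuredArrow Ind.yoneda X where
  obj i := CostructuredArrow.mk (limι F i ≫ a)
  map s := CostructuredArrow.homMk (F.map s) (by simp)

instance {F : I ⥤ C} {X : Ind C} (a : (Ind.lim I).obj F ⟶ X) [IsIso a] : (elemFunctor a).Final := by
  refine Functor.final_of_exists_of_isFiltered _ (fun t => ?_) (fun {t k} s s' => ?_)
  · obtain ⟨k, r, hr⟩ := exists_eq_map_comp_limι (t.hom ≫ inv a)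
    exact ⟨k, ⟨CostructuredArrow.homMk r (by simp [elemFunctor, ← reassoc_of% hr])⟩⟩
  · have hs (s : t ⟶ (elemFunctor a).obj k) : Ind.yoneda.map s.left ≫ limι F k = t.hom ≫ inv a :=
      (IsIso.eq_comp_inv a).2 ((Category.assoc _ _ _).trans (CostructuredArrow.w s))
    obtain ⟨k', r, hr⟩ := exists_comp_map_eq ((hs s).trans (hs s').symm)
    exact ⟨k', r, CostructuredArrow.hom_ext _ _ hr⟩

lemma exists_final_natTrans {F : I ⥤ C} {X : Ind C} (a : (Ind.lim I).obj F ⟶ X) :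
    ∃ (J : Type v) (_ : SmallCategory J) (_ : IsFiltered J) (p : J ⥤ I) (_ : p.Final)
      (G : J ⥤ C) (η : p ⋙ F ⟶ G) (e : (Ind.lim J).obj G ≅ X),
      (Ind.lim J).map η ≫ e.hom = (finalIso p F).hom ≫ a := by
  obtain ⟨K, _, _, G, ⟨e⟩⟩ := exists_lim_iso X
  let L := elemFunctor a
  let R := elemFunctor e.hom
  let r := Comma.snd L R
  let η : Comma.fst L R ⋙ F ⟶ r ⋙ G :=
    { app := fun j => j.hom.left
      naturality := fun i j s => congrArg CommaMorphism.left s.w }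
  have hη (j : Comma L R) : Ind.yoneda.map (η.app j) ≫ limι G (r.obj j) ≫ e.hom =
      limι F j.left ≫ a :=
    CostructuredArrow.w j.hom
  refine ⟨Comma L R, _, inferInstance, Comma.fst L R, inferInstance, r ⋙ G, η,
    finalIso r G ≪≫ e, lim_hom_ext fun j => ?_⟩
  rw [limι_map_assoc, Iso.trans_hom, ← Category.assoc (limι (r ⋙ G) j), limι_finalIso_hom, hη,
    ← Category.assoc, limι_finalIso_hom]
  rfl

end IndObj

namespace IsExactCore

open IndObj

variable {C : Type u} [Category.{v} C] [Preadditive C] {S : SequenceClass C} (h : IsExactCore C S)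
include h

lemma exists_ind_pushout {X Y Z X' : Ind C} {f : X ⟶ Y} {g : Y ⟶ Z} (hfg : S.ind f g)
    (a : X ⟶ X') :
    ∃ (Y' : Ind C) (f' : X' ⟶ Y') (b : Y ⟶ Y') (g' : Y' ⟶ Z),
      S.ind f' g' ∧ f ≫ b = a ≫ f' ∧ b ≫ g' = g := by
  obtain ⟨I, _, _, F, G, H, α, β, hS, eX, eY, eZ, hf, hg⟩ := hfg
  obtain ⟨J, _, _, p, _, F', η, e, hη⟩ := exists_final_natTrans (eX.hom ≫ a)
  obtain ⟨P, α', b, β', hP, hα, hβ⟩ := h.exists_pushout_diagram (Functor.whiskerLeft p α)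
    (Functor.whiskerLeft p β) (fun j => hS _) η
  replace hα := congrArg (Ind.lim J).map hα
  replace hβ := congrArg (Ind.lim J).map hβ
  rw [Functor.map_comp, Functor.map_comp] at hα
  rw [Functor.map_comp] at hβ
  let eX' := finalIso p F ≪≫ eX
  let eY' := finalIso p G ≪≫ eY
  let eZ' := finalIso p H ≪≫ eZ
  have hf' : eX'.hom ≫ f = (Ind.lim J).map (Functor.whiskerLeft p α) ≫ eY'.hom := by
    simp only [eX', eY', Iso.trans_hom, Category.assoc, ← hf]
    rw [← Category.assoc, ← Category.assoc, lim_map_whiskerLeft]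
  have hg' : eY'.hom ≫ g = (Ind.lim J).map (Functor.whiskerLeft p β) ≫ eZ'.hom := by
    simp only [eY', eZ', Iso.trans_hom, Category.assoc, ← hg]
    rw [← Category.assoc, ← Category.assoc, lim_map_whiskerLeft]
  refine ⟨(Ind.lim J).obj P, e.inv ≫ (Ind.lim J).map α', eY'.inv ≫ (Ind.lim J).map b,
    (Ind.lim J).map β' ≫ eZ'.hom,
    ⟨J, _, inferInstance, _, _, _, α', β', hP, e, Iso.refl _, eZ', by simp, by simp⟩, ?_, ?_⟩
  · have ha : (Ind.lim J).map η = eX'.hom ≫ a ≫ e.inv := by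
      rw [← Category.assoc, Iso.eq_comp_inv, hη, Iso.trans_hom, Category.assoc]
    rw [← cancel_epi eX'.hom, reassoc_of% hf', Iso.hom_inv_id_assoc, hα, ha]
    simp only [Category.assoc]
  · rw [← cancel_epi eY'.hom, hg', Category.assoc, Iso.hom_inv_id_assoc, reassoc_of% hβ]

lemma ind_of_pushout [HasBinaryBiproducts (Ind C)] {X Y Z X' Y' : Ind C} {f : X ⟶ Y} {g : Y ⟶ Z}
    {f' : X' ⟶ Y'} {g' : Y' ⟶ Z} {a : X ⟶ X'} {b : Y ⟶ Y'} (hfg : S.ind f g) (hfg' : S.ind f' g')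
    (hl : f ≫ b = a ≫ f') (hr : b ≫ g' = g) :
    S.ind (biprod.lift f (-a)) (biprod.desc b f') := by
  have hE := h.elemExact_of_ind hfg
  have hE' := h.elemExact_of_ind hfg'
  refine h.ind_iff.2 ⟨by simp [biprod.lift_desc, hl], fun t ht => ?_, fun t ht => ?_, fun c z => ?_⟩
  · exact hE.injective t (by simpa using ht =≫ biprod.fst)
  · rw [biprod.desc_eq, Preadditive.comp_add] at ht
    obtain ⟨s, hs⟩ := hE.exact (t ≫ biprod.fst) (by
      have := ht =≫ g'
      simpa [hr, hE'.w] using this)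
    have hsa : s ≫ a + t ≫ biprod.snd = 0 := hE'.injective _ (by
      rw [← ht, Preadditive.add_comp, Category.assoc, ← hl, reassoc_of% hs, Category.assoc])
    exact ⟨s, biprod.hom_ext _ _ (by simpa using hs)
      (by simpa using (eq_neg_of_add_eq_zero_right hsa).symm)⟩
  · obtain ⟨d, p, t, hp, ht⟩ := hE.localEpi c (z ≫ g')
    obtain ⟨s, hs⟩ := hE'.exact (Ind.yoneda.map p ≫ z - t ≫ b) (by
      rw [Preadditive.sub_comp, Category.assoc, Category.assoc, hr, ht, sub_self])
    exact ⟨d, p, biprod.lift t s, hp, by simp [biprod.lift_desc, hs]⟩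

lemma exists_ind_isPushout [HasBinaryBiproducts (Ind C)] {X Y Z X' : Ind C} {f : X ⟶ Y}
    {g : Y ⟶ Z} (hfg : S.ind f g) (a : X ⟶ X') :
    ∃ (Y' : Ind C) (f' : X' ⟶ Y') (b : Y ⟶ Y'), S.ind.AdmissibleMono f' ∧
      S.ind (biprod.lift f (-a)) (biprod.desc b f') ∧ IsPushout f a b f' := by
  obtain ⟨Y', f', b, g', hfg', hl, hr⟩ := h.exists_ind_pushout hfg a
  have hb := h.ind_of_pushout hfg hfg' hl hr
  exact ⟨Y', f', b, ⟨_, _, hfg'⟩, hb, (h.isCok_of_ind hb).isPushout⟩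

lemma exists_ind_isPullback [HasBinaryBiproducts (Ind C)] {X Y Z : Ind C} {g : X ⟶ Z}
    (hg : S.ind.AdmissibleEpi g) (f : Y ⟶ Z) :
    ∃ (P : Ind C) (f' : P ⟶ X) (g' : P ⟶ Y), IsPullback f' g' g f ∧ S.ind.AdmissibleEpi g' := by
  rw [h.ind_admissibleEpi_iff] at hg
  obtain ⟨P, k, hk⟩ := h.exists_ind_of_localEpi (g := biprod.desc g (-f)) fun c z => by
    obtain ⟨d, p, t, hp, ht⟩ := hg c z
    exact ⟨d, p, t ≫ biprod.inl, hp, by simp [ht]⟩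
  have hk' := (h.elemExact_of_ind hk).isKer
  refine ⟨P, k ≫ biprod.fst, k ≫ biprod.snd, hk'.isPullback,
    h.ind_admissibleEpi_iff.2 fun c z => ?_⟩
  obtain ⟨d, p, t, hp, ht⟩ := hg c (z ≫ f)
  obtain ⟨s, hs⟩ := hk'.lift (biprod.lift t (Ind.yoneda.map p ≫ z)) (by simp [biprod.lift_desc, ht])
  exact ⟨d, p, s, hp, by simp [reassoc_of% hs]⟩

lemma ind_admissibleEpi_comp {X Y Z : Ind C} {f : X ⟶ Y} {g : Y ⟶ Z}
    (hf : S.ind.AdmissibleEpi f) (hg : S.ind.AdmissibleEpi g) : S.ind.AdmissibleEpi (f ≫ g) := by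
  rw [h.ind_admissibleEpi_iff] at *
  intro c z
  obtain ⟨d, p, t, hp, ht⟩ := hg c z
  obtain ⟨d', p', t', hp', ht'⟩ := hf d t
  exact ⟨d', p' ≫ p, t', h.epi_comp hp' hp, by simp [reassoc_of% ht', ht]⟩

lemma ind_comp_of_pushout [HasBinaryBiproducts (Ind C)] {X Y Z Q P : Ind C} {f : X ⟶ Y}
    {p : Y ⟶ Q} {g : Y ⟶ Z} {b : Z ⟶ P} {f' : Q ⟶ P} (hp : S.ind f p)
    (hg : ∀ {c : C} (t : Ind.yoneda.obj c ⟶ Y), t ≫ g = 0 → t = 0)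
    (hP : S.ind (biprod.lift g (-p)) (biprod.desc b f')) : S.ind (f ≫ g) b := by
  have hE := h.elemExact_of_ind hp
  have hE' := h.elemExact_of_ind hP
  have w : g ≫ b = p ≫ f' := by simpa [biprod.lift_desc, add_neg_eq_zero] using hE'.w
  refine h.ind_iff.2 ⟨?_, fun t ht => ?_, fun t ht => ?_, fun c z => ?_⟩
  · rw [Category.assoc, w, ← Category.assoc, hE.w, zero_comp]
  · exact hE.injective _ (hg _ (by simpa using ht))
  · obtain ⟨s, hs⟩ := hE'.exact (biprod.lift t 0) (by simp [biprod.lift_desc, ht])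
    have hsg : s ≫ g = t := by simpa using hs =≫ biprod.fst
    have hsp : s ≫ p = 0 := by simpa using hs =≫ biprod.snd
    obtain ⟨r, hr⟩ := hE.exact s hsp
    exact ⟨r, by rw [← Category.assoc, hr, hsg]⟩
  · obtain ⟨d, e, t, he, ht⟩ := hE'.localEpi c z
    obtain ⟨d', e', s, he', hs⟩ := hE.localEpi d (t ≫ biprod.snd)
    refine ⟨d', e' ≫ e, Ind.yoneda.map e' ≫ t ≫ biprod.fst + s ≫ g, h.epi_comp he' he, ?_⟩
    rw [Functor.map_comp, Category.assoc, ← ht, Preadditive.add_comp, Category.assoc s, w,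
      reassoc_of% hs, biprod.desc_eq]
    simp

lemma ind_admissibleMono_comp [HasBinaryBiproducts (Ind C)] {X Y Z : Ind C} {f : X ⟶ Y} {g : Y ⟶ Z}
    (hf : S.ind.AdmissibleMono f) (hg : S.ind.AdmissibleMono g) :
    S.ind.AdmissibleMono (f ≫ g) := by
  obtain ⟨Q, p, hp⟩ := hf
  obtain ⟨R, q, hq⟩ := hg
  obtain ⟨P, f', b, -, hP, -⟩ := h.exists_ind_isPushout hq p
  exact ⟨P, b, h.ind_comp_of_pushout hp (h.elemExact_of_ind hq).injective hP⟩

theorem ind : IsExactCore (Ind C) S.ind :=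
  have := h.hasFiniteBiproducts
  have : HasBinaryBiproducts (Ind C) := hasBinaryBiproducts_of_finite_biproducts _
  { hasFiniteBiproducts := inferInstance
    of_iso := SequenceClass.ind_of_iso
    ker := fun hfg => (h.elemExact_of_ind hfg).isKer
    cok := h.isCok_of_ind
    split := fun i₁ p₁ i₂ p₂ h₁₁ h₂₂ h₁₂ _ hsum => h.ind_iff.2 ⟨h₁₂,
      fun t ht => by simpa [h₁₁] using ht =≫ p₁,
      fun t ht => ⟨t ≫ p₁, by simpa [reassoc_of% ht] using t ≫= hsum⟩,
      fun c z => ⟨c, 𝟙 c, z ≫ i₂, h.admissibleEpi_id c, by simp [h₂₂]⟩⟩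
    epi_comp := h.ind_admissibleEpi_comp
    mono_comp := h.ind_admissibleMono_comp
    epi_pullback := h.exists_ind_isPullback
    mono_pushout := fun hg f => by
      obtain ⟨Q, q, hq⟩ := hg
      obtain ⟨P, f', b, hf', -, hP⟩ := h.exists_ind_isPushout hq f
      exact ⟨P, b, f', hP, hf'⟩ }

lemma of_ind {X Y Z : C} {f : X ⟶ Y} {g : Y ⟶ Z}
    (hfg : S.ind (Ind.yoneda.map f) (Ind.yoneda.map g)) :
    S f g := by
  have hE := h.elemExact_of_ind hfg
  obtain ⟨d, p, t, hp, ht⟩ := hE.localEpi Z (𝟙 _)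
  obtain ⟨t, rfl⟩ := Ind.yoneda.map_surjective t
  have htg : t ≫ g = p := Ind.yoneda.map_injective (by simpa using ht)
  refine h.of_isKer_of_comp (t := t) ⟨Ind.yoneda.map_injective (by simpa using hE.w), ?_,
    fun {T} s hs => ?_⟩ (htg ▸ hp)
  · have := hE.isKer.mono
    exact Ind.yoneda.mono_of_mono_map this
  · obtain ⟨r, hr⟩ := hE.exact (Ind.yoneda.map s)
      (by rw [← Functor.map_comp, hs, Functor.map_zero])
    obtain ⟨r, rfl⟩ := Ind.yoneda.map_surjective r
    exact ⟨r, Ind.yoneda.map_injective (by simpa using hr)⟩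

lemma ind_map {X Y Z : C} {f : X ⟶ Y} {g : Y ⟶ Z} (hfg : S f g) :
    S.ind (Ind.yoneda.map f) (Ind.yoneda.map g) := by
  refine h.ind_iff.2 ⟨by rw [← Functor.map_comp, (h.ker hfg).w, Functor.map_zero], fun t ht => ?_,
    fun t ht => ?_, fun c z => ?_⟩
  · have := (h.ker hfg).mono
    obtain ⟨t, rfl⟩ := Ind.yoneda.map_surjective t
    rw [← Functor.map_comp, Functor.map_eq_zero_iff] at ht
    rw [(cancel_mono f).1 (ht.trans zero_comp.symm), Functor.map_zero]
  · obtain ⟨t, rfl⟩ := Ind.yoneda.map_surjective t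
    rw [← Functor.map_comp, Functor.map_eq_zero_iff] at ht
    obtain ⟨s, rfl⟩ := (h.ker hfg).lift t ht
    exact ⟨Ind.yoneda.map s, by simp⟩
  · obtain ⟨z, rfl⟩ := Ind.yoneda.map_surjective z
    obtain ⟨d, p, x, hp, hx⟩ := h.exists_local_lift ⟨_, _, hfg⟩ z
    exact ⟨d, p, Ind.yoneda.map x, hp, by rw [← Functor.map_comp, hx, Functor.map_comp]⟩

theorem pro : IsExactCore (Pro C) S.pro := h.op.ind.op

end IsExactCore

/-! ### Full subcategories closed under extensions -/

lemma IsExactCore.exists_pullback {C : Type u} [Category.{v} C] [Preadditive C]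
    {S : SequenceClass C} (h : IsExactCore C S) {X Y Z Z' : C} {f : X ⟶ Y} {g : Y ⟶ Z}
    (hfg : S f g) (c : Z' ⟶ Z) :
    ∃ (P : C) (f' : X ⟶ P) (b : P ⟶ Y) (g' : P ⟶ Z'), IsPullback b g' g c ∧ S f' g' ∧
      f' ≫ b = f := by
  obtain ⟨P, f', b, q, hP, hg', hb⟩ := h.op.exists_pushout (f := g.op) (g := f.op) hfg c.op
  exact ⟨P.unop, q.unop, b.unop, f'.unop, hP.flip.unop, hg',
    congrArg Quiver.Hom.unop hb⟩

section Subcategory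

universe v' u'

variable {B : Type u'} [Category.{v'} B] {D : Type u} [Category.{v} D]
  (S : SequenceClass D) (ι : B ⥤ D)

/-- The essential image of `ι` contains the middle term of every sequence of the class `S` whose
outer terms are in the image of `ι`. -/
def IsExtensionClosed : Prop :=
  ∀ (X Z : B) (Y : D) (f : ι.obj X ⟶ Y) (g : Y ⟶ ι.obj Z), S f g → ι.essImage Y

variable {S ι}

lemma IsExtensionClosed.op (hext : IsExtensionClosed S ι) : IsExtensionClosed S.op ι.op :=
  fun _ _ _ _ _ hfg =>
    have ⟨W, ⟨e⟩⟩ := hext _ _ _ _ _ hfg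
    ⟨.op W, ⟨e.symm.op⟩⟩

lemma preimage_op_admissibleEpi_iff {X Y : Bᵒᵖ} (f : X ⟶ Y) :
    (S.op.preimage ι.op).AdmissibleEpi f ↔ (S.preimage ι).AdmissibleMono f.unop :=
  op_admissibleEpi_iff (S := S.preimage ι) f

variable [Preadditive D] [ι.Full]

lemma IsExactCore.preimage_admissibleEpi_comp (h : IsExactCore D S) (hext : IsExtensionClosed S ι)
    {X Y Z : B} {f : X ⟶ Y} {g : Y ⟶ Z} (hf : (S.preimage ι).AdmissibleEpi f)
    (hg : (S.preimage ι).AdmissibleEpi g) : (S.preimage ι).AdmissibleEpi (f ≫ g) := by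
  obtain ⟨K, k, hk⟩ := hf
  obtain ⟨L, l, hl⟩ := hg
  obtain ⟨M, m, hm⟩ := h.epi_comp ⟨_, _, hk⟩ ⟨_, _, hl⟩
  obtain ⟨u, v, -, -, huv⟩ := h.exists_kernel_sequence hk hl hm
  obtain ⟨M', ⟨e⟩⟩ := hext _ _ _ _ _ huv
  obtain ⟨m', hm'⟩ := ι.map_surjective (e.hom ≫ m)
  exact ⟨M', m', h.of_iso ⟨e.symm, Iso.refl _, Iso.refl _, by simp [hm'], by simp⟩ hm⟩

variable [ι.Faithful]

lemma IsExactCore.preimage_exists_isPullback (h : IsExactCore D S) (hext : IsExtensionClosed S ι)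
    {X Y Z : B} {g : X ⟶ Z} (hg : (S.preimage ι).AdmissibleEpi g) (f : Y ⟶ Z) :
    ∃ (P : B) (f' : P ⟶ X) (g' : P ⟶ Y), IsPullback f' g' g f ∧
      (S.preimage ι).AdmissibleEpi g' := by
  obtain ⟨K, k, hk⟩ := hg
  obtain ⟨P, k', b, g', hP, hg', -⟩ := h.exists_pullback hk (ι.map f)
  obtain ⟨P', ⟨e⟩⟩ := hext _ _ _ _ _ hg'
  obtain ⟨b', hb'⟩ := ι.map_surjective (e.hom ≫ b)
  obtain ⟨g'', hg''⟩ := ι.map_surjective (e.hom ≫ g')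
  obtain ⟨k'', hk''⟩ := ι.map_surjective (k' ≫ e.inv)
  refine ⟨P', b', g'', ?_, K, k'', ?_⟩
  · refine IsPullback.of_map ι (ι.map_injective ?_) ?_
    · simp [hb', hg'', hP.w]
    · exact hP.of_iso e.symm (Iso.refl _) (Iso.refl _) (Iso.refl _) (by simp [hb']) (by simp [hg''])
        (by simp) (by simp)
  · exact h.of_iso ⟨Iso.refl _, e.symm, Iso.refl _, by simp [hk''], by simp [hg'']⟩ hg'

variable [Preadditive B] [ι.Additive]

lemma IsKer.of_map {X Y Z : B} {f : X ⟶ Y} {g : Y ⟶ Z} (h : IsKer (ι.map f) (ι.map g)) :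
    IsKer f g where
  w := ι.map_injective (by simpa using h.w)
  mono := ι.mono_of_mono_map h.mono
  lift t ht := by
    obtain ⟨s, hs⟩ := h.lift (ι.map t) (by rw [← ι.map_comp, ht, ι.map_zero])
    obtain ⟨s, rfl⟩ := ι.map_surjective s
    exact ⟨s, ι.map_injective (by simpa using hs)⟩

lemma IsCok.of_map {X Y Z : B} {f : X ⟶ Y} {g : Y ⟶ Z} (h : IsCok (ι.map f) (ι.map g)) :
    IsCok f g where
  w := ι.map_injective (by simpa using h.w)
  epi := ι.epi_of_epi_map h.epi
  desc t ht := by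
    obtain ⟨s, hs⟩ := h.desc (ι.map t) (by rw [← ι.map_comp, ht, ι.map_zero])
    obtain ⟨s, rfl⟩ := ι.map_surjective s
    exact ⟨s, ι.map_injective (by simpa using hs)⟩

lemma IsExactCore.hasBinaryBiproducts_of_isExtensionClosed (h : IsExactCore D S)
    (hext : IsExtensionClosed S ι) : HasBinaryBiproducts B := by
  have := h.hasBinaryBiproducts
  refine ⟨fun X Z => ?_⟩
  have hS : S (biprod.inl : ι.obj X ⟶ ι.obj X ⊞ ι.obj Z) biprod.snd :=
    h.split _ biprod.fst biprod.inr _ (by simp) (by simp) (by simp) (by simp) (by simp)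
  obtain ⟨Y, ⟨e⟩⟩ := hext _ _ _ _ _ hS
  let b : BinaryBicone X Z :=
    { pt := Y
      inl := ι.preimage (biprod.inl ≫ e.inv)
      inr := ι.preimage (biprod.inr ≫ e.inv)
      fst := ι.preimage (e.hom ≫ biprod.fst)
      snd := ι.preimage (e.hom ≫ biprod.snd)
      inl_fst := ι.map_injective (by simp)
      inl_snd := ι.map_injective (by simp)
      inr_fst := ι.map_injective (by simp)
      inr_snd := ι.map_injective (by simp) }
  refine hasBinaryBiproduct_of_total b (ι.map_injective ?_)
  simp only [b, Functor.map_add, Functor.map_comp, Functor.map_preimage, Category.assoc,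
    ← Preadditive.comp_add]
  rw [← Category.assoc biprod.fst, ← Category.assoc biprod.snd, ← Preadditive.add_comp,
    biprod.total]
  simp

theorem IsExactCore.preimage [HasZeroObject B] (h : IsExactCore D S)
    (hext : IsExtensionClosed S ι) : IsExactCore B (S.preimage ι) where
  hasFiniteBiproducts :=
    have := h.hasBinaryBiproducts_of_isExtensionClosed hext
    have : HasFiniteProducts B := hasFiniteProducts_of_has_binary_and_terminal
    .of_hasFiniteProducts
  of_iso := by
    rintro X Y Z X' Y' Z' f g f' g' ⟨a, b, c, hab, hbc⟩ hfg
    exact h.of_iso ⟨ι.mapIso a, ι.mapIso b, ι.mapIso c, by simp [← Functor.map_comp, hab],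
      by simp [← Functor.map_comp, hbc]⟩ hfg
  ker hfg := .of_map (h.ker hfg)
  cok hfg := .of_map (h.cok hfg)
  split i₁ p₁ i₂ p₂ h₁₁ h₂₂ h₁₂ h₂₁ hsum := h.split _ (ι.map p₁) (ι.map i₂) _
    (by rw [← ι.map_comp, h₁₁, ι.map_id]) (by rw [← ι.map_comp, h₂₂, ι.map_id])
    (by rw [← ι.map_comp, h₁₂, ι.map_zero]) (by rw [← ι.map_comp, h₂₁, ι.map_zero])
    (by rw [← ι.map_comp, ← ι.map_comp, ← ι.map_add, hsum, ι.map_id])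
  epi_comp := h.preimage_admissibleEpi_comp hext
  epi_pullback := h.preimage_exists_isPullback hext
  mono_comp {X Y Z f g} hf hg :=
    (preimage_op_admissibleEpi_iff (g.op ≫ f.op)).1 <| h.op.preimage_admissibleEpi_comp hext.op
      ((preimage_op_admissibleEpi_iff g.op).2 hg) ((preimage_op_admissibleEpi_iff f.op).2 hf)
  mono_pushout {X Y Z g} hg f := by
    obtain ⟨P, f', g', hP, hg'⟩ := h.op.preimage_exists_isPullback hext.op (g := g.op)
      ((preimage_op_admissibleEpi_iff g.op).2 hg) f.op
    exact ⟨P.unop, f'.unop, g'.unop, hP.flip.unop, (preimage_op_admissibleEpi_iff g').1 hg'⟩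

end Subcategory

open IndObj

/-! ### Pro-objects -/

section Pro

variable {A : Type u} [Category.{v} A]

/-- The embedding of a category into its category of pro-objects. -/
def Pro.yoneda : A ⥤ Pro A where
  obj a := op (Ind.yoneda.obj (op a))
  map f := (Ind.yoneda.map f.op).op
  map_id a := by rw [op_id, CategoryTheory.Functor.map_id, op_id]
  map_comp f g := by rw [op_comp, Functor.map_comp, op_comp]

instance : (Pro.yoneda (A := A)).Full where
  map_surjective f := by
    obtain ⟨g, hg⟩ := Ind.yoneda.map_surjective f.unop
    exact ⟨g.unop, Quiver.Hom.unop_inj hg⟩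

instance : (Pro.yoneda (A := A)).Faithful where
  map_injective h := Quiver.Hom.op_inj (Ind.yoneda.map_injective (Quiver.Hom.op_inj h))

lemma Pro.isIso_of_bijective {P Q : Pro A} (f : P ⟶ Q)
    (hinj : ∀ (a : A) (s t : Q ⟶ Pro.yoneda.obj a), f ≫ s = f ≫ t → s = t)
    (hsurj : ∀ (a : A) (t : P ⟶ Pro.yoneda.obj a), ∃ s : Q ⟶ Pro.yoneda.obj a, f ≫ s = t) :
    IsIso f := by
  have : IsIso f.unop := IndObj.isIso_of_bijective f.unop
    (fun c s t hst => Quiver.Hom.op_inj (hinj c.unop s.op t.op (Quiver.Hom.unop_inj hst)))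
    (fun c t => by
      obtain ⟨s, hs⟩ := hsurj c.unop t.op
      exact ⟨s.unop, Quiver.Hom.op_inj hs⟩)
  rw [← Quiver.Hom.op_unop f]
  infer_instance

variable [Preadditive A] {E : SequenceClass A}

instance : (Pro.yoneda (A := A)).Additive where
  map_add {a b f g} := by
    change (Ind.yoneda.map (f + g).op).op = (Ind.yoneda.map f.op).op + (Ind.yoneda.map g.op).op
    rw [op_add, Functor.map_add, op_add]

variable (h : IsExactCore A E)
include h

lemma IsExactCore.pro_of_elements {P Q R : Pro A} {f : P ⟶ Q} {g : Q ⟶ R} (w : f ≫ g = 0)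
    (hinj : ∀ (a : A) (t : R ⟶ Pro.yoneda.obj a), g ≫ t = 0 → t = 0)
    (hexact : ∀ (a : A) (t : Q ⟶ Pro.yoneda.obj a), f ≫ t = 0 → ∃ s, g ≫ s = t)
    (hext : ∀ (a : A) (t : P ⟶ Pro.yoneda.obj a),
      ∃ (b : A) (m : a ⟶ b) (s : Q ⟶ Pro.yoneda.obj b),
        E.AdmissibleMono m ∧ f ≫ s = t ≫ Pro.yoneda.map m) :
    E.pro f g := by
  refine (h.op.ind_iff (f := g.unop) (g := f.unop)).2 ⟨Quiver.Hom.op_inj w, fun {c} t ht => ?_,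
    fun {c} t ht => ?_, fun c z => ?_⟩
  · exact Quiver.Hom.op_inj (hinj c.unop t.op (Quiver.Hom.unop_inj ht))
  · obtain ⟨s, hs⟩ := hexact c.unop t.op (Quiver.Hom.unop_inj ht)
    exact ⟨s.unop, Quiver.Hom.op_inj hs⟩
  · obtain ⟨b, m, s, hm, hs⟩ := hext c.unop z.op
    exact ⟨.op b, m.op, s.unop, (op_admissibleEpi_iff (S := E) m.op).2 hm, Quiver.Hom.op_inj hs⟩

lemma IsExactCore.of_pro {X Y Z : A} {f : X ⟶ Y} {g : Y ⟶ Z}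
    (hfg : E.pro (Pro.yoneda.map f) (Pro.yoneda.map g)) : E f g :=
  h.op.of_ind (f := g.op) (g := f.op) hfg

lemma IsExactCore.pro_map {X Y Z : A} {f : X ⟶ Y} {g : Y ⟶ Z} (hfg : E f g) :
    E.pro (Pro.yoneda.map f) (Pro.yoneda.map g) :=
  h.op.ind_map (f := g.op) (g := f.op) hfg

end Pro

/-! ### The pro-objects attached to a diagram -/

section Levels

variable {A : Type u} [Category.{v} A]

/-- The pro-objects `“lim”_i X_{i,j}`, as an inductive system indexed by `j`; its formal inductive
limit is `indProLim`. -/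
def proSystem (X : Pairs ⥤ A) : ULift.{v} ℤ ⥤ Pro A :=
  extend.{v} ⋙ (Functor.whiskeringRight _ _ _).obj X ⋙ proLim A (ULift.{v} ℤ)

/-- The morphism of inductive systems induced by a morphism of diagrams. -/
def proSystemMap {X Y : Pairs ⥤ A} (f : X ⟶ Y) : proSystem X ⟶ proSystem Y :=
  Functor.whiskerLeft extend.{v}
    (Functor.whiskerRight ((Functor.whiskeringRight _ _ _).map f) (proLim A (ULift.{v} ℤ)))

/-- The pro-object `“lim”_i X_{i,j}`. -/
abbrev proObj (X : Pairs ⥤ A) (j : ℤ) : Pro A := (proSystem X).obj ⟨j⟩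

/-- The system of the opposite category whose formal inductive limit is, up to `op`, the pro-object
`proObj X j`; as in `extend`, it is indexed by all integers. -/
abbrev opSystem (X : Pairs ⥤ A) (j : ℤ) : (ULift.{v} ℤ)ᵒᵖ ⥤ Aᵒᵖ :=
  ((extend.{v}.obj ⟨j⟩ : ULift.{v} ℤ ⥤ Pairs) ⋙ X).op

/-- The transition map `“lim”_k X_{k,i} ⟶ “lim”_k X_{k,j}`. -/
def proTrans (X : Pairs ⥤ A) {i j : ℤ} (hij : i ≤ j) : proObj X i ⟶ proObj X j :=
  (proSystem X).map (homOfLE hij)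

lemma proTrans_comp (X : Pairs ⥤ A) {i j k : ℤ} (hij : i ≤ j) (hjk : j ≤ k) :
    proTrans X hij ≫ proTrans X hjk = proTrans X (hij.trans hjk) :=
  ((proSystem X).map_comp _ _).symm

/-- The projections of the limit `proObj X j`, for the indexing by all integers of `extend`. -/
def minProj (X : Pairs ⥤ A) (i j : ℤ) :
    proObj X j ⟶ Pro.yoneda.obj (X.obj (pair (min i j) j (min_le_right i j))) :=
  (limι (opSystem X j) (op ⟨i⟩)).op

/-- The projection `“lim”_k X_{k,j} ⟶ X_{i,j}`. -/
def proπ (X : Pairs ⥤ A) {i j : ℤ} (hij : i ≤ j) :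
    proObj X j ⟶ Pro.yoneda.obj (X.obj (pair i j hij)) :=
  minProj X i j ≫ Pro.yoneda.map (str X (min_le_right i j) hij (min_le_left i j) le_rfl)

lemma str_str (X : Pairs ⥤ A) {i j i' j' i'' j'' : ℤ} (h : i ≤ j) (h' : i' ≤ j') (h'' : i'' ≤ j'')
    (hi : i ≤ i') (hj : j ≤ j') (hi' : i' ≤ i'') (hj' : j' ≤ j'') :
    str X h h' hi hj ≫ str X h' h'' hi' hj' = str X h h'' (hi.trans hi') (hj.trans hj') :=
  (X.map_comp _ _).symm

lemma str_self (X : Pairs ⥤ A) {i j : ℤ} (h : i ≤ j) : str X h h le_rfl le_rfl = 𝟙 _ := X.map_id _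

lemma minProj_str (X : Pairs ⥤ A) {i i' : ℤ} (j : ℤ) (h : i ≤ i') :
    minProj X i j ≫ Pro.yoneda.map (str X (min_le_right i j) (min_le_right i' j)
      (min_le_min_right _ h) le_rfl) = minProj X i' j :=
  Quiver.Hom.unop_inj
    (map_limι (opSystem X j) (i := op ⟨i'⟩) (j := op ⟨i⟩) (Quiver.Hom.op (homOfLE h)))

lemma minProj_eq (X : Pairs ⥤ A) {i j : ℤ} (h : i ≤ j) :
    minProj X i j =
      proπ X h ≫ Pro.yoneda.map (str X h (min_le_right i j) (by simp [h]) le_rfl) := by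
  rw [proπ, Category.assoc, ← Functor.map_comp, str_str, str_self,
    CategoryTheory.Functor.map_id, Category.comp_id]

lemma proπ_str (X : Pairs ⥤ A) {i i' j : ℤ} (h : i ≤ j) (h' : i' ≤ j) (hi : i ≤ i') :
    proπ X h ≫ Pro.yoneda.map (str X h h' hi le_rfl) = proπ X h' := by
  rw [proπ, proπ, ← minProj_str X j hi]
  simp only [Category.assoc, ← Functor.map_comp]
  rfl

lemma proSystemMap_minProj {X Y : Pairs ⥤ A} (f : X ⟶ Y) (i j : ℤ) :
    (proSystemMap f).app ⟨j⟩ ≫ minProj Y i j =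
      minProj X i j ≫ Pro.yoneda.map (f.app (pair (min i j) j (min_le_right i j))) :=
  Quiver.Hom.unop_inj (limι_map
    (NatTrans.op (Functor.whiskerLeft (extend.{v}.obj ⟨j⟩ : ULift.{v} ℤ ⥤ Pairs) f)) (op ⟨i⟩))

lemma proSystemMap_proπ {X Y : Pairs ⥤ A} (f : X ⟶ Y) {i j : ℤ} (h : i ≤ j) :
    (proSystemMap f).app ⟨j⟩ ≫ proπ Y h = proπ X h ≫ Pro.yoneda.map (f.app (pair i j h)) := by
  rw [proπ, ← Category.assoc, proSystemMap_minProj, proπ, Category.assoc, Category.assoc,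
    ← Functor.map_comp, ← Functor.map_comp, ← f.naturality]

lemma proTrans_minProj (X : Pairs ⥤ A) {j j' : ℤ} (h : j ≤ j') (i : ℤ) :
    proTrans X h ≫ minProj X i j' =
      minProj X i j ≫ Pro.yoneda.map (str X (min_le_right i j) (min_le_right i j')
        (min_le_min_left _ h) h) :=
  Quiver.Hom.unop_inj (limι_map (NatTrans.op (Functor.whiskerRight
    (extend.{v}.map (homOfLE h : (⟨j⟩ : ULift.{v} ℤ) ⟶ ⟨j'⟩)) X)) (op ⟨i⟩))

lemma proTrans_proπ (X : Pairs ⥤ A) {i j i' j' : ℤ} (h : i ≤ j) (h' : i' ≤ j') (hi : i ≤ i')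
    (hj : j ≤ j') :
    proTrans X hj ≫ proπ X h' = proπ X h ≫ Pro.yoneda.map (str X h h' hi hj) := by
  rw [← proπ_str X (h.trans hj) h' hi, ← Category.assoc, proπ, ← Category.assoc, proTrans_minProj,
    minProj_eq X h]
  simp only [Category.assoc, ← Functor.map_comp]
  rfl

lemma exists_eq_proπ_comp {X : Pairs ⥤ A} {j : ℤ} {a : A} (t : proObj X j ⟶ Pro.yoneda.obj a) :
    ∃ (i : ℤ) (h : i ≤ j) (s : X.obj (pair i j h) ⟶ a), t = proπ X h ≫ Pro.yoneda.map s := by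
  obtain ⟨i, s, hs⟩ := exists_eq_map_comp_limι
    (F := opSystem X j) t.unop
  have ht : t = minProj X i.unop.down j ≫ Pro.yoneda.map s.unop := Quiver.Hom.unop_inj hs
  refine ⟨min i.unop.down j, min_le_right _ _, s.unop, ?_⟩
  rw [ht, proπ, ← minProj_str X j (min_le_left i.unop.down j)]

lemma exists_eq_proπ_comp_le {X : Pairs ⥤ A} {j : ℤ} {a : A} (t : proObj X j ⟶ Pro.yoneda.obj a)
    (m : ℤ) :
    ∃ (i : ℤ) (_ : i ≤ m) (h : i ≤ j) (s : X.obj (pair i j h) ⟶ a),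
      t = proπ X h ≫ Pro.yoneda.map s := by
  obtain ⟨i, h, s, rfl⟩ := exists_eq_proπ_comp t
  refine ⟨min i m, min_le_right _ _, (min_le_left _ _).trans h,
    str X _ h (min_le_left _ _) le_rfl ≫ s, ?_⟩
  rw [Functor.map_comp, ← Category.assoc, proπ_str]

lemma proObj_hom_ext {X : Pairs ⥤ A} {j : ℤ} {P : Pro A} {f g : P ⟶ proObj X j}
    (hfg : ∀ (i : ℤ) (h : i ≤ j), f ≫ proπ X h = g ≫ proπ X h) : f = g := by
  refine Quiver.Hom.unop_inj (lim_hom_ext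
    (F := opSystem X j) fun i => Quiver.Hom.op_inj ?_)
  change f ≫ minProj X i.unop.down j = g ≫ minProj X i.unop.down j
  rw [← minProj_str X j (min_le_left i.unop.down j), minProj_eq X (min_le_right i.unop.down j)]
  simp only [← Category.assoc, hfg]

lemma exists_proObj_lift {X : Pairs ⥤ A} {j : ℤ} {P : Pro A}
    (τ : ∀ (i : ℤ) (h : i ≤ j), P ⟶ Pro.yoneda.obj (X.obj (pair i j h)))
    (hτ : ∀ (i i' : ℤ) (h : i ≤ j) (h' : i' ≤ j) (hi : i ≤ i'),
      τ i h ≫ Pro.yoneda.map (str X h h' hi le_rfl) = τ i' h') :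
    ∃ f : P ⟶ proObj X j, ∀ (i : ℤ) (h : i ≤ j), f ≫ proπ X h = τ i h := by
  let F := opSystem X j
  let τ' (i : (ULift.{v} ℤ)ᵒᵖ) : Ind.yoneda.obj (F.obj i) ⟶ P.unop :=
    (τ (min i.unop.down j) (min_le_right _ _)).unop
  have hτ' {i i' : (ULift.{v} ℤ)ᵒᵖ} (s : i ⟶ i') : Ind.yoneda.map (F.map s) ≫ τ' i' = τ' i :=
    Quiver.Hom.op_inj (hτ _ _ (min_le_right _ _) (min_le_right _ _)
      (min_le_min_right _ (leOfHom s.unop : i'.unop ≤ i.unop)))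
  obtain ⟨f, hf⟩ : ∃ f : P ⟶ proObj X j, ∀ i, f ≫ minProj X i j = τ (min i j) (min_le_right _ _) :=
    ⟨(limDesc τ' hτ').op, fun i => Quiver.Hom.unop_inj (limι_limDesc τ' hτ' (op ⟨i⟩))⟩
  refine ⟨f, fun i hi => ?_⟩
  rw [proπ, ← Category.assoc, hf, hτ]

end Levels

/-! ### The coprojections to the inductive limit -/

section Admissible

variable {A : Type u} [Category.{v} A] [Preadditive A] {E : SequenceClass A}
  (h : IsExactCore A E) {X : Pairs ⥤ A} (hX : admissible E X)
include h hX

lemma IsExactCore.eq_zero_of_proπ_comp {i j : ℤ} (hij : i ≤ j) {a : A}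
    (s : X.obj (pair i j hij) ⟶ a) (hs : proπ X hij ≫ Pro.yoneda.map s = 0) : s = 0 := by
  have hs' : minProj X i j ≫
      Pro.yoneda.map (str X (min_le_right i j) hij (min_le_left i j) le_rfl ≫ s) = 0 := by
    rw [Functor.map_comp, ← Category.assoc]
    exact hs
  obtain ⟨m, r, hr⟩ := exists_map_eq_zero (F := opSystem X j) (i := Opposite.op ⟨i⟩)
    (a := (str X (min_le_right i j) hij (min_le_left i j) le_rfl ≫ s).op)
    (Quiver.Hom.op_inj hs')
  have hr' : str X (min_le_right m.unop.down j) (min_le_right i j)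
      (min_le_min_right _ (leOfHom r.unop : m.unop ≤ ⟨i⟩)) le_rfl ≫
        str X (min_le_right i j) hij (min_le_left i j) le_rfl ≫ s = 0 := Quiver.Hom.op_inj hr
  have hle : min m.unop.down j ≤ i :=
    (min_le_left _ _).trans (leOfHom r.unop : m.unop ≤ ⟨i⟩)
  rw [← Category.assoc, str_str] at hr'
  have := (h.cok (hX (min m.unop.down j) i j hle hij)).epi
  exact zero_of_epi_comp _ hr'

lemma IsExactCore.isZero_diag (i : ℤ) : IsZero (X.obj (pair i i le_rfl)) := by
  have := (h.ker (hX i i i le_rfl le_rfl)).w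
  rw [str_self] at this
  rw [IsZero.iff_id_eq_zero]
  simpa using this

lemma IsExactCore.pro_proTrans_proπ {i j : ℤ} (hij : i ≤ j) :
    E.pro (proTrans X hij) (proπ X hij) := by
  refine h.pro_of_elements ?_ (fun a t ht => ?_) (fun a t ht => ?_) (fun a t => ?_)
  · have : str X (le_refl i) hij le_rfl hij = 0 := (h.isZero_diag hX i).eq_of_src _ _
    rw [proTrans_proπ X (le_refl i) hij le_rfl hij, this, Functor.map_zero, comp_zero]
  · obtain ⟨s, rfl⟩ := Pro.yoneda.map_surjective t
    rw [h.eq_zero_of_proπ_comp hX hij s ht, Functor.map_zero]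
  · obtain ⟨m, hm, hmj, s, rfl⟩ := exists_eq_proπ_comp_le t i
    rw [← Category.assoc, proTrans_proπ X hm hmj le_rfl hij, Category.assoc,
      ← Functor.map_comp] at ht
    obtain ⟨r, hr⟩ := (h.cok (hX m i j hm hij)).desc s (h.eq_zero_of_proπ_comp hX hm _ ht)
    exact ⟨Pro.yoneda.map r, by rw [← hr, Functor.map_comp, ← Category.assoc, proπ_str]⟩
  · obtain ⟨m, hm, s, rfl⟩ := exists_eq_proπ_comp t
    obtain ⟨b, s', m', hP, hm'⟩ := h.mono_pushout ⟨_, _, hX m i j hm hij⟩ s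
    refine ⟨b, m', proπ X (hm.trans hij) ≫ Pro.yoneda.map s', hm', ?_⟩
    rw [← Category.assoc, proTrans_proπ X hm (hm.trans hij) le_rfl hij, Category.assoc,
      Category.assoc, ← Functor.map_comp, ← Functor.map_comp, hP.w]

lemma IsExactCore.mono_proTrans {i j : ℤ} (hij : i ≤ j) : Mono (proTrans X hij) :=
  (h.pro.ker (h.pro_proTrans_proπ hX hij)).mono

lemma IsExactCore.epi_proπ {i j : ℤ} (hij : i ≤ j) : Epi (proπ X hij) :=
  (h.pro.cok (h.pro_proTrans_proπ hX hij)).epi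

end Admissible

section Coprojections

variable {A : Type u} [Category.{v} A]

/-- The coprojection of the pro-object `“lim”_i X_{i,j}` to the inductive limit. -/
def indProι (X : Pairs ⥤ A) (j : ℤ) : Ind.yoneda.obj (proObj X j) ⟶ (indProLim A).obj X :=
  limι (proSystem X) ⟨j⟩

@[simp]
lemma map_proTrans_indProι (X : Pairs ⥤ A) {i j : ℤ} (hij : i ≤ j) :
    Ind.yoneda.map (proTrans X hij) ≫ indProι X j = indProι X i := map_limι (proSystem X) _

@[simp]
lemma indProι_map {X Y : Pairs ⥤ A} (f : X ⟶ Y) (j : ℤ) :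
    indProι X j ≫ (indProLim A).map f = Ind.yoneda.map ((proSystemMap f).app ⟨j⟩) ≫ indProι Y j :=
  limι_map (proSystemMap f) _

lemma exists_eq_map_comp_indProι {X : Pairs ⥤ A} {P : Pro A}
    (t : Ind.yoneda.obj P ⟶ (indProLim A).obj X) :
    ∃ (j : ℤ) (s : P ⟶ proObj X j), t = Ind.yoneda.map s ≫ indProι X j := by
  obtain ⟨j, s, hs⟩ := exists_eq_map_comp_limι (F := proSystem X) t
  exact ⟨j.down, s, hs⟩

lemma indProLim_hom_ext {X : Pairs ⥤ A} {Y : IndPro A} {f g : (indProLim A).obj X ⟶ Y}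
    (hfg : ∀ j, indProι X j ≫ f = indProι X j ≫ g) : f = g :=
  lim_hom_ext (F := proSystem X) fun j => hfg j.down

lemma IsExactCore.mono_indProι [Preadditive A] {E : SequenceClass A} (h : IsExactCore A E)
    {X : Pairs ⥤ A} (hX : admissible E X) (j : ℤ) : Mono (indProι X j) := by
  refine mono_of_injective _ fun P s t hst => ?_
  obtain ⟨s, rfl⟩ := Ind.yoneda.map_surjective s
  obtain ⟨t, rfl⟩ := Ind.yoneda.map_surjective t
  obtain ⟨k, r, hr⟩ := exists_comp_map_eq (F := proSystem X) hst
  have : Mono ((proSystem X).map r) := h.mono_proTrans hX (leOfHom r : (⟨j⟩ : ULift.{v} ℤ) ≤ k)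
  rw [(cancel_mono _).1 hr]

instance [Preadditive A] : (indProLim A).Additive where
  map_add {X Y f g} := by
    refine indProLim_hom_ext fun j => ?_
    rw [Preadditive.comp_add, indProι_map, indProι_map, indProι_map, ← Preadditive.add_comp,
      ← Functor.map_add]
    congr 2
    refine proObj_hom_ext fun i hi => ?_
    rw [Preadditive.add_comp, proSystemMap_proπ, proSystemMap_proπ, proSystemMap_proπ,
      ← Preadditive.comp_add, ← Functor.map_add]
    rfl

end Coprojections

/-! ### Reindexing -/

lemma exists_bicofinal (R : ℤ → ℤ → Prop)
    (hR : ∀ {a a' j j' : ℤ}, a' ≤ a → j ≤ j' → R a j → R a' j')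
    (hR_right : ∀ a, ∃ j, R a j) (hR_left : ∀ j, ∃ a, R a j) :
    ∃ φ : ℤ →o ℤ, Bicofinal φ ∧ φ ≤ OrderHom.id ∧ ∀ j, R (φ j) j := by
  have exists_greatest (j : ℤ) : ∃ b, (b ≤ j ∧ R b j) ∧ ∀ z, z ≤ j ∧ R z j → z ≤ b := by
    refine Int.exists_greatest_of_bdd ⟨j, fun z hz => hz.1⟩ ?_
    obtain ⟨a, ha⟩ := hR_left j
    exact ⟨min a j, min_le_right _ _, hR (min_le_left _ _) le_rfl ha⟩
  choose φ hφ hmax using exists_greatest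
  refine ⟨⟨φ, fun i j hij => hmax j _ ⟨(hφ i).1.trans hij, hR le_rfl hij (hφ i).2⟩⟩, ⟨?_, ?_⟩,
    fun j => (hφ j).1, fun j => (hφ j).2⟩
  · rw [Filter.tendsto_atTop]
    intro a
    obtain ⟨k, hk⟩ := hR_right a
    filter_upwards [Filter.eventually_ge_atTop (max a k)] with j hj
    exact hmax j a ⟨(le_max_left _ _).trans hj, hR le_rfl ((le_max_right _ _).trans hj) hk⟩
  · exact Filter.tendsto_atBot_mono (fun j => (hφ j).1) Filter.tendsto_id

lemma Bicofinal.exists_comp_le {φ ψ : ℤ →o ℤ} (hφ : Bicofinal φ) (hψ : Bicofinal ψ) :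
    ∃ χ : ℤ →o ℤ, Bicofinal χ ∧ χ ≤ OrderHom.id ∧ ψ.comp χ ≤ φ :=
  exists_bicofinal (fun i j => ψ i ≤ φ j)
    (fun hi hj hij => (ψ.monotone hi).trans (hij.trans (φ.monotone hj)))
    (fun i => (Filter.tendsto_atTop.1 hφ.1 (ψ i)).exists)
    (fun j => (Filter.tendsto_atBot.1 hψ.2 (φ j)).exists)

section Reindexing

variable {A : Type u} [Category.{v} A]

/-- The canonical morphism `X_{χ i, χ j} ⟶ X_{i,j}` of diagrams, for `χ ≤ id`. -/
def fromTilde (X : Pairs ⥤ A) {χ : ℤ →o ℤ} (hχ : ∀ i, χ i ≤ i) : tilde χ ⋙ X ⟶ X :=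
  Functor.whiskerRight (tildeMap (ψ := OrderHom.id) hχ) X

lemma reindexMap_comp {E : SequenceClass A} (X : AdmDiagram E) {φ ψ χ : ℤ →o ℤ} (hφψ : φ ≤ ψ)
    (hψχ : ψ ≤ χ) : reindexMap X hφψ ≫ reindexMap X hψχ = reindexMap X (hφψ.trans hψχ) := by
  ext p
  exact (X.obj.map_comp _ _).symm

variable [Preadditive A] {E : SequenceClass A} (h : IsExactCore A E)
include h

lemma IsExactCore.exists_proObj_tilde_iso {X : Pairs ⥤ A} (hX : admissible E X) {χ : ℤ →o ℤ}
    (hχ : Bicofinal χ) (hle : ∀ i, χ i ≤ i) (j : ℤ) :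
    ∃ u : proObj X (χ j) ≅ proObj (tilde χ ⋙ X) j,
      u.hom ≫ (proSystemMap (fromTilde X hle)).app ⟨j⟩ = proTrans X (hle j) ∧
      ∀ (i : ℤ) (hij : i ≤ j), u.hom ≫ proπ (tilde χ ⋙ X) hij = proπ X (χ.monotone hij) := by
  obtain ⟨u, hu⟩ := exists_proObj_lift (X := tilde χ ⋙ X) (j := j)
    (fun i hi => proπ X (χ.monotone hi)) (fun i i' hi hi' hii' => proπ_str X _ _ (χ.monotone hii'))
  have : IsIso u := by
    refine Pro.isIso_of_bijective u (fun a s t hst => ?_) (fun a t => ?_)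
    · rw [← sub_eq_zero, ← Preadditive.comp_sub] at hst
      rw [← sub_eq_zero]
      obtain ⟨i, hi, q, hq⟩ := exists_eq_proπ_comp (s - t)
      rw [hq, ← Category.assoc, hu] at hst
      have hq_zero : q = 0 := h.eq_zero_of_proπ_comp hX (χ.monotone hi) q hst
      rw [hq, hq_zero, Functor.map_zero, comp_zero]
    · obtain ⟨m, hm, s, rfl⟩ := exists_eq_proπ_comp t
      obtain ⟨i, him, hij⟩ :=
        ((Filter.tendsto_atBot.1 hχ.2 m).and (Filter.eventually_le_atBot j)).exists
      refine ⟨proπ (tilde χ ⋙ X) hij ≫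
        Pro.yoneda.map (str X (χ.monotone hij) hm him le_rfl ≫ s), ?_⟩
      calc u ≫ proπ (tilde χ ⋙ X) hij ≫ Pro.yoneda.map (str X (χ.monotone hij) hm him le_rfl ≫ s)
          = proπ X (χ.monotone hij) ≫
              Pro.yoneda.map (str X (χ.monotone hij) hm him le_rfl ≫ s) := by
            rw [← Category.assoc, hu]; rfl
        _ = proπ X hm ≫ Pro.yoneda.map s := by
            rw [Functor.map_comp, ← Category.assoc, proπ_str]
  refine ⟨asIso u, proObj_hom_ext fun i hi => ?_, hu⟩
  rw [asIso_hom, Category.assoc, proSystemMap_proπ, ← Category.assoc, hu]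
  exact (proTrans_proπ X (χ.monotone hi) hi (hle i) (hle j)).symm

lemma IsExactCore.isIso_map_fromTilde {X : Pairs ⥤ A} (hX : admissible E X) {χ : ℤ →o ℤ}
    (hχ : Bicofinal χ) (hle : ∀ i, χ i ≤ i) : IsIso ((indProLim A).map (fromTilde X hle)) := by
  choose u hu _ using h.exists_proObj_tilde_iso hX hχ hle
  have (j : ℤ) : Mono ((proSystemMap (fromTilde X hle)).app ⟨j⟩) := by
    have := h.mono_proTrans hX (hle j)
    rw [← (Iso.inv_comp_eq _).2 (hu j).symm]
    infer_instance
  refine isIso_of_bijective _ (fun P a b hab => ?_) (fun P t => ?_)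
  · rw [← sub_eq_zero, ← Preadditive.sub_comp] at hab
    rw [← sub_eq_zero]
    obtain ⟨j, c, hc⟩ := exists_eq_map_comp_indProι (a - b)
    have := h.mono_indProι hX j
    rw [hc, Category.assoc, indProι_map, ← Functor.map_comp_assoc] at hab
    have hc_comp := zero_of_comp_mono _ hab
    rw [Functor.map_eq_zero_iff] at hc_comp
    rw [hc, zero_of_comp_mono _ hc_comp, Functor.map_zero, zero_comp]
  · obtain ⟨j, a, rfl⟩ := exists_eq_map_comp_indProι t
    obtain ⟨k, hk⟩ := (Filter.tendsto_atTop.1 hχ.1 j).exists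
    refine ⟨Ind.yoneda.map (a ≫ proTrans X hk ≫ (u k).hom) ≫ indProι _ k, ?_⟩
    rw [Category.assoc, indProι_map, ← Functor.map_comp_assoc, Category.assoc, Category.assoc, hu,
      proTrans_comp X hk (hle k), Functor.map_comp_assoc, map_proTrans_indProι]

/-- The two-out-of-six property, applied to `X_{φχ} ⟶ X_{ψχ} ⟶ X_φ ⟶ X_ψ`. -/
lemma IsExactCore.isIso_map_reindexMap (X : AdmDiagram E) {φ ψ : ℤ →o ℤ} (hφ : Bicofinal φ)
    (hψ : Bicofinal ψ) (hle : φ ≤ ψ) :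
    IsIso (((admissible E).ι ⋙ indProLim A).map (reindexMap X hle)) := by
  obtain ⟨χ, hχ, hχ_le, hψχ⟩ := hφ.exists_comp_le hψ
  have hφψχ : φ.comp χ ≤ ψ.comp χ := fun i => hle (χ i)
  let F := (admissible E).ι ⋙ indProLim A
  have map_comp {α β γ : ℤ →o ℤ} (hαβ : α ≤ β) (hβγ : β ≤ γ) :
      F.map (reindexMap X hαβ) ≫ F.map (reindexMap X hβγ) =
        F.map (reindexMap X (hαβ.trans hβγ)) := by
    rw [← F.map_comp, reindexMap_comp]
  have : IsIso (F.map (reindexMap X (hφψχ.trans hψχ))) :=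
    h.isIso_map_fromTilde (reindex X φ).property hχ hχ_le
  have : IsIso (F.map (reindexMap X (hψχ.trans hle))) :=
    h.isIso_map_fromTilde (reindex X ψ).property hχ hχ_le
  have : Epi (F.map (reindexMap X hψχ)) := epi_of_epi_fac (map_comp hφψχ hψχ)
  have : IsSplitMono (F.map (reindexMap X hψχ)) :=
    .mk' ⟨F.map (reindexMap X hle) ≫ inv (F.map (reindexMap X (hψχ.trans hle))), by
      rw [← Category.assoc, map_comp hψχ hle, IsIso.hom_inv_id]⟩
  have : IsIso (F.map (reindexMap X hψχ)) := isIso_of_epi_of_isSplitMono _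
  exact IsIso.of_isIso_fac_left (map_comp hψχ hle)

lemma IsExactCore.inverts_reindexMaps :
    (reindexMaps E).IsInvertedBy ((admissible E).ι ⋙ indProLim A) := by
  rintro _ _ _ ⟨X, φ, ψ, hφ, hψ, hle⟩
  exact h.isIso_map_reindexMap X hφ hψ hle

end Reindexing

/-! ### Morphisms between the ind-pro-objects of admissible diagrams -/

section Morphisms

variable {A : Type u} [Category.{v} A] [Preadditive A] {E : SequenceClass A}
  (h : IsExactCore A E) {X Y : Pairs ⥤ A}
include h

lemma IsExactCore.eq_of_map_comp_indProι (hX : admissible E X) {P : Pro A} {j : ℤ}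
    {s t : P ⟶ proObj X j} (hst : Ind.yoneda.map s ≫ indProι X j = Ind.yoneda.map t ≫ indProι X j) :
    s = t := by
  have := h.mono_indProι hX j
  exact Ind.yoneda.map_injective ((cancel_mono _).1 hst)

lemma IsExactCore.eq_of_proπ_comp (hX : admissible E X) {i j : ℤ} (hij : i ≤ j) {a : A}
    {s t : X.obj (pair i j hij) ⟶ a}
    (hst : proπ X hij ≫ Pro.yoneda.map s = proπ X hij ≫ Pro.yoneda.map t) : s = t := by
  have := h.epi_proπ hX hij
  exact Pro.yoneda.map_injective ((cancel_epi _).1 hst)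

lemma IsExactCore.indProLim_map_injective (hX : admissible E X) (hY : admissible E Y)
    {f g : X ⟶ Y} (hfg : (indProLim A).map f = (indProLim A).map g) : f = g := by
  ext ⟨⟨i, j⟩, hij⟩
  have happ : (proSystemMap f).app ⟨j⟩ = (proSystemMap g).app ⟨j⟩ :=
    h.eq_of_map_comp_indProι hY (by rw [← indProι_map, ← indProι_map, hfg])
  exact h.eq_of_proπ_comp hX hij (by rw [← proSystemMap_proπ, ← proSystemMap_proπ, happ])

lemma IsExactCore.exists_comp_proTrans_eq (hX : admissible E X) (hY : admissible E Y) {j k l : ℤ}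
    (t : proObj X k ⟶ proObj Y l) (hjl : j ≤ l) :
    ∃ (i : ℤ) (hik : i ≤ k) (r : proObj X i ⟶ proObj Y j),
      r ≫ proTrans Y hjl = proTrans X hik ≫ t := by
  obtain ⟨i, hik, s, hs⟩ := exists_eq_proπ_comp (t ≫ proπ Y hjl)
  obtain ⟨r, hr⟩ := (h.pro.ker (h.pro_proTrans_proπ hY hjl)).lift (proTrans X hik ≫ t) (by
    rw [Category.assoc, hs, ← Category.assoc, (h.pro.ker (h.pro_proTrans_proπ hX hik)).w,
      zero_comp])
  exact ⟨i, hik, r, hr⟩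

lemma IsExactCore.exists_bicofinal_map_comp_eq (hX : admissible E X) (hY : admissible E Y)
    (a : (indProLim A).obj X ⟶ (indProLim A).obj Y) :
    ∃ φ : ℤ →o ℤ, Bicofinal φ ∧ φ ≤ OrderHom.id ∧ ∃ t : ∀ j, proObj X (φ j) ⟶ proObj Y j,
      ∀ j, Ind.yoneda.map (t j) ≫ indProι Y j = indProι X (φ j) ≫ a := by
  obtain ⟨φ, hφ, hle, ht⟩ := exists_bicofinal
    (fun i j => ∃ t : proObj X i ⟶ proObj Y j, Ind.yoneda.map t ≫ indProι Y j = indProι X i ≫ a)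
    (fun hi hj ⟨t, ht⟩ => ⟨proTrans X hi ≫ t ≫ proTrans Y hj, by
      rw [Functor.map_comp, Functor.map_comp, Category.assoc, Category.assoc,
        map_proTrans_indProι, ht, ← Category.assoc, map_proTrans_indProι]⟩)
    (fun i => by
      obtain ⟨j, t, ht⟩ := exists_eq_map_comp_indProι (indProι X i ≫ a)
      exact ⟨j, t, ht.symm⟩)
    (fun j => by
      obtain ⟨k, t, ht⟩ := exists_eq_map_comp_indProι (indProι X 0 ≫ a)
      obtain ⟨i, hi, r, hr⟩ := h.exists_comp_proTrans_eq hX hY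
        (t ≫ proTrans Y (le_max_left k j)) (le_max_right k j)
      refine ⟨i, r, ?_⟩
      rw [← map_proTrans_indProι Y (le_max_right k j), ← Functor.map_comp_assoc, hr,
        Functor.map_comp, Functor.map_comp, Category.assoc, Category.assoc, map_proTrans_indProι,
        ← ht, ← Category.assoc, map_proTrans_indProι])
  choose t ht using ht
  exact ⟨φ, hφ, hle, t, ht⟩

lemma IsExactCore.exists_hom_of_proObj (hX : admissible E X) (hY : admissible E Y) {φ : ℤ →o ℤ}
    (t : ∀ j, proObj X (φ j) ⟶ proObj Y j)
    (ht : ∀ {i j : ℤ} (hij : i ≤ j), proTrans X (φ.monotone hij) ≫ t j = t i ≫ proTrans Y hij) :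
    ∃ f : tilde φ ⋙ X ⟶ Y, ∀ {i j : ℤ} (hij : i ≤ j),
      proπ X (φ.monotone hij) ≫ Pro.yoneda.map (f.app (pair i j hij)) = t j ≫ proπ Y hij := by
  have exists_component {i j : ℤ} (hij : i ≤ j) :
      ∃ f : X.obj (pair (φ i) (φ j) (φ.monotone hij)) ⟶ Y.obj (pair i j hij),
        proπ X (φ.monotone hij) ≫ Pro.yoneda.map f = t j ≫ proπ Y hij := by
    obtain ⟨f, hf⟩ := (h.pro.cok (h.pro_proTrans_proπ hX (φ.monotone hij))).desc (t j ≫ proπ Y hij)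
      (by rw [← Category.assoc, ht hij, Category.assoc,
        (h.pro.ker (h.pro_proTrans_proπ hY hij)).w, comp_zero])
    obtain ⟨f, rfl⟩ := Pro.yoneda.map_surjective f
    exact ⟨f, hf⟩
  choose f hf using @exists_component
  have naturality {i j i' j' : ℤ} (hij : i ≤ j) (hij' : i' ≤ j') (hi : i ≤ i') (hj : j ≤ j') :
      str X (φ.monotone hij) (φ.monotone hij') (φ.monotone hi) (φ.monotone hj) ≫ f hij' =
        f hij ≫ str Y hij hij' hi hj := by
    refine h.eq_of_proπ_comp hX (φ.monotone hij) ?_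
    rw [Functor.map_comp, Functor.map_comp, ← Category.assoc, ← proTrans_proπ, Category.assoc, hf,
      ← Category.assoc, ht, Category.assoc, proTrans_proπ Y hij, ← Category.assoc, ← hf,
      Category.assoc]
  exact ⟨{ app := fun p => f p.2
           naturality := fun p q u => naturality p.2 q.2 (leOfHom u).1 (leOfHom u).2 }, hf⟩

lemma IsExactCore.exists_indProLim_map_eq (hX : admissible E X) (hY : admissible E Y)
    (a : (indProLim A).obj X ⟶ (indProLim A).obj Y) :
    ∃ φ : ℤ →o ℤ, Bicofinal φ ∧ ∃ (hle : φ ≤ OrderHom.id) (f : tilde φ ⋙ X ⟶ Y),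
      (indProLim A).map (fromTilde X hle) ≫ a = (indProLim A).map f := by
  obtain ⟨φ, hφ, hle, t, ht⟩ := h.exists_bicofinal_map_comp_eq hX hY a
  have ht_trans {i j : ℤ} (hij : i ≤ j) :
      proTrans X (φ.monotone hij) ≫ t j = t i ≫ proTrans Y hij :=
    h.eq_of_map_comp_indProι hY (by
      rw [Functor.map_comp, Functor.map_comp, Category.assoc, Category.assoc, ht,
        map_proTrans_indProι, ht, ← Category.assoc, map_proTrans_indProι])
  obtain ⟨f, hf⟩ := h.exists_hom_of_proObj hX hY t ht_trans
  refine ⟨φ, hφ, hle, f, indProLim_hom_ext fun j => ?_⟩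
  have hj : φ j ≤ j := hle j
  obtain ⟨u, hu, hu_proπ⟩ := h.exists_proObj_tilde_iso hX hφ hle j
  have huf : u.hom ≫ (proSystemMap f).app ⟨j⟩ = t j := by
    refine proObj_hom_ext fun i hij => ?_
    rw [Category.assoc, proSystemMap_proπ, ← Category.assoc, hu_proπ]
    exact hf hij
  rw [← cancel_epi (Ind.yoneda.map u.hom), indProι_map, ← Functor.map_comp_assoc, huf, ht,
    ← Category.assoc (indProι _ j), indProι_map, Category.assoc, ← Functor.map_comp_assoc, hu,
    ← Category.assoc, map_proTrans_indProι X hj]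

end Morphisms

/-! ### Calculus of fractions -/

section Fractions

variable {A : Type u} [Category.{v} A] {E : SequenceClass A}

lemma Bicofinal.comp {φ ψ : ℤ →o ℤ} (hφ : Bicofinal φ) (hψ : Bicofinal ψ) :
    Bicofinal (φ.comp ψ) := ⟨hφ.1.comp hψ.1, hφ.2.comp hψ.2⟩

lemma bicofinal_id : Bicofinal OrderHom.id := ⟨Filter.tendsto_id, Filter.tendsto_id⟩

lemma Bicofinal.inf {φ ψ : ℤ →o ℤ} (hφ : Bicofinal φ) (hψ : Bicofinal ψ) :
    Bicofinal (φ ⊓ ψ) := by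
  refine ⟨Filter.tendsto_atTop.2 fun a => ?_,
    Filter.tendsto_atBot_mono (fun i => inf_le_left) hφ.2⟩
  filter_upwards [Filter.tendsto_atTop.1 hφ.1 a, Filter.tendsto_atTop.1 hψ.1 a] with i hφi hψi
  exact le_inf hφi hψi

lemma toBeilinson_obj_surjective : Function.Surjective (toBeilinson E).obj :=
  (Localization.Construction.objEquiv _).surjective

/-- The canonical morphism `X_{φ i, φ j} ⟶ X_{i,j}` of admissible diagrams, for `φ ≤ id`. These are
the denominators of the calculus of fractions. -/
def fromReindex (X : AdmDiagram E) {φ : ℤ →o ℤ} (hφ : φ ≤ OrderHom.id) : reindex X φ ⟶ X :=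
  reindexMap X hφ

lemma isIso_map_fromReindex (X : AdmDiagram E) {φ : ℤ →o ℤ} (hφ : Bicofinal φ)
    (hle : φ ≤ OrderHom.id) : IsIso ((toBeilinson E).map (fromReindex X hle)) :=
  (reindexMaps E).Q_inverts _ (IsReindexMap.mk X φ OrderHom.id hφ bicofinal_id hle)

/-- The morphism `X_{φψ} ⟶ Y_ψ` obtained by reindexing a morphism `X_φ ⟶ Y`. -/
def reindexHom {X Y : AdmDiagram E} {φ : ℤ →o ℤ} (f : reindex X φ ⟶ Y) (ψ : ℤ →o ℤ) :
    reindex X (φ.comp ψ) ⟶ reindex Y ψ :=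
  ObjectProperty.homMk (Functor.whiskerLeft (tilde ψ) f.hom)

lemma reindexHom_fromReindex {X Y : AdmDiagram E} {φ ψ : ℤ →o ℤ} (f : reindex X φ ⟶ Y)
    (hψ : ψ ≤ OrderHom.id) (hle : φ.comp ψ ≤ φ) :
    reindexHom f ψ ≫ fromReindex Y hψ = reindexMap X hle ≫ f := by
  ext p
  exact (f.hom.naturality ((tildeMap hψ).app p)).symm

lemma reindexMap_fromReindex (X : AdmDiagram E) {φ ψ : ℤ →o ℤ} (hφψ : φ ≤ ψ)
    (hψ : ψ ≤ OrderHom.id) :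
    reindexMap X hφψ ≫ fromReindex X hψ = fromReindex X (hφψ.trans hψ) :=
  reindexMap_comp X hφψ hψ

/-- The morphisms of the Beilinson category that are represented by a fraction
`X ⟵ X_φ ⟶ Y`. -/
def IsFraction {X Y : AdmDiagram E} (a : (toBeilinson E).obj X ⟶ (toBeilinson E).obj Y) : Prop :=
  ∃ (φ : ℤ →o ℤ) (_ : Bicofinal φ) (hle : φ ≤ OrderHom.id) (f : reindex X φ ⟶ Y),
    (toBeilinson E).map (fromReindex X hle) ≫ a = (toBeilinson E).map f

lemma IsFraction.comp {X Y Z : AdmDiagram E} {a : (toBeilinson E).obj X ⟶ (toBeilinson E).obj Y}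
    {b : (toBeilinson E).obj Y ⟶ (toBeilinson E).obj Z} (ha : IsFraction a) (hb : IsFraction b) :
    IsFraction (a ≫ b) := by
  obtain ⟨φ, hφ, hφ_le, f, hf⟩ := ha
  obtain ⟨ψ, hψ, hψ_le, g, hg⟩ := hb
  have hle : φ.comp ψ ≤ φ := fun i => φ.monotone (hψ_le i)
  refine ⟨φ.comp ψ, hφ.comp hψ, hle.trans hφ_le, reindexHom f ψ ≫ g, ?_⟩
  rw [Functor.map_comp, ← hg, ← Functor.map_comp_assoc, reindexHom_fromReindex f hψ_le hle,
    Functor.map_comp_assoc, ← hf, ← reindexMap_fromReindex X hle hφ_le, Functor.map_comp_assoc,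
    Category.assoc]

lemma isFraction_map {X Y : AdmDiagram E} (f : X ⟶ Y) : IsFraction ((toBeilinson E).map f) :=
  ⟨OrderHom.id, bicofinal_id, le_rfl, fromReindex X le_rfl ≫ f, (Functor.map_comp _ _ _).symm⟩

/-- If `ψχ ≤ φ`, then `X_ψ ⟵ X_{ψχ} ⟶ X_φ` represents the inverse of `X_φ ⟶ X_ψ`. -/
lemma isFraction_wInv {X Y : AdmDiagram E} (w : X ⟶ Y) (hw : reindexMaps E w) :
    IsFraction (Localization.Construction.wInv w hw) := by
  have hw' := hw
  obtain ⟨X, φ, ψ, hφ, hψ, hle⟩ := hw'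
  obtain ⟨χ, hχ, hχ_le, hψχ⟩ := hφ.exists_comp_le hψ
  refine ⟨χ, hχ, hχ_le, reindexMap X hψχ, ?_⟩
  exact (Iso.comp_inv_eq (Localization.Construction.wIso _ hw)).2
    ((congrArg (toBeilinson E).map (reindexMap_comp X hψχ hle).symm).trans (Functor.map_comp _ _ _))

lemma isFraction {X Y : AdmDiagram E} (a : (toBeilinson E).obj X ⟶ (toBeilinson E).obj Y) :
    IsFraction a := by
  let P : MorphismProperty (BeilinsonCategory E) := fun U V a =>
    IsFraction (X := (Localization.Construction.objEquiv _).symm U)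
      (Y := (Localization.Construction.objEquiv _).symm V) a
  have : P.IsStableUnderComposition := ⟨fun _ _ ha hb => IsFraction.comp ha hb⟩
  have hP : P = ⊤ := Localization.Construction.morphismProperty_eq_top P
    (fun _ _ f => isFraction_map f) (fun _ _ w hw => isFraction_wInv w hw)
  have ha : P a := by rw [hP]; trivial
  exact ha

lemma exists_common_denominator {X Y : AdmDiagram E}
    (a b : (toBeilinson E).obj X ⟶ (toBeilinson E).obj Y) :
    ∃ (φ : ℤ →o ℤ) (_ : Bicofinal φ) (hle : φ ≤ OrderHom.id) (f g : reindex X φ ⟶ Y),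
      (toBeilinson E).map (fromReindex X hle) ≫ a = (toBeilinson E).map f ∧
        (toBeilinson E).map (fromReindex X hle) ≫ b = (toBeilinson E).map g := by
  obtain ⟨φ, hφ, hφ_le, f, hf⟩ := isFraction a
  obtain ⟨ψ, hψ, hψ_le, g, hg⟩ := isFraction b
  refine ⟨φ ⊓ ψ, hφ.inf hψ, inf_le_left.trans hφ_le, reindexMap X inf_le_left ≫ f,
    reindexMap X inf_le_right ≫ g, ?_, ?_⟩
  · rw [Functor.map_comp, ← hf, ← Functor.map_comp_assoc, reindexMap_fromReindex]
  · rw [Functor.map_comp, ← hg, ← Functor.map_comp_assoc, reindexMap_fromReindex]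

end Fractions

section Factorization

variable {A : Type u} [Category.{v} A] {E : SequenceClass A} {ι : BeilinsonCategory E ⥤ IndPro A}
  (e : toBeilinson E ⋙ ι ≅ (admissible E).ι ⋙ indProLim A)
include e

lemma map_toBeilinson_eq_iff {X Y : AdmDiagram E} {f : X ⟶ Y}
    {b : ι.obj ((toBeilinson E).obj X) ⟶ ι.obj ((toBeilinson E).obj Y)} :
    ι.map ((toBeilinson E).map f) = b ↔
      (indProLim A).map f.hom = e.inv.app X ≫ b ≫ e.hom.app Y := by
  have hef := NatIso.naturality_1 e f
  dsimp only [Functor.comp_obj, Functor.comp_map, ObjectProperty.ι_obj, ObjectProperty.ι_map] at hef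
  rw [← hef, cancel_epi, cancel_mono]

variable [Preadditive A]

lemma additive_toBeilinson [Preadditive (BeilinsonCategory E)] [ι.Additive] [ι.Faithful] :
    (toBeilinson E).Additive where
  map_add {X Y f g} := by
    refine ι.map_injective ((map_toBeilinson_eq_iff e).2 ?_)
    rw [Functor.map_add, Preadditive.add_comp, Preadditive.comp_add,
      ← (map_toBeilinson_eq_iff e).1 rfl, ← (map_toBeilinson_eq_iff e).1 rfl, ← Functor.map_add]
    rfl

variable (h : IsExactCore A E)
include h

lemma IsExactCore.faithful_of_iso : ι.Faithful where
  map_injective {U V a b} hab := by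
    obtain ⟨X, rfl⟩ := toBeilinson_obj_surjective U
    obtain ⟨Y, rfl⟩ := toBeilinson_obj_surjective V
    obtain ⟨φ, hφ, hle, f, g, hf, hg⟩ := exists_common_denominator a b
    have := isIso_map_fromReindex X hφ hle
    suffices f = g by
      rw [← cancel_epi ((toBeilinson E).map (fromReindex X hle)), hf, hg, this]
    refine ObjectProperty.hom_ext _ (h.indProLim_map_injective (reindex X φ).property Y.property ?_)
    rw [(map_toBeilinson_eq_iff e).1 rfl, (map_toBeilinson_eq_iff e).1 rfl, ← hf, ← hg,
      Functor.map_comp, Functor.map_comp, hab]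

lemma IsExactCore.full_of_iso : ι.Full where
  map_surjective {U V} b := by
    obtain ⟨X, rfl⟩ := toBeilinson_obj_surjective U
    obtain ⟨Y, rfl⟩ := toBeilinson_obj_surjective V
    obtain ⟨φ, hφ, hle, f, hf⟩ := h.exists_indProLim_map_eq X.property Y.property
      (e.inv.app X ≫ b ≫ e.hom.app Y)
    have := isIso_map_fromReindex X hφ hle
    refine ⟨inv ((toBeilinson E).map (fromReindex X hle)) ≫
      (toBeilinson E).map (ObjectProperty.homMk f : reindex X φ ⟶ Y), ?_⟩
    rw [Functor.map_comp, Functor.map_inv, IsIso.inv_comp_eq, map_toBeilinson_eq_iff e]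
    change (indProLim A).map (fromReindex X hle).hom ≫ _ = _ at hf
    refine hf.symm.trans ?_
    rw [(map_toBeilinson_eq_iff e).1 rfl]
    simp

end Factorization

section ZeroObject

variable {A : Type u} [Category.{v} A] [Preadditive A] {E : SequenceClass A} (h : IsExactCore A E)
include h

open scoped ZeroObject in
lemma IsExactCore.hasZeroObject_admDiagram : HasZeroObject (AdmDiagram E) := by
  have := h.hasFiniteBiproducts
  have : HasZeroObject A := hasZeroObject_of_hasFiniteBiproducts A
  have eq_of_src {b : A} (f g : (0 : A) ⟶ b) : f = g := (isZero_zero A).eq_of_src f g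
  let Z : AdmDiagram E := ⟨(Functor.const Pairs).obj 0, fun i j k hij hjk =>
    h.split _ 0 0 _ (eq_of_src _ _) (eq_of_src _ _) (eq_of_src _ _) (eq_of_src _ _) (eq_of_src _ _)⟩
  exact ⟨Z, ⟨fun Y => ⟨⟨⟨0⟩, fun f => by ext p; exact (isZero_zero A).eq_of_src _ _⟩⟩,
    fun Y => ⟨⟨⟨0⟩, fun f => by ext p; exact (isZero_zero A).eq_of_tgt _ _⟩⟩⟩⟩

lemma IsExactCore.hasZeroObject_beilinson [Preadditive (BeilinsonCategory E)]
    [(toBeilinson E).Additive] : HasZeroObject (BeilinsonCategory E) := by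
  have := h.hasZeroObject_admDiagram
  exact ⟨_, (toBeilinson E).map_isZero (isZero_zero (AdmDiagram E))⟩

end ZeroObject

/-! ### Extensions of ind-objects and pro-objects -/

namespace IsExactCore

section Extensions

variable {C : Type u} [Category.{v} C] [Preadditive C] {S : SequenceClass C}
  (h : IsExactCore C S)
include h

section Ind

variable {X Y Z : Ind C} {f : X ⟶ Y} {g : Y ⟶ Z} (hfg : S.ind f g) {K : Type*} {x : K → C}
  {ξ : ∀ k, Ind.yoneda.obj (x k) ⟶ X}
  (hξ : ∀ (n : C) (r : Ind.yoneda.obj n ⟶ X),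
    ∃ (k : K) (a : n ⟶ x k), r = Ind.yoneda.map a ≫ ξ k)
include hfg hξ

/-- The kernel `n` of `e` maps into some `x k`, and the extension is its pushout. -/
lemma exists_extension_of_lift {c d : C} (ζ : Ind.yoneda.obj c ⟶ Z) {e : d ⟶ c}
    (he : S.AdmissibleEpi e) (t : Ind.yoneda.obj d ⟶ Y) (ht : t ≫ g = Ind.yoneda.map e ≫ ζ) :
    ∃ (k : K) (D : C) (i : x k ⟶ D) (q : D ⟶ c) (m : Ind.yoneda.obj D ⟶ Y) (b : d ⟶ D),
      S i q ∧ Ind.yoneda.map i ≫ m = ξ k ≫ f ∧ m ≫ g = Ind.yoneda.map q ≫ ζ ∧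
        Ind.yoneda.map b ≫ m = t := by
  have hE := h.elemExact_of_ind hfg
  obtain ⟨N, n, hn⟩ := he
  obtain ⟨r, hr⟩ := hE.exact (Ind.yoneda.map n ≫ t) (by
    rw [Category.assoc, ht, ← Functor.map_comp_assoc, (h.ker hn).w, Functor.map_zero, zero_comp])
  obtain ⟨k, a, rfl⟩ := hξ N r
  obtain ⟨D, i, b, q, hP, hiq, hbq⟩ := h.exists_pushout hn a
  have hP_ind : IsPushout (Ind.yoneda.map n) (Ind.yoneda.map a) (Ind.yoneda.map b)
      (Ind.yoneda.map i) :=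
    h.ind.isPushout_of_admissible (h.ind_map hn) (h.ind_map hiq)
      (by rw [← Functor.map_comp, hP.w, Functor.map_comp]) (by rw [← Functor.map_comp, hbq])
  let m : Ind.yoneda.obj D ⟶ Y := hP_ind.desc t (ξ k ≫ f) (by rw [← hr, Category.assoc])
  have hbm : Ind.yoneda.map b ≫ m = t := hP_ind.inl_desc _ _ _
  have him : Ind.yoneda.map i ≫ m = ξ k ≫ f := hP_ind.inr_desc _ _ _
  refine ⟨k, D, i, q, m, b, hiq, him, hP_ind.hom_ext ?_ ?_, hbm⟩
  · rw [reassoc_of% hbm, ht, ← Functor.map_comp_assoc, hbq]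
  · rw [reassoc_of% him, hE.w, comp_zero, ← Functor.map_comp_assoc, (h.ker hiq).w,
      Functor.map_zero, zero_comp]

lemma exists_extension {c : C} (ζ : Ind.yoneda.obj c ⟶ Z) :
    ∃ (k : K) (D : C) (i : x k ⟶ D) (q : D ⟶ c) (m : Ind.yoneda.obj D ⟶ Y),
      S i q ∧ Ind.yoneda.map i ≫ m = ξ k ≫ f ∧ m ≫ g = Ind.yoneda.map q ≫ ζ := by
  obtain ⟨d, e, t, he, ht⟩ := (h.elemExact_of_ind hfg).localEpi c ζ
  obtain ⟨k, D, i, q, m, -, hiq, him, hmg, -⟩ := h.exists_extension_of_lift hfg hξ ζ he t ht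
  exact ⟨k, D, i, q, m, hiq, him, hmg⟩

/-- The extension of `exists_extension` can be chosen to contain an element `t` of `Y` over `ζ`:
add `t` to a local lift of `ζ`. -/
lemma exists_extension_through {c d : C} (ζ : Ind.yoneda.obj c ⟶ Z) (s : d ⟶ c)
    (t : Ind.yoneda.obj d ⟶ Y) (ht : t ≫ g = Ind.yoneda.map s ≫ ζ) :
    ∃ (k : K) (D : C) (i : x k ⟶ D) (q : D ⟶ c) (m : Ind.yoneda.obj D ⟶ Y) (t' : d ⟶ D),
      S i q ∧ Ind.yoneda.map i ≫ m = ξ k ≫ f ∧ m ≫ g = Ind.yoneda.map q ≫ ζ ∧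
        Ind.yoneda.map t' ≫ m = t := by
  have := h.hasBinaryBiproducts
  obtain ⟨d', e, t', he, ht'⟩ := (h.elemExact_of_ind hfg).localEpi c ζ
  obtain ⟨k, D, i, q, m, b, hiq, him, hmg, hbm⟩ := h.exists_extension_of_lift hfg hξ ζ
    (h.admissibleEpi_biprodDesc s he)
    (Ind.yoneda.map biprod.fst ≫ t + Ind.yoneda.map biprod.snd ≫ t') (by
      simp only [Preadditive.add_comp, Category.assoc, ht, ht', biprod.desc_eq, Functor.map_add,
        Functor.map_comp])
  refine ⟨k, D, i, q, m, biprod.inl ≫ b, hiq, him, hmg, ?_⟩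
  rw [Functor.map_comp, Category.assoc, hbm]
  simp [← Functor.map_comp_assoc]

end Ind

lemma exists_iso_of_ind {a c : C} {Y : Ind C} {f : Ind.yoneda.obj a ⟶ Y}
    {g : Y ⟶ Ind.yoneda.obj c} (hfg : S.ind f g) : ∃ b : C, Nonempty (Ind.yoneda.obj b ≅ Y) := by
  obtain ⟨-, D, i, q, m, hiq, him, hmg⟩ :=
    h.exists_extension hfg (ξ := fun _ : Unit => 𝟙 (Ind.yoneda.obj a)) (fun n r => by
      obtain ⟨r, rfl⟩ := Ind.yoneda.map_surjective r
      exact ⟨(), r, (Category.comp_id _).symm⟩) (𝟙 _)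
  have : IsIso m := h.ind.short_five (a := 𝟙 _) (c := 𝟙 _) (h.ind_map hiq) hfg him hmg.symm
  exact ⟨D, ⟨asIso m⟩⟩

lemma exists_iso_of_pro {a c : C} {P : Pro C} {f : Pro.yoneda.obj a ⟶ P}
    {g : P ⟶ Pro.yoneda.obj c} (hfg : S.pro f g) :
    ∃ b : C, Nonempty (P ≅ Pro.yoneda.obj b) := by
  obtain ⟨b, ⟨e⟩⟩ := h.op.exists_iso_of_ind (f := g.unop) (g := f.unop) hfg
  exact ⟨b.unop, ⟨e.op⟩⟩

lemma exists_coextension {P Q R : Pro C} {f : P ⟶ Q} {g : Q ⟶ R} (hfg : S.pro f g) {c : C}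
    (ζ : P ⟶ Pro.yoneda.obj c) {K : Type*} {x : K → C} {ξ : ∀ k, R ⟶ Pro.yoneda.obj (x k)}
    (hξ : ∀ (n : C) (r : R ⟶ Pro.yoneda.obj n),
      ∃ (k : K) (a : x k ⟶ n), r = ξ k ≫ Pro.yoneda.map a) :
    ∃ (k : K) (D : C) (i : c ⟶ D) (q : D ⟶ x k) (m : Q ⟶ Pro.yoneda.obj D),
      S i q ∧ f ≫ m = ζ ≫ Pro.yoneda.map i ∧ m ≫ Pro.yoneda.map q = g ≫ ξ k := by
  obtain ⟨k, D, i, q, m, hiq, him, hmg⟩ :=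
    h.op.exists_extension (f := g.unop) (g := f.unop) hfg (ξ := fun k => (ξ k).unop) (fun n r => by
      obtain ⟨k, a, ha⟩ := hξ n.unop r.op
      exact ⟨k, a.op, Quiver.Hom.op_inj ha⟩) (c := Opposite.op c) ζ.unop
  exact ⟨k, D.unop, q.unop, i.unop, m.op, hiq, Quiver.Hom.unop_inj hmg, Quiver.Hom.unop_inj him⟩

end Extensions

end IsExactCore

/-! ### Chains of pro-objects -/

lemma exists_int_chain {α : Type*} [Nonempty α] (R : α → α → Prop) (hright : ∀ a, ∃ b, R a b)
    (hleft : ∀ b, ∃ a, R a b) : ∃ c : ℤ → α, ∀ n, R (c n) (c (n + 1)) := by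
  choose up hup using hright
  choose down hdown using hleft
  obtain ⟨a⟩ := ‹Nonempty α›
  let c : ℤ → α := fun n => Int.casesOn n (fun n => up^[n] a) (fun n => down^[n + 1] a)
  refine ⟨c, fun n => ?_⟩
  match n with
  | .ofNat n =>
    change R (up^[n] a) (up^[n + 1] a)
    rw [Function.iterate_succ_apply']
    exact hup _
  | .negSucc 0 => exact hdown a
  | .negSucc (n + 1) =>
    change R (down^[n + 2] a) (down^[n + 1] a)
    rw [Function.iterate_succ_apply']
    exact hdown _

lemma exists_le_of_strictMono {k : ℤ → ℤ} (hk : StrictMono k) (b i : ℤ) :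
    ∃ j, i ≤ j ∧ b ≤ k j := by
  obtain ⟨_, ⟨j, rfl⟩, hj⟩ := not_bddAbove_iff.1 hk.not_bddAbove_range_of_isSuccArchimedean b
  exact ⟨max i j, le_max_left i j, hj.le.trans (hk.monotone (le_max_right i j))⟩

lemma exists_ge_of_strictMono {k : ℤ → ℤ} (hk : StrictMono k) (b i : ℤ) :
    ∃ j, j ≤ i ∧ k j ≤ b := by
  obtain ⟨_, ⟨j, rfl⟩, hj⟩ := not_bddBelow_iff.1 hk.not_bddBelow_range_of_isPredArchimedean b
  exact ⟨min i j, min_le_left i j, (hk.monotone (min_le_right i j)).trans hj.le⟩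

section CokernelDiagram

variable {A D : Type*} [Category* A] [Category* D] [Preadditive D] (F : A ⥤ D) [F.Full]
  [F.Faithful] (P : ℤ ⥤ D)

lemma exists_cokernel_diagram {a : ∀ {i j : ℤ}, i ≤ j → A}
    {r : ∀ {i j : ℤ} (hij : i ≤ j), P.obj j ⟶ F.obj (a hij)}
    (hr : ∀ {i j : ℤ} (hij : i ≤ j), IsCok (P.map (homOfLE hij)) (r hij)) :
    ∃ (W : Pairs ⥤ A) (r : ∀ {i j : ℤ} (hij : i ≤ j), P.obj j ⟶ F.obj (W.obj (pair i j hij))),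
      (∀ {i j : ℤ} (hij : i ≤ j), IsCok (P.map (homOfLE hij)) (r hij)) ∧
      ∀ {i j i' j' : ℤ} (hij : i ≤ j) (hij' : i' ≤ j') (hi : i ≤ i') (hj : j ≤ j'),
        r hij ≫ F.map (str W hij hij' hi hj) = P.map (homOfLE hj) ≫ r hij' := by
  have hepi {i j : ℤ} (hij : i ≤ j) : Epi (r hij) := (hr hij).epi
  have exists_map (p q : Pairs) (hpq : p ≤ q) : ∃ s : a p.2 ⟶ a q.2,
      r p.2 ≫ F.map s = P.map (homOfLE hpq.2) ≫ r q.2 := by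
    obtain ⟨s, hs⟩ := (hr p.2).desc (P.map (homOfLE hpq.2) ≫ r q.2) (by
      rw [← P.map_comp_assoc, homOfLE_comp, ← homOfLE_comp hpq.1 q.2, P.map_comp_assoc,
        (hr q.2).w, comp_zero])
    exact ⟨F.preimage s, by rw [F.map_preimage, hs]⟩
  choose s hs using exists_map
  let W : Pairs ⥤ A :=
    { obj := fun p => a p.2
      map := fun {p q} u => s p q (leOfHom u)
      map_id := fun p => F.map_injective (by
        rw [← cancel_epi (r p.2), hs]
        simp)
      map_comp := fun {p q q'} u u' => F.map_injective (by
        rw [← cancel_epi (r p.2), hs, Functor.map_comp, reassoc_of% hs, hs, ← P.map_comp_assoc,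
          homOfLE_comp]) }
  exact ⟨W, r, hr, fun hij hij' hi hj => hs (pair _ _ hij) (pair _ _ hij') ⟨hi, hj⟩⟩

end CokernelDiagram

section Chain

variable {A : Type u} [Category.{v} A] [Preadditive A] {E : SequenceClass A}
  (h : IsExactCore A E) {P : ℤ ⥤ Pro A}
  (hquot : ∀ {i j : ℤ} (hij : i ≤ j), ∃ (a : A) (r : P.obj j ⟶ Pro.yoneda.obj a),
    E.pro (P.map (homOfLE hij)) r)
include h hquot

lemma IsExactCore.exists_quotient_diagram :
    ∃ (W : Pairs ⥤ A) (r : ∀ {i j : ℤ} (hij : i ≤ j),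
      P.obj j ⟶ Pro.yoneda.obj (W.obj (pair i j hij))), admissible E W ∧
      (∀ {i j : ℤ} (hij : i ≤ j), E.pro (P.map (homOfLE hij)) (r hij)) ∧
      ∀ {i j i' j' : ℤ} (hij : i ≤ j) (hij' : i' ≤ j') (hi : i ≤ i') (hj : j ≤ j'),
        r hij ≫ Pro.yoneda.map (str W hij hij' hi hj) = P.map (homOfLE hj) ≫ r hij' := by
  choose a r hr using @hquot
  obtain ⟨W, r', hr', hstr⟩ := exists_cokernel_diagram Pro.yoneda P fun hij => h.pro.cok (hr hij)
  have hquot' {i j : ℤ} (hij : i ≤ j) : E.pro (P.map (homOfLE hij)) (r' hij) :=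
    h.pro.of_isCok ⟨_, _, hr hij⟩ (hr' hij)
  refine ⟨W, r', fun i j k hij hjk => h.of_pro ?_, hquot', hstr⟩
  refine h.pro.quotient_sequence (hquot' hij) (hquot' hjk) (r := r' (hij.trans hjk)) ?_
    (hstr _ _ _ _) ?_
  · rw [← P.map_comp, homOfLE_comp]
    exact hquot' _
  · exact (hstr _ _ _ le_rfl).trans (by simp)

variable (hsep : ∀ (j : ℤ) (a : A) (t : P.obj j ⟶ Pro.yoneda.obj a),
  ∃ (i : ℤ) (hij : i ≤ j), P.map (homOfLE hij) ≫ t = 0)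
include hsep

lemma IsExactCore.exists_iso_proObj :
    ∃ (W : Pairs ⥤ A) (e : ∀ j, P.obj j ≅ proObj W j), admissible E W ∧
      ∀ {i j : ℤ} (hij : i ≤ j), P.map (homOfLE hij) ≫ (e j).hom = (e i).hom ≫ proTrans W hij := by
  obtain ⟨W, r, hW, hr, hstr⟩ := h.exists_quotient_diagram hquot
  have exists_map (j : ℤ) :
      ∃ e : P.obj j ⟶ proObj W j, ∀ (i : ℤ) (hij : i ≤ j), e ≫ proπ W hij = r hij :=
    exists_proObj_lift (fun i hij => r hij) fun i i' hi hi' hii' => by simp [hstr]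
  choose e he using exists_map
  have hiso (j : ℤ) : IsIso (e j) := by
    refine Pro.isIso_of_bijective _ (fun a s t hst => ?_) (fun a t => ?_)
    · rw [← sub_eq_zero, ← Preadditive.comp_sub] at hst
      rw [← sub_eq_zero]
      obtain ⟨i, hi, q, hq⟩ := exists_eq_proπ_comp (s - t)
      have := (h.pro.cok (hr hi)).epi
      rw [hq, reassoc_of% he] at hst
      rw [hq, zero_of_epi_comp _ hst, comp_zero]
    · obtain ⟨i, hij, ht⟩ := hsep j a t
      obtain ⟨q, hq⟩ := (h.pro.cok (hr hij)).desc t ht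
      exact ⟨proπ W hij ≫ q, by rw [reassoc_of% he, hq]⟩
  refine ⟨W, fun j => asIso (e j), hW, fun {i j} hij => proObj_hom_ext fun m hm => ?_⟩
  rw [asIso_hom, asIso_hom, Category.assoc, he, Category.assoc,
    proTrans_proπ W (min_le_right m i) hm (min_le_left m i) hij, reassoc_of% he, hstr]

lemma IsExactCore.exists_iso_indProLim {Y : IndPro A} (m : ∀ j, Ind.yoneda.obj (P.obj j) ⟶ Y)
    (hmono : ∀ j, Mono (m j))
    (hm : ∀ {i j : ℤ} (hij : i ≤ j), Ind.yoneda.map (P.map (homOfLE hij)) ≫ m j = m i)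
    (hexh : ∀ (Q : Pro A) (t : Ind.yoneda.obj Q ⟶ Y), ∃ (j : ℤ) (s : Q ⟶ P.obj j),
      t = Ind.yoneda.map s ≫ m j) :
    ∃ W : Pairs ⥤ A, admissible E W ∧ Nonempty ((indProLim A).obj W ≅ Y) := by
  obtain ⟨W, e, hW, he⟩ := h.exists_iso_proObj hquot hsep
  let τ (j : ULift.{v} ℤ) : Ind.yoneda.obj ((proSystem W).obj j) ⟶ Y :=
    Ind.yoneda.map (e j.down).inv ≫ m j.down
  have hτ {i j : ULift.{v} ℤ} (s : i ⟶ j) : Ind.yoneda.map ((proSystem W).map s) ≫ τ j = τ i := by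
    have hij : i.down ≤ j.down := (leOfHom s : i ≤ j)
    have hs : (proSystem W).map s ≫ (e j.down).inv = (e i.down).inv ≫ P.map (homOfLE hij) := by
      rw [Iso.comp_inv_eq, Category.assoc, he, Iso.inv_hom_id_assoc]
      rfl
    simp only [τ]
    rw [← Functor.map_comp_assoc, hs, Functor.map_comp_assoc, hm]
  have : IsIso (limDesc τ hτ) := by
    refine isIso_limDesc τ hτ (fun Q j a b hab => ⟨j, 𝟙 j, ?_⟩) (fun Q t => ?_)
    · rw [Ind.yoneda.map_injective ((cancel_mono (τ j)).1 hab)]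
    · obtain ⟨j, s, rfl⟩ := hexh Q t
      exact ⟨⟨j⟩, s ≫ (e j).hom, by simp [τ, ← Functor.map_comp_assoc]⟩
  let e' : (Ind.lim (ULift.{v} ℤ)).obj (proSystem W) ≅ Y := asIso (limDesc τ hτ)
  exact ⟨W, hW, ⟨e'⟩⟩

end Chain

/-! ### Extensions of objects of the Beilinson category -/

section ExtensionLattice

variable {A : Type u} [Category.{v} A] {E : SequenceClass A}

variable (E) in
/-- A lattice in the middle term of a sequence `indProLim X ⟶ Y ⟶ indProLim Z`: a pro-object over
`Y` which is an extension, by `i` and `q`, of the term `l` of the filtration of `indProLim Z` by the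
term `k` of the filtration of `indProLim X`. -/
structure ExtensionLattice {X Z : Pairs ⥤ A} {Y : IndPro A} (f : (indProLim A).obj X ⟶ Y)
    (g : Y ⟶ (indProLim A).obj Z) where
  k : ℤ
  l : ℤ
  obj : Pro A
  i : proObj X k ⟶ obj
  q : obj ⟶ proObj Z l
  m : Ind.yoneda.obj obj ⟶ Y
  exact : E.pro i q
  i_m : Ind.yoneda.map i ≫ m = indProι X k ≫ f
  m_g : m ≫ g = Ind.yoneda.map q ≫ indProι Z l

namespace ExtensionLattice

variable {X Z : Pairs ⥤ A} {Y : IndPro A} {f : (indProLim A).obj X ⟶ Y}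
  {g : Y ⟶ (indProLim A).obj Z}

instance : Preorder (ExtensionLattice E f g) where
  le a b := a.k ≤ b.k ∧ a.l ≤ b.l ∧ ∃ u : a.obj ⟶ b.obj, Ind.yoneda.map u ≫ b.m = a.m
  le_refl a := ⟨le_rfl, le_rfl, 𝟙 _, by simp⟩
  le_trans := by
    rintro a b c ⟨hk, hl, u, hu⟩ ⟨hk', hl', w, hw⟩
    exact ⟨hk.trans hk', hl.trans hl', u ≫ w, by rw [Functor.map_comp, Category.assoc, hw, hu]⟩

/-- The inclusion of a lattice in a larger one. -/
def incl {a b : ExtensionLattice E f g} (hab : a ≤ b) : a.obj ⟶ b.obj := hab.2.2.choose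

@[simp]
lemma map_incl_m {a b : ExtensionLattice E f g} (hab : a ≤ b) :
    Ind.yoneda.map (incl hab) ≫ b.m = a.m := hab.2.2.choose_spec

lemma incl_comp {a b c : ExtensionLattice E f g} [Mono c.m] (hab : a ≤ b) (hbc : b ≤ c) :
    incl hab ≫ incl hbc = incl (hab.trans hbc) :=
  Ind.yoneda.map_injective (by simp [← cancel_mono c.m])

lemma i_incl {a b : ExtensionLattice E f g} [Mono b.m] (hab : a ≤ b) :
    a.i ≫ incl hab = proTrans X hab.1 ≫ b.i :=
  Ind.yoneda.map_injective (by
    rw [← cancel_mono b.m, Functor.map_comp, Functor.map_comp, Category.assoc, Category.assoc,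
      map_incl_m, i_m, i_m, ← Category.assoc, map_proTrans_indProι])

lemma q_proTrans {a b : ExtensionLattice E f g} [Mono (indProι Z b.l)] (hab : a ≤ b) :
    a.q ≫ proTrans Z hab.2.1 = incl hab ≫ b.q :=
  Ind.yoneda.map_injective (by
    rw [← cancel_mono (indProι Z b.l), Functor.map_comp, Functor.map_comp, Category.assoc,
      Category.assoc, map_proTrans_indProι, ← m_g, ← m_g, ← map_incl_m hab, Category.assoc])

/-- The functor attached to an increasing family of lattices. -/
def chain {c : ℤ → ExtensionLattice E f g} (hc : Monotone c) [∀ j, Mono (c j).m] : ℤ ⥤ Pro A where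
  obj j := (c j).obj
  map s := incl (hc (leOfHom s))
  map_id j := Ind.yoneda.map_injective (by simp [← cancel_mono (c j).m])
  map_comp _ _ := (incl_comp _ _).symm

variable [Preadditive A] (h : IsExactCore A E)
include h

section Existence

lemma nonempty (hfg : E.pro.ind f g) : Nonempty (ExtensionLattice E f g) := by
  obtain ⟨k, D, i, q, m, hiq, him, hmg⟩ := h.pro.exists_extension hfg
    (fun n r => exists_eq_map_comp_indProι r) (indProι Z 0)
  exact ⟨⟨k, 0, D, i, q, m, hiq, him, hmg⟩⟩

lemma exists_gt (hfg : E.pro.ind f g) (a : ExtensionLattice E f g) :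
    ∃ b, a ≤ b ∧ a.k < b.k ∧ a.l < b.l := by
  obtain ⟨⟨k, hk⟩, D, i, q, m, u, hiq, him, hmg, hu⟩ := h.pro.exists_extension_through hfg
    (ξ := fun k : {k : ℤ // a.k < k} => indProι X k) (fun n r => by
      obtain ⟨k, s, rfl⟩ := exists_eq_map_comp_indProι r
      refine ⟨⟨max k (a.k + 1), by lia⟩, s ≫ proTrans X (le_max_left _ _), ?_⟩
      rw [Functor.map_comp, Category.assoc, map_proTrans_indProι])
    (indProι Z (a.l + 1)) (a.q ≫ proTrans Z (le_add_of_nonneg_right zero_le_one)) a.m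
    (by rw [a.m_g, Functor.map_comp, Category.assoc, map_proTrans_indProι])
  exact ⟨⟨k, a.l + 1, D, i, q, m, hiq, him, hmg⟩, ⟨hk.le, (lt_add_one _).le, u, hu⟩, hk,
    lt_add_one _⟩

lemma exists_lt (hX : admissible E X) (hZ : admissible E Z) (a : ExtensionLattice E f g) :
    ∃ b, b ≤ a ∧ b.k < a.k ∧ b.l < a.l := by
  have hk : a.k - 1 ≤ a.k := by lia
  obtain ⟨⟨n, hn, hn_le⟩, D, i, q, m, hiq, him, hmq⟩ := h.exists_coextension a.exact (proπ X hk)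
    (ξ := fun n : {n : ℤ // n < a.l ∧ n ≤ a.l} => proπ Z n.2.2) (fun c r => by
      obtain ⟨n, hn, hn_le, s, hs⟩ := exists_eq_proπ_comp_le r (a.l - 1)
      exact ⟨⟨n, by lia, hn_le⟩, s, hs⟩)
  obtain ⟨M, r, u, w, -, huw, hur, hrq⟩ := h.pro.exists_middle_kernel a.exact (h.pro_map hiq) him
    hmq.symm (h.pro_proTrans_proπ hX hk) (h.pro_proTrans_proπ hZ hn_le)
  refine ⟨⟨a.k - 1, n, M, u, w, Ind.yoneda.map r ≫ a.m, huw, ?_, ?_⟩, ⟨hk, hn_le, r, rfl⟩,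
    sub_one_lt _, hn⟩
  · rw [← Functor.map_comp_assoc, hur, Functor.map_comp, Category.assoc, a.i_m, ← Category.assoc,
      map_proTrans_indProι]
  · rw [Category.assoc, a.m_g, ← Functor.map_comp_assoc, hrq, Functor.map_comp, Category.assoc,
      map_proTrans_indProι]

lemma exists_monotone (hX : admissible E X) (hZ : admissible E Z) (hfg : E.pro.ind f g) :
    ∃ c : ℤ → ExtensionLattice E f g, Monotone c ∧ StrictMono (fun j => (c j).k) ∧
      StrictMono (fun j => (c j).l) := by
  have := nonempty h hfg
  obtain ⟨c, hc⟩ := exists_int_chain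
    (fun a b : ExtensionLattice E f g => a ≤ b ∧ a.k < b.k ∧ a.l < b.l)
    (exists_gt h hfg) (exists_lt h hX hZ)
  exact ⟨c, monotone_int_of_le_succ fun n => (hc n).1,
    strictMono_int_of_lt_succ fun n => (hc n).2.1, strictMono_int_of_lt_succ fun n => (hc n).2.2⟩

end Existence

lemma mono_m (hX : admissible E X) (hZ : admissible E Z) (hfg : E.pro.ind f g)
    (a : ExtensionLattice E f g) : Mono a.m := by
  have := h.mono_indProι hX a.k
  have := h.mono_indProι hZ a.l
  exact h.pro.ind.mono_middle (h.pro.ind_map a.exact) hfg a.i_m a.m_g.symm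

lemma exists_pro_incl (hX : admissible E X) (hZ : admissible E Z) {a b : ExtensionLattice E f g}
    [Mono b.m] (hab : a ≤ b) : ∃ (c : A) (r : b.obj ⟶ Pro.yoneda.obj c), E.pro (incl hab) r := by
  have := h.mono_indProι hZ b.l
  obtain ⟨Q, r, s, w, hr, hsw, -, -⟩ := h.pro.exists_middle_quotient a.exact b.exact
    (i_incl hab) (q_proTrans hab) (h.pro_proTrans_proπ hX hab.1) (h.pro_proTrans_proπ hZ hab.2.1)
  obtain ⟨c, ⟨e⟩⟩ := h.exists_iso_of_pro hsw
  exact ⟨c, r ≫ e.hom, h.pro.of_iso ⟨Iso.refl _, Iso.refl _, e, by simp, by simp⟩ hr⟩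

section Chain

variable {c : ℤ → ExtensionLattice E f g} (hc : Monotone c) (hk : StrictMono fun j => (c j).k)
  (hl : StrictMono fun j => (c j).l)
include hc hk hl

lemma exists_local_factor (hfg : E.pro.ind f g) {Q : Pro A} (t : Ind.yoneda.obj Q ⟶ Y) :
    ∃ (Q' : Pro A) (p : Q' ⟶ Q) (j : ℤ) (s : Q' ⟶ (c j).obj), E.pro.AdmissibleEpi p ∧
      Ind.yoneda.map p ≫ t = Ind.yoneda.map s ≫ (c j).m := by
  have hE := h.pro.elemExact_of_ind hfg
  obtain ⟨l, z, hz⟩ := exists_eq_map_comp_indProι (t ≫ g)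
  obtain ⟨j, -, hj⟩ := exists_le_of_strictMono hl l 0
  obtain ⟨Q', p, x, hp, hx⟩ := h.pro.exists_local_lift ⟨_, _, (c j).exact⟩ (z ≫ proTrans Z hj)
  obtain ⟨r, hr⟩ := hE.exact (Ind.yoneda.map p ≫ t - Ind.yoneda.map x ≫ (c j).m) (by
    rw [Preadditive.sub_comp, Category.assoc, Category.assoc, hz, m_g,
      ← Category.assoc (Ind.yoneda.map x), ← Functor.map_comp, hx, Functor.map_comp,
      Functor.map_comp, Category.assoc, Category.assoc, map_proTrans_indProι, sub_self])
  obtain ⟨k, r, rfl⟩ := exists_eq_map_comp_indProι r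
  obtain ⟨j', hj', hkj⟩ := exists_le_of_strictMono hk k j
  refine ⟨Q', p, j', x ≫ incl (hc hj') + r ≫ proTrans X hkj ≫ (c j').i, hp, ?_⟩
  rw [Functor.map_add, Preadditive.add_comp, Functor.map_comp, Category.assoc, map_incl_m,
    Functor.map_comp, Functor.map_comp, Category.assoc, Category.assoc, i_m,
    ← Category.assoc (Ind.yoneda.map (proTrans X hkj)), map_proTrans_indProι, ← Category.assoc,
    hr, add_sub_cancel]

variable [∀ j, Mono (c j).m]

lemma exists_eq_map_comp_m (hfg : E.pro.ind f g) {Q : Pro A} (t : Ind.yoneda.obj Q ⟶ Y) :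
    ∃ (j : ℤ) (s : Q ⟶ (c j).obj), t = Ind.yoneda.map s ≫ (c j).m := by
  obtain ⟨Q', p, j, s, ⟨_, _, hp⟩, hs⟩ := exists_local_factor h hc hk hl hfg t
  obtain ⟨s, hs⟩ := h.pro.ind.exists_lift_of_admissibleEpi ⟨_, _, h.pro.ind_map hp⟩ t _ hs
  obtain ⟨s, rfl⟩ := Ind.yoneda.map_surjective s
  exact ⟨j, s, hs.symm⟩

omit hl in
lemma exists_i_incl_comp_eq_zero (hX : admissible E X) {j : ℤ} {a : A}
    (t : (c j).obj ⟶ Pro.yoneda.obj a) :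
    ∃ (i : ℤ) (hij : i ≤ j), (c i).i ≫ incl (hc hij) ≫ t = 0 := by
  obtain ⟨n, hn, s, hs⟩ := exists_eq_proπ_comp ((c j).i ≫ t)
  obtain ⟨i, hij, hni⟩ := exists_ge_of_strictMono hk n j
  refine ⟨i, hij, ?_⟩
  rw [← Category.assoc, i_incl, Category.assoc, hs, ← proTrans_comp X hni hn, Category.assoc,
    ← Category.assoc (proTrans X hn), (h.pro.ker (h.pro_proTrans_proπ hX hn)).w, zero_comp,
    comp_zero]

omit hk [∀ j, Mono (c j).m] in
lemma exists_incl_comp_eq_zero_of_i_comp (hZ : admissible E Z) {j : ℤ} {a : A}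
    {t : (c j).obj ⟶ Pro.yoneda.obj a} (ht : (c j).i ≫ t = 0) :
    ∃ (i : ℤ) (hij : i ≤ j), incl (hc hij) ≫ t = 0 := by
  obtain ⟨w, rfl⟩ := (h.pro.cok (c j).exact).desc t ht
  obtain ⟨n, hn, s, rfl⟩ := exists_eq_proπ_comp w
  obtain ⟨i, hij, hni⟩ := exists_ge_of_strictMono hl n j
  have := h.mono_indProι hZ (c j).l
  refine ⟨i, hij, ?_⟩
  rw [← Category.assoc, ← q_proTrans, ← proTrans_comp Z hni hn, Category.assoc, Category.assoc,
    ← Category.assoc (proTrans Z hn), (h.pro.ker (h.pro_proTrans_proπ hZ hn)).w, zero_comp,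
    comp_zero, comp_zero]

lemma exists_incl_comp_eq_zero (hX : admissible E X) (hZ : admissible E Z) {j : ℤ} {a : A}
    (t : (c j).obj ⟶ Pro.yoneda.obj a) : ∃ (i : ℤ) (hij : i ≤ j), incl (hc hij) ≫ t = 0 := by
  obtain ⟨i, hij, ht⟩ := exists_i_incl_comp_eq_zero h hc hk hX t
  obtain ⟨n, hni, hn⟩ := exists_incl_comp_eq_zero_of_i_comp h hc hl hZ ht
  exact ⟨n, hni.trans hij, by rw [← incl_comp (hc hni) (hc hij), Category.assoc, hn]⟩

end Chain

end ExtensionLattice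

namespace IsExactCore

variable [Preadditive A] (h : IsExactCore A E)
include h

theorem exists_iso_of_extension {X Z : Pairs ⥤ A} (hX : admissible E X) (hZ : admissible E Z)
    {Y : IndPro A} {f : (indProLim A).obj X ⟶ Y} {g : Y ⟶ (indProLim A).obj Z}
    (hfg : E.pro.ind f g) :
    ∃ W : Pairs ⥤ A, admissible E W ∧ Nonempty ((indProLim A).obj W ≅ Y) := by
  obtain ⟨c, hc, hk, hl⟩ := ExtensionLattice.exists_monotone h hX hZ hfg
  have hmono (j : ℤ) : Mono (c j).m := (c j).mono_m h hX hZ hfg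
  exact h.exists_iso_indProLim (P := ExtensionLattice.chain hc)
    (fun hij => ExtensionLattice.exists_pro_incl h hX hZ (hc hij))
    (fun _ _ t => ExtensionLattice.exists_incl_comp_eq_zero h hc hk hl hX hZ t)
    (fun j => (c j).m) hmono (fun hij => ExtensionLattice.map_incl_m (hc hij))
    (fun _ t => ExtensionLattice.exists_eq_map_comp_m h hc hk hl hfg t)

theorem essImage_of_extension {ι : BeilinsonCategory E ⥤ IndPro A}
    (e : toBeilinson E ⋙ ι ≅ (admissible E).ι ⋙ indProLim A) (X Z : BeilinsonCategory E)
    (Y : IndPro A) (f : ι.obj X ⟶ Y) (g : Y ⟶ ι.obj Z) (hfg : E.pro.ind f g) :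
    ι.essImage Y := by
  obtain ⟨X, rfl⟩ := toBeilinson_obj_surjective X
  obtain ⟨Z, rfl⟩ := toBeilinson_obj_surjective Z
  have hfg' : E.pro.ind (e.inv.app X ≫ f) (g ≫ e.hom.app Z) :=
    h.pro.ind.of_iso ⟨e.app X, Iso.refl _, e.app Z, by simp [← Category.assoc], by simp⟩ hfg
  obtain ⟨W, hW, ⟨e'⟩⟩ := h.exists_iso_of_extension X.property Z.property hfg'
  exact ⟨(toBeilinson E).obj ⟨W, hW⟩, ⟨e.app ⟨W, hW⟩ ≪≫ e'⟩⟩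

end IsExactCore

end ExtensionLattice

end Beilinson

end

open Beilinson in
theorem mainTheorem1 {A : Type u} [Category.{v} A] [Preadditive A] (E : SequenceClass A)
    (hE : IsExactStructure A E) :
    ∃ (_ : Preadditive (IndPro A)) (_ : Preadditive (BeilinsonCategory E))
      (ι : BeilinsonCategory E ⥤ IndPro A),
      -- `Ind Pro(A)` is an exact category
      IsExactStructure (IndPro A) E.pro.ind ∧
      -- `ι` is the functor `X ↦ “colim”_j “lim”_i X_{i,j}`; it is additive and fully faithful
      Nonempty (toBeilinson E ⋙ ι ≅ (admissible E).ι ⋙ indProLim A) ∧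
      (toBeilinson E).Additive ∧ ι.Additive ∧ ι.Full ∧ ι.Faithful ∧
      -- its essential image is closed under extensions
      (∀ (X Z : BeilinsonCategory E) (Y : IndPro A) (f : ι.obj X ⟶ Y) (g : Y ⟶ ι.obj Z),
        E.pro.ind f g → ι.essImage Y) ∧
      -- the sequences that `ι` sends to admissible ones make the Beilinson category exact
      IsExactStructure (BeilinsonCategory E) (E.pro.ind.preimage ι) := by
  have h := hE.core
  let ι := Localization.Construction.lift _ h.inverts_reindexMaps
  let e : toBeilinson E ⋙ ι ≅ (admissible E).ι ⋙ indProLim A :=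
    eqToIso (Localization.Construction.fac _ h.inverts_reindexMaps)
  have hfull : ι.Full := h.full_of_iso e
  have hfaithful : ι.Faithful := h.faithful_of_iso e
  let _ : Preadditive (BeilinsonCategory E) := .ofFullyFaithful (.ofFullyFaithful ι)
  have hadd : ι.Additive := Functor.FullyFaithful.additive_ofFullyFaithful (.ofFullyFaithful ι)
  have hadd' : (toBeilinson E).Additive := additive_toBeilinson e
  have := h.hasZeroObject_beilinson
  have hext := h.essImage_of_extension e
  exact ⟨inferInstance, inferInstance, ι, h.pro.ind.exact, ⟨e⟩, hadd', hadd, hfull, hfaithful,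
    hext, (h.pro.ind.preimage hext).exact⟩
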